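/- Write $e(x)=e^{2\pi i x}$ and $q=e(\tau)$ for $\tau$ in the upper half plane $\mathbb H$. Let $G=\mathrm{Mp}_2(\mathbb Z)$ be the group of pairs $\alpha=(A,w)$, $A=\begin{pmatrix}a&b\\c&d\end{pmatrix}\in\mathrm{SL}_2(\mathbb Z)$, $w$ holomorphic on $\mathbb H$ with $w(\tau)^2=c\tau+d$, with multiplication $(A,w)(B,v)=(AB,\,w(B\tau)v(\tau))$, and let $\varepsilon(A,w)=\eta(A\tau)/(\eta(\tau)w(\tau))$ be the linear character of $G$ afforded by the Dedekind eta function. Let $\underline L=(L,\beta)$ be an integral positive definite lattice of rank $n$ (a free $\mathbb Z$-module $L$ of rank $n$ with a $\mathbb Z$-valued symmetric positive definite bilinear form $\beta$); extend $\beta$ bilinearly and put $\beta(x)=\tfrac12\beta(x,x)$. Let $L^\bullet=\{r\in\mathbb Q\otimes L:\beta(r,x)\equiv\beta(x)\bmod\mathbb Z\ \text{for all }x\in L\}$ be its shadow, $L_{\mathrm{ev}}=\{x\in L:\beta(x,x)\in2\mathbb Z\}$, and let the level of $\underline L$ be the smallest positive integer $\ell$ with $\ell\beta(y)\in\mathbb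 Z$ for all $y\in\mathbb Q\otimes L$ with $\beta(y,L_{\mathrm{ev}})\subseteq\mathbb Z$. For $k\in\frac12\mathbb Z$ and a function $\phi$ on $\mathbb H\times(\mathbb C\otimes L)$ put $$(\phi|_{k}\alpha)(\tau,z)=\phi\Big(A\tau,\frac z{c\tau+d}\Big)\,e\Big(\frac{-c\,\beta(z)}{c\tau+d}\Big)\,w(\tau)^{-2k},$$ and for a function $f$ on $\mathbb H$ put $(f|_k\alpha)(\tau)=f(A\tau)w(\tau)^{-2k}$. For $h\in\mathbb Z$ let $J_{k,\underline L}(\varepsilon^h)$ be the space of holomorphic functions $\phi$ on $\mathbb H\times(\mathbb C\otimes L)$ such that (i) $\phi|_k\alpha=\varepsilon^h(\alpha)\phi$ for all $\alpha\in G$; (ii) $\phi(\tau,z+x\tau+y)\,e(\tau\beta(x)+\beta(x,z))=e(\beta(x+y))\,\phi(\tau,z)$ for all $x,y\in L$; (iii) $\phi$ has a Fourier expansion $\phi=\sum_{m\in\frac h{24}+\mathbb Z}\sum_{r\in L^\bullet,\,m\ge\beta(r)}c(m,r)\,q^m e(\beta(r,z))$. Let $M_k(\Gamma(N))$ (with $4\mid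 N$ if $k\notin\mathbb Z$) be the space of modular forms of weight $k$ on $\Gamma(N)$, i.e. of holomorphic functions $f$ on $\mathbb H$ such that $f|_k\alpha$ is bounded for $\mathrm{Im}\,\tau\to\infty$ for all $\alpha\in G$ and such that, for all $\gamma=(A,w)\in G$ with $A\in\Gamma(N)$, one has $f|_k\gamma=f$ if $k\in\mathbb Z$ and $f|_k\gamma=\kappa(\gamma)^{2k}f$ if $k\notin\mathbb Z$, where $\kappa(\gamma)=\theta(A\tau)/(\theta(\tau)w(\tau))$, $\theta=\sum_{r\in\mathbb Z}q^{r^2}$. Let $M_k=\bigcup_N M_k(\Gamma(N))$ over all $N\ge1$ (with $4\mid N$ if $k\notin\mathbb Z$). Let $W(\underline L)$ be the space of all $\lambda:L^\bullet\to\mathbb C$ with $\lambda(r+x)=e(\beta(x))\lambda(r)$ for $r\in L^\bullet$, $x\in L$, let $\vartheta_{\underline L,\lambda}(\tau,z)=\sum_{r\in L^\bullet}\lambda(r)\,q^{\beta(r)}e(\beta(r,z))$ be the basic theta functions, and let $\Theta(\underline L)$ be the space they span. Let $\mathbb C(\varepsilon^h)$ be $\mathbb C$ with the action $(\alpha,z)\mapsto\varepsilon^h(\alpha)z$.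 **Theorem.** Let $k\in\frac12\mathbb Z$, let $\underline L$ be an integral positive definite lattice of rank $n$, and let $h\in\mathbb Z$. The space $M_{k-n/2}$ is stable under $(\alpha,f)\mapsto f|_{k-n/2}\alpha^{-1}$ and $\Theta(\underline L)$ is stable under $(\alpha,\phi)\mapsto\phi|_{n/2}\alpha^{-1}$, so that both are $G$-modules, and the map $f\otimes\vartheta\otimes c\mapsto c\,f\,\vartheta$ restricts to an isomorphism $$\big(M_{k-n/2}\otimes\Theta(\underline L)\otimes\mathbb C(\varepsilon^h)\big)^G\;\xrightarrow{\ \cong\ }\;J_{k,\underline L}(\varepsilon^h).$$ In particular, for every basis $B$ of $W(\underline L)$, every $\phi\in J_{k,\underline L}(\varepsilon^h)$ has a unique theta expansion $\phi=\sum_{\lambda\in B}h_\lambda\,\vartheta_{\underline L,\lambda}$ with $h_\lambda\in M_{k-n/2}$. The same holds with $M_{k-n/2}$ replaced by $M_{k-n/2}(\Gamma(N))$ for every positive integer $N$ which is a multiple of the level of $\underline L$ and of $24/\gcd(h,24)$ (and divisible by $4$ if $k-n/2\notin\mathbb Z$, as required for the definition of $M_{k-n/2}(\Gamma(N))$). 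-/

import Mathlib

open scoped UpperHalfPlane MatrixGroups TensorProduct Manifold

noncomputable section

namespace LatticeJacobi

/-- `e(x) = exp(2πix)`. -/
def e (x : ℂ) : ℂ := Complex.exp (2 * Real.pi * Complex.I * x)

/-- The factor of automorphy `cτ + d` of a matrix with lower row `(c, d)`. -/
def aut (A : SL(2, ℤ)) (τ : ℍ) : ℂ := (A 1 0 : ℂ) * (τ : ℂ) + (A 1 1 : ℂ)

theorem aut_eq_denom (A : SL(2, ℤ)) (τ : ℍ) : aut A τ = UpperHalfPlane.denom A τ := by
  simp [aut, ModularGroup.denom_apply]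

theorem aut_ne_zero (A : SL(2, ℤ)) (τ : ℍ) : aut A τ ≠ 0 := by
  rw [aut_eq_denom]
  exact UpperHalfPlane.denom_ne_zero _ _

theorem aut_mul (A B : SL(2, ℤ)) (τ : ℍ) : aut (A * B) τ = aut A (B • τ) * aut B τ := by
  have hB := aut_ne_zero B τ
  have h1 : ((B • τ : ℍ) : ℂ) = ((B 0 0 : ℂ) * τ + B 0 1) / aut B τ := by
    rw [UpperHalfPlane.coe_specialLinearGroup_apply]
    simp [aut]
  have h2 : aut A (B • τ) * aut B τ = A 1 0 * ((B 0 0 : ℂ) * τ + B 0 1) + A 1 1 * aut B τ := by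
    rw [aut, h1]
    field_simp
  rw [h2]
  simp only [aut, Matrix.SpecialLinearGroup.coe_mul, Matrix.mul_apply, Fin.sum_univ_two]
  push_cast
  ring

theorem aut_one (τ : ℍ) : aut 1 τ = 1 := by simp [aut]

/-! ### The metaplectic group -/

/-- The metaplectic cover `Mp₂(ℤ)` of `SL₂(ℤ)`: pairs `(A, w)` of a matrix `A` in `SL₂(ℤ)` with
lower row `(c, d)` and a holomorphic function `w` on `ℍ` with `w(τ)² = cτ + d`. -/
@[ext]
structure Mp2Z where
  mat : SL(2, ℤ)
  root : ℍ → ℂ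
  holo : MDifferentiable 𝓘(ℂ) 𝓘(ℂ) root
  sq : ∀ τ, root τ ^ 2 = aut mat τ

namespace Mp2Z

theorem root_ne_zero (α : Mp2Z) (τ : ℍ) : α.root τ ≠ 0 := by
  intro h
  have := α.sq τ
  rw [h] at this
  exact aut_ne_zero _ _ (by simpa using this.symm)

theorem mdifferentiable_smul_SL (A : SL(2, ℤ)) :
    MDifferentiable 𝓘(ℂ) 𝓘(ℂ) (fun τ : ℍ ↦ A • τ) :=
  UpperHalfPlane.mdifferentiable_smul (g := (A : GL (Fin 2) ℝ)) (by simp)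

/-- `(A, w) (B, v) = (AB, w(Bτ) v(τ))`. -/
instance : Mul Mp2Z where
  mul α β :=
    { mat := α.mat * β.mat
      root := fun τ ↦ α.root (β.mat • τ) * β.root τ
      holo := (α.holo.comp (mdifferentiable_smul_SL β.mat)).mul β.holo
      sq := fun τ ↦ by rw [mul_pow, α.sq, β.sq, aut_mul] }

instance : One Mp2Z where
  one :=
    { mat := 1
      root := fun _ ↦ 1
      holo := mdifferentiable_const
      sq := fun τ ↦ by simp [aut_one] }

/-- `(A, w)⁻¹ = (A⁻¹, 1 / w(A⁻¹τ))`. -/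
instance : Inv Mp2Z where
  inv α :=
    { mat := α.mat⁻¹
      root := fun τ ↦ (α.root (α.mat⁻¹ • τ))⁻¹
      holo := by
        have h := α.holo.comp (mdifferentiable_smul_SL α.mat⁻¹)
        rw [UpperHalfPlane.mdifferentiable_iff] at h ⊢
        exact h.inv fun z _ ↦ α.root_ne_zero _
      sq := fun τ ↦ by
        have h := aut_mul α.mat α.mat⁻¹ τ
        rw [mul_inv_cancel, aut_one] at h
        rw [inv_pow, α.sq]
        exact inv_eq_of_mul_eq_one_right h.symm }

@[simp] theorem mul_mat (α β : Mp2Z) : (α * β).mat = α.mat * β.mat := rfl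
@[simp] theorem mul_root (α β : Mp2Z) (τ : ℍ) :
    (α * β).root τ = α.root (β.mat • τ) * β.root τ := rfl
@[simp] theorem one_mat : (1 : Mp2Z).mat = 1 := rfl
@[simp] theorem one_root (τ : ℍ) : (1 : Mp2Z).root τ = 1 := rfl
@[simp] theorem inv_mat (α : Mp2Z) : (α⁻¹).mat = α.mat⁻¹ := rfl
@[simp] theorem inv_root (α : Mp2Z) (τ : ℍ) :
    (α⁻¹).root τ = (α.root (α.mat⁻¹ • τ))⁻¹ := rfl

instance : Group Mp2Z :=
  Group.ofLeftAxioms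
    (fun α β γ ↦ by
      ext
      · simp [mul_assoc]
      · simp [mul_assoc, mul_smul])
    (fun α ↦ by ext <;> simp)
    (fun α ↦ by
      ext
      · simp
      · simp [α.root_ne_zero])

end Mp2Z

/-! ### The character of the Dedekind eta function -/

/-- The quotient `η(Aτ) / (η(τ) w(τ))`. -/
def etaQuotient (α : Mp2Z) (τ : ℍ) : ℂ :=
  ModularForm.eta (α.mat • τ : ℍ) / (ModularForm.eta τ * α.root τ)

theorem eta_ne_zero (τ : ℍ) : ModularForm.eta (τ : ℂ) ≠ 0 := ModularForm.eta_ne_zero τ.2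

theorem etaQuotient_ne_zero (α : Mp2Z) (τ : ℍ) : etaQuotient α τ ≠ 0 :=
  div_ne_zero (eta_ne_zero _) (mul_ne_zero (eta_ne_zero _) (α.root_ne_zero _))

theorem etaQuotient_pow (α : Mp2Z) (τ : ℍ) : etaQuotient α τ ^ 24 = 1 := by
  have h := congrFun (SlashInvariantForm.slash_action_generators_SL2Z
    ModularForm.discriminant_S_invariant ModularForm.discriminant_T_invariant α.mat) τ
  rw [ModularForm.SL_slash_apply, ← aut_eq_denom] at h
  simp only [ModularForm.discriminant] at h
  have h1 : α.root τ ^ 24 = aut α.mat τ ^ 12 := by rw [← α.sq τ]; ring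
  have h2 := aut_ne_zero α.mat τ
  have h3 := eta_ne_zero τ
  have h4 : aut α.mat τ ^ (-12 : ℤ) * aut α.mat τ ^ 12 = 1 := by
    rw [zpow_neg, ← zpow_natCast]
    exact inv_mul_cancel₀ (zpow_ne_zero _ h2)
  rw [etaQuotient, div_pow, mul_pow, h1,
    div_eq_one_iff_eq (mul_ne_zero (pow_ne_zero _ h3) (pow_ne_zero _ h2)), ← h, mul_assoc, h4,
    mul_one]

theorem continuous_eta : Continuous fun τ : ℍ ↦ ModularForm.eta (τ : ℂ) :=
  continuous_iff_continuousAt.2 fun τ ↦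
    ContinuousAt.comp (f := fun τ : ℍ ↦ (τ : ℂ))
      (ModularForm.differentiableAt_eta_of_mem_upperHalfPlaneSet τ.2).continuousAt
      UpperHalfPlane.continuous_coe.continuousAt

theorem continuous_etaQuotient (α : Mp2Z) : Continuous (etaQuotient α) := by
  refine Continuous.div ?_ (continuous_eta.mul α.holo.continuous)
    fun τ ↦ mul_ne_zero (eta_ne_zero _) (α.root_ne_zero _)
  exact continuous_eta.comp (Mp2Z.mdifferentiable_smul_SL α.mat).continuous

/-- The quotient `η(Aτ) / (η(τ) w(τ))` does not depend on `τ`. -/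
theorem etaQuotient_const (α : Mp2Z) (τ τ' : ℍ) : etaQuotient α τ = etaQuotient α τ' := by
  have hfin : {z : ℂ | z ^ 24 = 1}.Finite :=
    (Polynomial.nthRootsFinset 24 (1 : ℂ)).finite_toSet.subset fun z hz ↦ by
      simpa [Polynomial.mem_nthRootsFinset] using hz
  have hpre : IsPreconnected (Set.range (etaQuotient α)) :=
    isPreconnected_range (continuous_etaQuotient α)
  have hsub : (Set.range (etaQuotient α)).Subsingleton :=
    (hfin.subset (by
      rintro _ ⟨σ, rfl⟩
      exact etaQuotient_pow α σ)).countable.isTotallyDisconnected _ subset_rfl hpre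
  exact hsub ⟨τ, rfl⟩ ⟨τ', rfl⟩

/-- The linear character `ε(A, w) = η(Aτ) / (η(τ) w(τ))` of `Mp₂(ℤ)`; the quotient is independent
of `τ` by `etaQuotient_const`, and is evaluated at `τ = i`. -/
def eps : Mp2Z →* ℂˣ where
  toFun α := Units.mk0 (etaQuotient α UpperHalfPlane.I) (etaQuotient_ne_zero _ _)
  map_one' := by
    ext
    simpa [etaQuotient] using eta_ne_zero UpperHalfPlane.I
  map_mul' α β := by
    ext
    simp only [Units.val_mk0, Units.val_mul]
    rw [etaQuotient_const α _ (β.mat • UpperHalfPlane.I)]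
    have h1 := eta_ne_zero UpperHalfPlane.I
    have h2 := eta_ne_zero (β.mat • UpperHalfPlane.I)
    have h3 := α.root_ne_zero (β.mat • UpperHalfPlane.I)
    have h4 := β.root_ne_zero UpperHalfPlane.I
    simp only [etaQuotient, Mp2Z.mul_mat, Mp2Z.mul_root, mul_smul]
    field_simp

/-- The `G`-module `ℂ(χ)`: the space `ℂ` on which `α` acts as multiplication by `χ(α)`. -/
def charRep (χ : Mp2Z →* ℂˣ) : Representation ℂ Mp2Z ℂ where
  toFun α := (χ α : ℂ) • LinearMap.id
  map_one' := by ext; simp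
  map_mul' α β := by ext; simp [mul_comm]

/-! ### Modular forms of integral and half-integral weight -/

/-- The slash action of weight `m / 2` on functions on `ℍ`:
`(f | (A, w))(τ) = f(Aτ) w(τ)⁻ᵐ`. -/
def slash (m : ℤ) (α : Mp2Z) (f : ℍ → ℂ) : ℍ → ℂ :=
  fun τ ↦ f (α.mat • τ) * α.root τ ^ (-m)

theorem slash_mul (m : ℤ) (α β : Mp2Z) (f : ℍ → ℂ) :
    slash m (α * β) f = slash m β (slash m α f) := by
  funext τ
  simp only [slash, Mp2Z.mul_mat, Mp2Z.mul_root, mul_smul, mul_zpow]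
  ring

/-- The left action `(α, f) ↦ f | α⁻¹` in weight `m / 2` on all functions on `ℍ`. -/
def slashRep (m : ℤ) : Representation ℂ Mp2Z (ℍ → ℂ) where
  toFun α :=
    { toFun := slash m α⁻¹
      map_add' := fun f g ↦ by funext τ; simp [slash, add_mul]
      map_smul' := fun c f ↦ by funext τ; simp [slash, mul_assoc] }
  map_one' := by ext f τ; simp [slash]
  map_mul' α β := by
    ext1 f
    simp [slash_mul]

/-- `θ(τ) = ∑_{r ∈ ℤ} q^{r²}`. -/
def theta (τ : ℍ) : ℂ := ∑' r : ℤ, e ((r : ℂ) ^ 2 * τ)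

/-- `κ(A, w) = θ(Aτ) / (θ(τ) w(τ))`, which is independent of `τ` if `A ∈ Γ₀(4)`. -/
def kappa (α : Mp2Z) (τ : ℍ) : ℂ := theta (α.mat • τ) / (theta τ * α.root τ)

/-- The multiplier of modular forms of weight `m / 2`: it is trivial if `m / 2` is an integer, and
it is `κᵐ` otherwise. -/
def multiplier (m : ℤ) (α : Mp2Z) (τ : ℍ) : ℂ := if Even m then 1 else kappa α τ ^ m

/-- The space `M_{m/2}(Γ(N))` of modular forms of weight `m / 2` on the principal congruence
subgroup `Γ(N)`: holomorphic functions on `ℍ` which transform under the elements of `Mp₂(ℤ)` over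
`Γ(N)` by the multiplier above and which are bounded at all cusps. If `m` is odd this is
considered only for `4 ∣ N`. -/
def modularFormsLevel (m : ℤ) (N : ℕ) : Submodule ℂ (ℍ → ℂ) where
  carrier := {f | MDifferentiable 𝓘(ℂ) 𝓘(ℂ) f ∧
    (∀ γ : Mp2Z, γ.mat ∈ CongruenceSubgroup.Gamma N →
      ∀ τ, slash m γ f τ = multiplier m γ τ * f τ) ∧
    ∀ α : Mp2Z, UpperHalfPlane.IsBoundedAtImInfty (slash m α f)}
  add_mem' := by
    rintro f g ⟨hf, hf', hf''⟩ ⟨hg, hg', hg''⟩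
    refine ⟨hf.add hg, fun γ hγ τ ↦ ?_, fun α ↦ ?_⟩
    · have h1 := hf' γ hγ τ
      have h2 := hg' γ hγ τ
      simp only [slash, Pi.add_apply, add_mul, mul_add] at *
      rw [h1, h2]
    · have h : slash m α (f + g) = slash m α f + slash m α g := by
        funext τ; simp [slash, add_mul]
      rw [h]
      exact (hf'' α).add (hg'' α)
  zero_mem' := by
    refine ⟨mdifferentiable_const, fun γ _ τ ↦ by simp [slash], fun α ↦ ?_⟩
    have h : slash m α 0 = 0 := by funext τ; simp [slash]
    rw [h]
    exact Filter.const_boundedAtFilter _ (0 : ℂ)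
  smul_mem' := by
    rintro c f ⟨hf, hf', hf''⟩
    refine ⟨hf.const_smul c, fun γ hγ τ ↦ ?_, fun α ↦ ?_⟩
    · have h1 := hf' γ hγ τ
      simp only [slash, Pi.smul_apply, smul_eq_mul] at *
      rw [mul_assoc, h1]
      ring
    · have h : slash m α (c • f) = c • slash m α f := by
        funext τ; simp [slash, mul_assoc]
      rw [h]
      exact (hf'' α).smul c

theorem modularFormsLevel_mono (m : ℤ) {N N' : ℕ} (h : N ∣ N') :
    modularFormsLevel m N ≤ modularFormsLevel m N' := by
  rintro f ⟨h1, h2, h3⟩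
  refine ⟨h1, fun γ hγ ↦ h2 γ ?_, h3⟩
  rw [CongruenceSubgroup.Gamma_mem] at hγ ⊢
  have key : ∀ a b : ℤ, (a : ZMod N') = b → (a : ZMod N) = b := fun a b hab ↦ by
    rw [ZMod.intCast_eq_intCast_iff_dvd_sub] at hab ⊢
    exact (Int.natCast_dvd_natCast.2 h).trans hab
  obtain ⟨a, b, c, d⟩ := hγ
  exact ⟨by simpa using key _ 1 (by simpa using a), by simpa using key _ 0 (by simpa using b),
    by simpa using key _ 0 (by simpa using c), by simpa using key _ 1 (by simpa using d)⟩

/-- The space `M_{m/2} = ⋃_N M_{m/2}(Γ(N))`, where `N ≥ 1`, and `4 ∣ N` if `m / 2` is not an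
integer. -/
def modularForms (m : ℤ) : Submodule ℂ (ℍ → ℂ) where
  carrier := {f | ∃ N : ℕ, 0 < N ∧ (Even m ∨ 4 ∣ N) ∧ f ∈ modularFormsLevel m N}
  add_mem' := by
    rintro f g ⟨N, hN, hN4, hf⟩ ⟨N', hN', _, hg⟩
    exact ⟨N * N', Nat.mul_pos hN hN', hN4.imp id fun h ↦ h.mul_right _,
      add_mem (modularFormsLevel_mono m (dvd_mul_right _ _) hf)
        (modularFormsLevel_mono m (dvd_mul_left _ _) hg)⟩
  zero_mem' := ⟨4, by norm_num, Or.inr dvd_rfl, zero_mem _⟩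
  smul_mem' := by
    rintro c f ⟨N, hN, hN4, hf⟩
    exact ⟨N, hN, hN4, Submodule.smul_mem _ c hf⟩

/-! ### Integral lattices, their shadows and levels -/

section Lattice

variable {L : Type*} [AddCommGroup L] (β : LinearMap.BilinForm ℤ L)

/-- The shadow `{r ∈ ℚ ⊗ L : β(r, x) ≡ β(x, x) / 2 mod ℤ for all x ∈ L}`. -/
def shadow : Set (ℚ ⊗[ℤ] L) :=
  {r | ∀ x : L, ∃ m : ℤ, β.baseChange ℚ r (1 ⊗ₜ x) - (β x x : ℚ) / 2 = m}

/-- The dual `{y ∈ ℚ ⊗ L : β(y, L_ev) ⊆ ℤ}` of the even sublattice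
`L_ev = {x ∈ L : β(x, x) even}`. -/
def dualEven : Set (ℚ ⊗[ℤ] L) :=
  {y | ∀ x : L, Even (β x x) → ∃ m : ℤ, β.baseChange ℚ y (1 ⊗ₜ x) = m}

/-- The level: the smallest positive integer `ℓ` with `ℓ β(y, y) / 2 ∈ ℤ` for all `y` in the dual
of the even sublattice. -/
def level : ℕ :=
  sInf {l : ℕ | 0 < l ∧ ∀ y ∈ dualEven β, ∃ m : ℤ, (l : ℚ) * (β.baseChange ℚ y y / 2) = m}

/-- The inclusion `ℚ ⊗ L → ℂ ⊗ L`. -/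
def ratToComplex : (ℚ ⊗[ℤ] L) →ₗ[ℤ] (ℂ ⊗[ℤ] L) :=
  LinearMap.rTensor L ((algebraMap ℚ ℂ : ℚ →+* ℂ).toAddMonoidHom.toIntLinearMap)

/-- `β(z) = β(z, z) / 2` on `ℂ ⊗ L`. -/
def quad (z : ℂ ⊗[ℤ] L) : ℂ := β.baseChange ℂ z z / 2

/-- The space `W(L)` of functions `lam` on the shadow with `lam(r + x) = e(β(x)) lam(r)` for
`x ∈ L`. -/
def W : Submodule ℂ (shadow β → ℂ) where
  carrier := {lam | ∀ (r r' : shadow β) (x : L),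
    (r' : ℚ ⊗[ℤ] L) = (r : ℚ ⊗[ℤ] L) + 1 ⊗ₜ x → lam r' = e ((β x x : ℂ) / 2) * lam r}
  add_mem' := by
    intro a b ha hb r r' x h
    simp only [Pi.add_apply, ha r r' x h, hb r r' x h, mul_add]
  zero_mem' := by
    intro r r' x h
    simp
  smul_mem' := by
    intro c a ha r r' x h
    simp only [Pi.smul_apply, ha r r' x h, smul_eq_mul]
    ring

/-- The basic theta function
`ϑ_lam(τ, z) = ∑_{r in the shadow} lam(r) q^{β(r)} e(β(r, z))`. -/
def basicTheta (lam : shadow β → ℂ) (τ : ℍ) (z : ℂ ⊗[ℤ] L) : ℂ :=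
  ∑' r : shadow β, lam r *
    e (((β.baseChange ℚ (r : ℚ ⊗[ℤ] L) r / 2 : ℚ) : ℂ) * τ +
      β.baseChange ℂ (ratToComplex (r : ℚ ⊗[ℤ] L)) z)

/-- The space `Θ(L)` spanned by the basic theta functions `ϑ_lam`, `lam ∈ W(L)`. -/
def thetaSpace : Submodule ℂ (ℍ → (ℂ ⊗[ℤ] L) → ℂ) :=
  Submodule.span ℂ (basicTheta β '' (W β : Set (shadow β → ℂ)))

/-! ### Jacobi forms of lattice index -/

/-- The action in weight `m / 2` and index `(L, β)` on functions on `ℍ × (ℂ ⊗ L)`: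
`(φ | (A, w))(τ, z) = φ(Aτ, z / (cτ + d)) e(-c β(z) / (cτ + d)) w(τ)⁻ᵐ`. -/
def jacobiSlash (m : ℤ) (α : Mp2Z) (φ : ℍ → (ℂ ⊗[ℤ] L) → ℂ) : ℍ → (ℂ ⊗[ℤ] L) → ℂ :=
  fun τ z ↦ φ (α.mat • τ) ((aut α.mat τ)⁻¹ • z) *
    e (-(α.mat 1 0 : ℂ) * quad β z / aut α.mat τ) * α.root τ ^ (-m)

theorem aut_cocycle (A B : SL(2, ℤ)) (τ : ℍ) :
    ((A * B) 1 0 : ℂ) / aut (A * B) τ =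
      (A 1 0 : ℂ) / (aut B τ ^ 2 * aut A (B • τ)) + (B 1 0 : ℂ) / aut B τ := by
  have hA := aut_ne_zero A (B • τ)
  have hB := aut_ne_zero B τ
  have h1 : ((B • τ : ℍ) : ℂ) = ((B 0 0 : ℂ) * τ + B 0 1) / aut B τ := by
    rw [UpperHalfPlane.coe_specialLinearGroup_apply]
    simp [aut]
  have h2 : aut A (B • τ) * aut B τ = A 1 0 * ((B 0 0 : ℂ) * τ + B 0 1) + A 1 1 * aut B τ := by
    rw [aut, h1]
    field_simp
  have hdet : (B 0 0 : ℂ) * B 1 1 - B 0 1 * B 1 0 = 1 := by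
    have := B.det_coe
    rw [Matrix.det_fin_two] at this
    exact_mod_cast this
  have hB' : aut B τ = (B 1 0 : ℂ) * τ + B 1 1 := rfl
  have h3 : ((A * B) 1 0 : ℂ) = A 1 0 * B 0 0 + A 1 1 * B 1 0 := by
    simp [Matrix.mul_apply, Fin.sum_univ_two]
  rw [aut_mul, h3]
  field_simp
  have h4 : (A 1 0 : ℂ) + B 1 0 * aut B τ * aut A (B • τ) =
      A 1 0 + B 1 0 * (aut A (B • τ) * aut B τ) := by ring
  have h5 : aut B τ * ((A 1 0 : ℂ) * B 0 0 + A 1 1 * B 1 0) =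
      A 1 0 + B 1 0 * (aut A (B • τ) * aut B τ) := by
    rw [h2, hB']
    linear_combination (A 1 0 : ℂ) * hdet
  linear_combination h5

theorem e_add (x y : ℂ) : e (x + y) = e x * e y := by
  simp [e, mul_add, Complex.exp_add]

theorem e_zero : e 0 = 1 := by simp [e]

theorem quad_smul (c : ℂ) (z : ℂ ⊗[ℤ] L) : quad β (c • z) = c ^ 2 * quad β z := by
  simp only [quad, map_smul, LinearMap.smul_apply, smul_eq_mul]
  ring

theorem jacobiSlash_mul (m : ℤ) (α γ : Mp2Z) (φ : ℍ → (ℂ ⊗[ℤ] L) → ℂ) :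
    jacobiSlash β m (α * γ) φ = jacobiSlash β m γ (jacobiSlash β m α φ) := by
  funext τ z
  have hA := aut_ne_zero α.mat (γ.mat • τ)
  have hB := aut_ne_zero γ.mat τ
  have h := aut_cocycle α.mat γ.mat τ
  have he : e (-((α.mat * γ.mat) 1 0 : ℂ) * quad β z / aut (α.mat * γ.mat) τ) =
      e (-(α.mat 1 0 : ℂ) * quad β ((aut γ.mat τ)⁻¹ • z) / aut α.mat (γ.mat • τ)) *
        e (-(γ.mat 1 0 : ℂ) * quad β z / aut γ.mat τ) := by
    rw [← e_add, quad_smul]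
    congr 1
    have h6 : -((α.mat * γ.mat) 1 0 : ℂ) * quad β z / aut (α.mat * γ.mat) τ =
      -(((α.mat * γ.mat) 1 0 : ℂ) / aut (α.mat * γ.mat) τ) * quad β z := by ring
    rw [h6, h]
    field_simp
    ring
  simp only [jacobiSlash, Mp2Z.mul_mat, Mp2Z.mul_root]
  rw [he, aut_mul, mul_inv, mul_smul α.mat γ.mat τ, mul_zpow, mul_smul]
  ring

/-- The left action `(α, φ) ↦ φ | α⁻¹` in weight `m / 2` and index `(L, β)` on all functions on
`ℍ × (ℂ ⊗ L)`. -/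
def jacobiRep (m : ℤ) : Representation ℂ Mp2Z (ℍ → (ℂ ⊗[ℤ] L) → ℂ) where
  toFun α :=
    { toFun := jacobiSlash β m α⁻¹
      map_add' := fun f g ↦ by funext τ z; simp [jacobiSlash, add_mul]
      map_smul' := fun c f ↦ by funext τ z; simp [jacobiSlash, mul_assoc] }
  map_one' := by
    ext f τ z
    simp [jacobiSlash, aut_one, e_zero]
  map_mul' α γ := by
    ext1 f
    simp [jacobiSlash_mul]

/-- Holomorphy of a function on `ℍ × (ℂ ⊗ L)`, in the coordinates of `ℂ ⊗ L` with respect to the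
`ℤ`-bases of `L`. -/
def IsHolomorphic (φ : ℍ → (ℂ ⊗[ℤ] L) → ℂ) : Prop :=
  ∀ b : Module.Basis (Fin (Module.finrank ℤ L)) ℤ L,
    DifferentiableOn ℂ
      (fun p : ℂ × (Fin (Module.finrank ℤ L) → ℂ) ↦
        φ (UpperHalfPlane.ofComplex p.1) (∑ i, p.2 i ⊗ₜ[ℤ] b i))
      {p | 0 < p.1.im}

/-- A Fourier expansion
`φ(τ, z) = ∑_{n ∈ h/24 + ℤ} ∑_{r in the shadow, n ≥ β(r)} c(n, r) qⁿ e(β(r, z))`,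
where `n = h/24 + j`. -/
def HasJacobiExpansion (h : ℤ) (φ : ℍ → (ℂ ⊗[ℤ] L) → ℂ) : Prop :=
  ∃ c : ℤ → shadow β → ℂ,
    (∀ (j : ℤ) (r : shadow β),
      (h : ℚ) / 24 + j < β.baseChange ℚ (r : ℚ ⊗[ℤ] L) r / 2 → c j r = 0) ∧
    ∀ (τ : ℍ) (z : ℂ ⊗[ℤ] L),
      HasSum (fun p : ℤ × shadow β ↦ c p.1 p.2 *
        e (((h : ℂ) / 24 + p.1) * τ + β.baseChange ℂ (ratToComplex (p.2 : ℚ ⊗[ℤ] L)) z)) (φ τ z)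

/-- The space `J_{m/2, (L, β)}(ε^h)` of Jacobi forms of weight `m / 2`, index `(L, β)` and
character `ε^h`. -/
def jacobiForms (m h : ℤ) : Submodule ℂ (ℍ → (ℂ ⊗[ℤ] L) → ℂ) where
  carrier := {φ | IsHolomorphic φ ∧
    (∀ (α : Mp2Z) (τ : ℍ) (z : ℂ ⊗[ℤ] L),
      jacobiSlash β m α φ τ z = ((eps ^ h) α : ℂ) * φ τ z) ∧
    (∀ (x y : L) (τ : ℍ) (z : ℂ ⊗[ℤ] L),
      φ τ (z + (τ : ℂ) ⊗ₜ x + 1 ⊗ₜ y) *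
          e ((τ : ℂ) * ((β x x : ℂ) / 2) + β.baseChange ℂ (1 ⊗ₜ x) z) =
        e ((β (x + y) (x + y) : ℂ) / 2) * φ τ z) ∧
    HasJacobiExpansion β h φ}
  add_mem' := by
    rintro f g ⟨f1, f2, f3, c, f4, f5⟩ ⟨g1, g2, g3, d, g4, g5⟩
    refine ⟨fun b ↦ (f1 b).add (g1 b), fun α τ z ↦ ?_, fun x y τ z ↦ ?_,
      fun j r ↦ c j r + d j r, fun j r h ↦ by simp [f4 j r h, g4 j r h], fun τ z ↦ ?_⟩
    · have h1 := f2 α τ z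
      have h2 := g2 α τ z
      simp only [jacobiSlash, Pi.add_apply, add_mul, mul_add] at *
      rw [h1, h2]
    · simp only [Pi.add_apply, add_mul, mul_add, f3 x y τ z, g3 x y τ z]
    · simpa [add_mul] using (f5 τ z).add (g5 τ z)
  zero_mem' := by
    refine ⟨fun b ↦ ?_, fun α τ z ↦ by simp [jacobiSlash], fun x y τ z ↦ by simp,
      fun _ _ ↦ 0, fun _ _ _ ↦ rfl, fun τ z ↦ by simp⟩
    exact differentiableOn_const 0
  smul_mem' := by
    rintro a f ⟨f1, f2, f3, c, f4, f5⟩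
    refine ⟨fun b ↦ (f1 b).const_smul a, fun α τ z ↦ ?_, fun x y τ z ↦ ?_,
      fun j r ↦ a * c j r, fun j r h ↦ by simp [f4 j r h], fun τ z ↦ ?_⟩
    · have h1 := f2 α τ z
      simp only [jacobiSlash, Pi.smul_apply, smul_eq_mul] at *
      rw [mul_assoc, mul_assoc, ← mul_assoc (f _ _), h1]
      ring
    · simp only [Pi.smul_apply, smul_eq_mul]
      rw [mul_assoc, f3 x y τ z]
      ring
    · simpa [mul_assoc] using (f5 τ z).mul_left a

/-! ### The theta expansion -/

/-- The `G`-module `M ⊗ Θ ⊗ ℂ(χ)` for `G`-stable spaces `M` of functions on `ℍ` and `Θ` of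
functions on `ℍ × (ℂ ⊗ L)`. -/
def tensorRep {m n : ℤ} (M : Subrepresentation (slashRep m))
    (T : Subrepresentation (jacobiRep β n)) (χ : Mp2Z →* ℂˣ) :
    Representation ℂ Mp2Z (M.toSubmodule ⊗[ℂ] (T.toSubmodule ⊗[ℂ] ℂ)) :=
  M.toRepresentation.tprod (T.toRepresentation.tprod (charRep χ))

/-- The product `(f, ϑ) ↦ f(τ) ϑ(τ, z)`. -/
def mulMap : (ℍ → ℂ) →ₗ[ℂ] (ℍ → (ℂ ⊗[ℤ] L) → ℂ) →ₗ[ℂ] (ℍ → (ℂ ⊗[ℤ] L) → ℂ) :=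
  LinearMap.mk₂ ℂ (fun f ϑ τ z ↦ f τ * ϑ τ z)
    (fun f g ϑ ↦ by funext τ z; simp [add_mul])
    (fun c f ϑ ↦ by funext τ z; simp [mul_assoc])
    (fun f ϑ ϑ' ↦ by funext τ z; simp [mul_add])
    (fun c f ϑ ↦ by funext τ z; simp [mul_left_comm])

/-- The linear map `f ⊗ ϑ ⊗ c ↦ c f ϑ`. -/
def thetaMap (M : Submodule ℂ (ℍ → ℂ)) (T : Submodule ℂ (ℍ → (ℂ ⊗[ℤ] L) → ℂ)) :
    M ⊗[ℂ] (T ⊗[ℂ] ℂ) →ₗ[ℂ] (ℍ → (ℂ ⊗[ℤ] L) → ℂ) :=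
  TensorProduct.lift (mulMap.domRestrict₁₂ M T) ∘ₗ
    LinearMap.lTensor M (TensorProduct.rid ℂ T).toLinearMap

theorem thetaMap_tmul (M : Submodule ℂ (ℍ → ℂ)) (T : Submodule ℂ (ℍ → (ℂ ⊗[ℤ] L) → ℂ))
    (f : M) (ϑ : T) (c : ℂ) (τ : ℍ) (z : ℂ ⊗[ℤ] L) :
    thetaMap M T (f ⊗ₜ (ϑ ⊗ₜ c)) τ z = c * ((f : ℍ → ℂ) τ * (ϑ : ℍ → (ℂ ⊗[ℤ] L) → ℂ) τ z) := by
  simp only [thetaMap, LinearMap.comp_apply, LinearMap.lTensor_tmul, LinearEquiv.coe_coe,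
    TensorProduct.rid_tmul, TensorProduct.lift.tmul, map_smul]
  rfl

/-- The multiplication map `f ⊗ ϑ ⊗ c ↦ c f ϑ` restricts to an isomorphism of
`(M ⊗ Θ ⊗ ℂ(ε^h))^G` onto the space of Jacobi forms of weight `k / 2`, and every such Jacobi form
has, for every basis `lam` of `W(L)`, a unique theta expansion `φ = ∑ i, f i · ϑ_{lam i}` with
`f i ∈ M`. -/
def ThetaExpansionIso (k h : ℤ) {m n : ℤ} (M : Subrepresentation (slashRep m))
    (T : Subrepresentation (jacobiRep β n)) : Prop :=
  (∃ Φ : (tensorRep β M T (eps ^ h)).invariants ≃ₗ[ℂ] jacobiForms β k h,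
    ∀ x, (Φ x : ℍ → (ℂ ⊗[ℤ] L) → ℂ) = thetaMap M.toSubmodule T.toSubmodule x.1) ∧
  ∀ (ι : Type) [Fintype ι] (lam : Module.Basis ι ℂ (W β)) (φ : jacobiForms β k h),
    ∃! f : ι → M.toSubmodule, ∀ τ z,
      (φ : ℍ → (ℂ ⊗[ℤ] L) → ℂ) τ z = ∑ i, (f i : ℍ → ℂ) τ * basicTheta β (lam i) τ z

end Lattice

end LatticeJacobi

end

open scoped UpperHalfPlane MatrixGroups TensorProduct Manifold Topology
open Filter

noncomputable section

namespace LatticeJacobi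

/-! ### The exponential `e` -/

/-! For fixed `τ`, translation by `L` turns `φ(τ, ·)` into a Fourier series whose coefficients obey
the law defining `W(L)`. Hence `φ(τ, ·)` is a combination of the `ϑ_λ(τ, ·)`, which are linearly
independent already at a single `τ` (`exists_mem_W`, `coeff_unique`). The coefficients `h_λ(τ)` are
series in powers `q^{m-β(r)}` with `m ≥ β(r)`, so they are holomorphic and bounded at infinity
(`exists_theta_coeff`). What remains is the action of `G` on `Θ(L)`.

Orthogonal vectors of norm `2aᵢ` in `L` express every `ϑ_λ` as a finite combination of products of
one-variable theta functions `th aᵢ s`. The span of these products is stable under `G` by Poisson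
summation, and quasi-periodicity, which `G` preserves, cuts `Θ(L)` out of it
(`jacobiSlash_mem_thetaSpace`). Boundedness of the `h_λ` at the other cusps follows, since slashing
only mixes them linearly.

For `Γ(N)`, every element is a product `δγ'` with `δ` in the normal closure of `T^N` and `γ'` over a
prescribed deeper `Γ(N')` (`Mp2Z.exists_normalClosure_mul_Gamma`). As `Nβ(r)` is integral on the
shadow, `T^N`, hence `δ`, acts trivially on `Θ(L)`. If `4a ∣ N'`, then `γ'` acts on all `th a s` by
one scalar, which is the same for index `a` and index `1` (`exists_scalar`): it is determined by a
quadratic Gauss sum modulo the lower right entry, which may be taken to be a prime `p ≡ 1 mod 4a`,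
and `a` is a square modulo `p` by reciprocity. Since `η` is a difference of two theta functions of
index `6`, by the pentagonal number theorem, this scalar is `ε(γ')` once also `24 ∣ N'`, and `ε(γ')²
= 1`. So `γ'` acts on `Θ(L)` by `ε(γ')ⁿ`, and the `h_λ` have exactly the multiplier of
`M_{k-n/2}(Γ(N))` (`exists_theta_expansion`).

Conversely, a `G`-invariant combination of modular forms and theta functions has a Fourier expansion
with non-negative exponents `m - β(r)`, and invariance under `T` forces `m ∈ h/24 + ℤ`
(`hasJacobiExpansion`). Injectivity of the multiplication map is again linear independence at each
`τ`. -/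

theorem e_int (n : ℤ) : e n = 1 := by
  rw [e, show 2 * (Real.pi : ℂ) * Complex.I * n = n * (2 * Real.pi * Complex.I) by ring]
  exact Complex.exp_int_mul_two_pi_mul_I n

theorem e_ne_zero (x : ℂ) : e x ≠ 0 := Complex.exp_ne_zero _

theorem e_neg (x : ℂ) : e (-x) = (e x)⁻¹ := by
  rw [e, e, ← Complex.exp_neg]
  ring_nf

theorem e_sub (x y : ℂ) : e (x - y) = e x / e y := by
  rw [sub_eq_add_neg, e_add, e_neg, div_eq_mul_inv]

theorem e_add_int (x : ℂ) (n : ℤ) : e (x + n) = e x := by rw [e_add, e_int, mul_one]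

theorem e_eq_of_sub_eq_int {x y : ℂ} (n : ℤ) (h : x - y = n) : e x = e y := by
  rw [show x = y + n by rw [← h]; ring, e_add_int]

theorem e_eq_one_iff (x : ℂ) : e x = 1 ↔ ∃ n : ℤ, x = n := by
  rw [e, Complex.exp_eq_one_iff]
  have h : (2 * (Real.pi : ℂ) * Complex.I) ≠ 0 := Complex.two_pi_I_ne_zero
  refine exists_congr fun n ↦ ⟨fun h' ↦ ?_, fun h' ↦ by rw [h']; ring⟩
  exact mul_left_cancel₀ h (by rw [h']; ring)

theorem e_sum {ι : Type*} (s : Finset ι) (f : ι → ℂ) : e (∑ i ∈ s, f i) = ∏ i ∈ s, e (f i) := by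
  simp [e, Finset.mul_sum, Complex.exp_sum]

theorem e_nat_mul (n : ℕ) (x : ℂ) : e (n * x) = e x ^ n := by
  rw [e, e, ← Complex.exp_nat_mul]
  ring_nf

theorem e_int_mul (n : ℤ) (x : ℂ) : e (n * x) = e x ^ n := by
  rw [e, e, ← Complex.exp_int_mul]
  ring_nf

theorem norm_e (x : ℂ) : ‖e x‖ = Real.exp (-(2 * Real.pi * x.im)) := by
  rw [e, Complex.norm_exp]
  simp

theorem differentiable_e : Differentiable ℂ e := by
  unfold e
  fun_prop

/-! ### Generators of the metaplectic group -/

theorem smul_coe (A : SL(2, ℤ)) (τ : ℍ) :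
    ((A • τ : ℍ) : ℂ) = ((A 0 0 : ℂ) * τ + A 0 1) / aut A τ := by
  rw [UpperHalfPlane.coe_specialLinearGroup_apply]
  simp [aut]

theorem det_eq_one (A : SL(2, ℤ)) : (A 0 0 : ℂ) * A 1 1 - A 0 1 * A 1 0 = 1 := by
  have := A.det_coe
  rw [Matrix.det_fin_two] at this
  exact_mod_cast this

theorem neg_I_mul_re_pos (τ : ℍ) : 0 < (-Complex.I * (τ : ℂ)).re := by
  simpa using τ.im_pos

namespace Mp2Z

/-- The projection of `Mp₂(ℤ)` onto `SL₂(ℤ)`. -/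
def toSL : Mp2Z →* SL(2, ℤ) where
  toFun := mat
  map_one' := rfl
  map_mul' _ _ := rfl

@[simp] theorem toSL_apply (α : Mp2Z) : toSL α = α.mat := rfl

/-- The translation `(T, 1)`. -/
def T : Mp2Z where
  mat := ModularGroup.T
  root := fun _ ↦ 1
  holo := mdifferentiable_const
  sq := fun τ ↦ by simp [aut, ModularGroup.T]

/-- The nontrivial element of the kernel of `Mp₂(ℤ) → SL₂(ℤ)`. -/
def Z : Mp2Z where
  mat := 1
  root := fun _ ↦ -1
  holo := mdifferentiable_const
  sq := fun τ ↦ by simp [aut_one]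

/-- The inversion `(S, √τ)`. -/
def S : Mp2Z where
  mat := ModularGroup.S
  -- `-iτ` lies in the right half plane, where the principal root is holomorphic, and `e(1/8)² = i`
  -- restores `τ`. The same root occurs in the functional equation of `jacobiTheta₂`.
  root := fun τ ↦ e (1 / 8) * (-Complex.I * (τ : ℂ)) ^ (1 / 2 : ℂ)
  holo := by
    rw [UpperHalfPlane.mdifferentiable_iff]
    have h : DifferentiableOn ℂ
        (fun z : ℂ ↦ e (1 / 8) * (-Complex.I * z) ^ (1 / 2 : ℂ)) {z | 0 < z.im} := by
      intro z hz
      refine DifferentiableAt.differentiableWithinAt ?_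
      refine DifferentiableAt.const_mul ?_ _
      refine DifferentiableAt.cpow_const (by fun_prop) (Or.inl ?_)
      exact neg_I_mul_re_pos ⟨z, hz⟩
    refine h.congr fun z hz ↦ ?_
    simp [UpperHalfPlane.ofComplex_apply_of_im_pos hz]
  sq := fun τ ↦ by
    have h1 : e (1 / 8) ^ 2 = Complex.I := by
      rw [← e_nat_mul, e]
      convert Complex.exp_pi_div_two_mul_I using 2
      push_cast; ring
    have h2 : ((-Complex.I * (τ : ℂ)) ^ (1 / 2 : ℂ)) ^ 2 = -Complex.I * τ := by
      rw [← Complex.cpow_nat_mul]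
      simp
    rw [mul_pow, h1, h2]
    simp [aut, ModularGroup.S, ← mul_assoc]

@[simp] theorem T_mat : T.mat = ModularGroup.T := rfl
@[simp] theorem T_root (τ : ℍ) : T.root τ = 1 := rfl
@[simp] theorem S_mat : S.mat = ModularGroup.S := rfl
theorem S_root (τ : ℍ) : S.root τ = e (1 / 8) * (-Complex.I * (τ : ℂ)) ^ (1 / 2 : ℂ) := rfl
@[simp] theorem Z_mat : Z.mat = 1 := rfl
@[simp] theorem Z_root (τ : ℍ) : Z.root τ = -1 := rfl

/-- The quotient of the two roots is continuous with square `1` on the connected space `ℍ`, hence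
constantly `1` or constantly `-1`. -/
theorem eq_or_eq_mul_Z {α γ : Mp2Z} (h : α.mat = γ.mat) : α = γ ∨ α = γ * Z := by
  have hq : ∀ τ, (α.root τ / γ.root τ) ^ 2 = 1 := fun τ ↦ by
    rw [div_pow, α.sq, γ.sq, h, div_self (aut_ne_zero _ _)]
  have hcont : Continuous fun τ ↦ α.root τ / γ.root τ :=
    α.holo.continuous.div γ.holo.continuous γ.root_ne_zero
  have hfin : ({1, -1} : Set ℂ).Finite := by simp
  have hsub : (Set.range fun τ ↦ α.root τ / γ.root τ).Subsingleton :=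
    (hfin.subset (by
      rintro _ ⟨σ, rfl⟩
      simpa using sq_eq_one_iff.1 (hq σ))).countable.isTotallyDisconnected _
        subset_rfl (isPreconnected_range hcont)
  have hall : ∀ τ, α.root τ / γ.root τ = α.root UpperHalfPlane.I / γ.root UpperHalfPlane.I :=
    fun τ ↦ hsub ⟨τ, rfl⟩ ⟨_, rfl⟩
  rcases sq_eq_one_iff.1 (hq UpperHalfPlane.I) with h1 | h1
  · left
    refine Mp2Z.ext ?_ ?_
    · exact h
    · funext τ
      have := hall τ
      rw [h1, div_eq_one_iff_eq (γ.root_ne_zero τ)] at this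
      exact this
  · right
    refine Mp2Z.ext ?_ ?_
    · simpa using h
    · funext τ
      have := hall τ
      rw [h1, div_eq_iff (γ.root_ne_zero τ)] at this
      simpa using this

/-- `S` and `T` generate `SL₂(ℤ)`, and `Z` accounts for the kernel of the projection. -/
theorem closure_generators : Subgroup.closure ({S, T, Z} : Set Mp2Z) = ⊤ := by
  rw [eq_top_iff]
  intro α _
  set K := Subgroup.closure ({S, T, Z} : Set Mp2Z) with hK
  have hmap : K.map toSL = ⊤ := by
    rw [eq_top_iff, ← SpecialLinearGroup.SL2Z_generators, Subgroup.closure_le]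
    rintro _ (rfl | rfl)
    · exact ⟨S, Subgroup.subset_closure (by simp), rfl⟩
    · exact ⟨T, Subgroup.subset_closure (by simp), rfl⟩
  obtain ⟨γ, hγ, hγα⟩ : α.mat ∈ K.map toSL := by rw [hmap]; trivial
  have hZ : Z ∈ K := Subgroup.subset_closure (by simp)
  rcases eq_or_eq_mul_Z (α := α) (γ := γ) hγα.symm with rfl | rfl
  · exact hγ
  · exact K.mul_mem hγ hZ

theorem Z_mul_Z : Z * Z = 1 := by
  refine Mp2Z.ext ?_ ?_
  · simp
  · funext τ; simp

theorem S_pow_eight : S ^ 8 = 1 := by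
  have h : (S ^ 4).mat = (1 : Mp2Z).mat := by
    have h1 : (S ^ 4).mat = ModularGroup.S ^ 4 := map_pow toSL S 4
    have h2 : ModularGroup.S ^ 4 = ModularGroup.S * ModularGroup.S *
        (ModularGroup.S * ModularGroup.S) := by simp only [pow_succ, pow_zero, one_mul, mul_assoc]
    rw [h1, h2]
    refine Subtype.ext ?_
    rw [Matrix.SpecialLinearGroup.coe_mul, Matrix.SpecialLinearGroup.coe_mul,
      ModularGroup.S_mul_S_eq]
    simp
  rw [show 8 = 4 * 2 from rfl, pow_mul, pow_two]
  rcases eq_or_eq_mul_Z h with h | h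
  · rw [h, one_mul]
  · rw [h, one_mul, Z_mul_Z]

/-- Properties closed under products need no closure under inverses here: `S` and `Z` have finite
order, so only `T⁻¹` must be treated separately. -/
theorem generator_induction {P : Mp2Z → Prop} (hS : P S) (hT : P T) (hT' : P T⁻¹) (hZ : P Z)
    (hmul : ∀ α γ, P α → P γ → P (α * γ)) (α : Mp2Z) : P α := by
  have h1 : P 1 := Z_mul_Z ▸ hmul _ _ hZ hZ
  have hpow : ∀ n, P (S ^ n) := fun n ↦ by
    induction n with
    | zero => simpa using h1
    | succ n ih => rw [pow_succ]; exact hmul _ _ ih hS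
  have hS' : P S⁻¹ := by
    rw [show S⁻¹ = S ^ 7 from inv_eq_of_mul_eq_one_right (by rw [← pow_succ', S_pow_eight])]
    exact hpow 7
  have hZ' : P Z⁻¹ := by
    rwa [show Z⁻¹ = Z from inv_eq_of_mul_eq_one_right Z_mul_Z]
  suffices P α ∧ P α⁻¹ from this.1
  have h : α ∈ Subgroup.closure ({S, T, Z} : Set Mp2Z) := by rw [closure_generators]; trivial
  induction h using Subgroup.closure_induction with
  | mem x hx =>
    rcases hx with rfl | rfl | rfl
    exacts [⟨hS, hS'⟩, ⟨hT, hT'⟩, ⟨hZ, hZ'⟩]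
  | one => exact ⟨h1, by simpa using h1⟩
  | mul x y _ _ hx hy => exact ⟨hmul x y hx.1 hy.1, by rw [mul_inv_rev]; exact hmul _ _ hy.2 hx.2⟩
  | inv x _ hx => exact ⟨hx.2, by simpa using hx.1⟩

theorem toSL_surjective : Function.Surjective toSL := by
  intro A
  have h : A ∈ Subgroup.closure ({ModularGroup.S, ModularGroup.T} : Set SL(2, ℤ)) := by
    rw [SpecialLinearGroup.SL2Z_generators]; trivial
  induction h using Subgroup.closure_induction with
  | mem x hx =>
    rcases hx with rfl | rfl
    exacts [⟨S, rfl⟩, ⟨T, rfl⟩]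
  | one => exact ⟨1, rfl⟩
  | mul x y _ _ hx hy =>
    obtain ⟨a, rfl⟩ := hx
    obtain ⟨b, rfl⟩ := hy
    exact ⟨a * b, rfl⟩
  | inv x _ hx =>
    obtain ⟨a, rfl⟩ := hx
    exact ⟨a⁻¹, rfl⟩

@[simp] theorem T_pow_mat (n : ℕ) : (T ^ n).mat = ModularGroup.T ^ n := map_pow toSL T n

@[simp] theorem T_pow_root (n : ℕ) (τ : ℍ) : (T ^ n).root τ = 1 := by
  induction n generalizing τ with
  | zero => simp
  | succ n ih => rw [pow_succ, mul_root, ih, T_root, mul_one]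

@[simp] theorem T_zpow_mat (n : ℤ) : (T ^ n).mat = ModularGroup.T ^ n := map_zpow toSL T n

end Mp2Z

theorem coe_T_zpow_smul (n : ℤ) (τ : ℍ) : ((ModularGroup.T ^ n • τ : ℍ) : ℂ) = τ + n := by
  rw [UpperHalfPlane.modular_T_zpow_smul]
  simp [add_comm]

theorem coe_T_pow_smul (n : ℕ) (τ : ℍ) : ((ModularGroup.T ^ n • τ : ℍ) : ℂ) = τ + n := by
  simpa using coe_T_zpow_smul n τ

theorem coe_T_smul (τ : ℍ) : ((ModularGroup.T • τ : ℍ) : ℂ) = τ + 1 := by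
  simpa using coe_T_zpow_smul 1 τ

theorem coe_S_smul (τ : ℍ) : ((ModularGroup.S • τ : ℍ) : ℂ) = -1 / τ := by
  rw [UpperHalfPlane.modular_S_smul]
  simp [neg_div]

theorem aut_T_pow (n : ℕ) (τ : ℍ) : aut (ModularGroup.T ^ n) τ = 1 := by
  simp [aut, ModularGroup.coe_T_zpow, ← zpow_natCast]

/-! ### Principal congruence subgroups and the normal closure of a translation -/

section NormalClosure

theorem mul_entry (A B : SL(2, ℤ)) (i j : Fin 2) :
    (A * B) i j = A i 0 * B 0 j + A i 1 * B 1 j := by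
  rw [Matrix.SpecialLinearGroup.coe_mul, Matrix.mul_apply, Fin.sum_univ_two]

theorem T_zpow_entry (x : ℤ) (i j : Fin 2) :
    (ModularGroup.T ^ x : SL(2, ℤ)) i j = !![1, x; 0, 1] i j := by
  rw [ModularGroup.coe_T_zpow]

theorem S_entry (i j : Fin 2) : ModularGroup.S i j = !![0, -1; 1, 0] i j := rfl

/-- The lower triangular unipotent matrix with entry `y`. -/
def lowerUnipotent (y : ℤ) : SL(2, ℤ) := ⟨!![1, 0; y, 1], by simp⟩

theorem lowerUnipotent_entry (y : ℤ) (i j : Fin 2) :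
    lowerUnipotent y i j = !![1, 0; y, 1] i j := rfl

theorem S_conj_T_zpow (y : ℤ) :
    ModularGroup.S * ModularGroup.T ^ (-y) * ModularGroup.S⁻¹ = lowerUnipotent y := by
  rw [mul_inv_eq_iff_eq_mul]
  refine Matrix.SpecialLinearGroup.ext _ _ fun i j ↦ ?_
  simp only [mul_entry, T_zpow_entry, S_entry, lowerUnipotent_entry]
  fin_cases i <;> fin_cases j <;> simp

variable {N N' : ℕ}

theorem T_zpow_mem_normalClosure {x : ℤ} (hx : (N : ℤ) ∣ x) :
    (ModularGroup.T ^ x : SL(2, ℤ)) ∈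
      Subgroup.normalClosure ({ModularGroup.T ^ N} : Set SL(2, ℤ)) := by
  obtain ⟨t, rfl⟩ := hx
  have h : (ModularGroup.T ^ N : SL(2, ℤ)) ∈
      Subgroup.normalClosure ({ModularGroup.T ^ N} : Set SL(2, ℤ)) :=
    Subgroup.subset_normalClosure (Set.mem_singleton _)
  have h2 := Subgroup.zpow_mem _ h t
  rw [← zpow_natCast, ← zpow_mul] at h2
  rwa [← zpow_natCast]

theorem lowerUnipotent_mem_normalClosure {y : ℤ} (hy : (N : ℤ) ∣ y) :
    lowerUnipotent y ∈ Subgroup.normalClosure ({ModularGroup.T ^ N} : Set SL(2, ℤ)) := by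
  rw [← S_conj_T_zpow]
  exact Subgroup.normalClosure_normal.conj_mem _
    (T_zpow_mem_normalClosure (dvd_neg.2 hy)) _

/-- Dirichlet's theorem in the form: a residue class prime to `c` contains large primes. -/
theorem exists_prime_eq_add_mul {a c : ℤ} (hac : IsCoprime a c) (hc : c ≠ 0) (n : ℕ) :
    ∃ (p : ℕ) (s : ℤ), p.Prime ∧ n < p ∧ a + s * c = p := by
  have hac' : IsCoprime a (c.natAbs : ℤ) := by
    rcases Int.natAbs_eq c with h | h
    · rwa [← h]
    · rw [h] at hac
      exact (IsCoprime.neg_right_iff _ _).1 hac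
  obtain ⟨p, hp, hpp, hmod⟩ :=
    Nat.forall_exists_prime_gt_and_zmodEq n (by simpa using hc) hac'
  obtain ⟨s, hs⟩ := Int.natAbs_dvd.1 (Int.modEq_iff_dvd.1 hmod.symm)
  exact ⟨p, s, hpp, hp, by linarith [hs, mul_comm c s]⟩

/-- For `c ≠ 0` a prime of the form `a + sc` exceeding `N'` is prime to `N'`; for `c = 0`
coprimality makes `a` a unit. -/
theorem exists_isCoprime_add_mul {a c : ℤ} (hac : IsCoprime a c) (hN' : 0 < N') :
    ∃ s : ℤ, IsCoprime (a + s * c) (N' : ℤ) := by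
  rcases eq_or_ne c 0 with rfl | hc
  · refine ⟨0, ?_⟩
    have ha : IsUnit a := isCoprime_zero_right.1 hac
    obtain ⟨u, rfl⟩ := ha
    exact ⟨(u⁻¹ : ℤˣ), 0, by simp⟩
  · obtain ⟨p, s, hp, hpn, hps⟩ := exists_prime_eq_add_mul hac hc N'
    refine ⟨s, ?_⟩
    rw [hps, Nat.isCoprime_iff_coprime]
    exact Nat.coprime_of_lt_prime hN'.ne' hpn hp

theorem dvd_of_mem_Gamma {γ : SL(2, ℤ)} (h : γ ∈ CongruenceSubgroup.Gamma N) :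
    (N : ℤ) ∣ γ 0 0 - 1 ∧ (N : ℤ) ∣ γ 0 1 ∧ (N : ℤ) ∣ γ 1 0 ∧ (N : ℤ) ∣ γ 1 1 - 1 := by
  rw [CongruenceSubgroup.Gamma_mem] at h
  obtain ⟨h1, h2, h3, h4⟩ := h
  refine ⟨?_, ?_, ?_, ?_⟩
  · rw [← ZMod.intCast_zmod_eq_zero_iff_dvd]; push_cast; rw [h1]; ring
  · rwa [← ZMod.intCast_zmod_eq_zero_iff_dvd]
  · rwa [← ZMod.intCast_zmod_eq_zero_iff_dvd]
  · rw [← ZMod.intCast_zmod_eq_zero_iff_dvd]; push_cast; rw [h4]; ring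

/-- Gaussian elimination modulo `N'`. The conjugate `T · lowerUnipotent (a-1) · T⁻¹` has rows `(a,
1-a)` and `(a-1, 2-a)` and lies in the normal closure because `N ∣ a - 1`. As `a` is a unit modulo
`N'` with inverse `u`, one row and one column operation, both by multiples of `N`, correct the
entries `b` and `c`. -/
theorem Gamma_le_of_isCoprime {γ : SL(2, ℤ)} (h : γ ∈ CongruenceSubgroup.Gamma N)
    (hco : IsCoprime (γ 0 0) (N' : ℤ)) :
    ∃ δ ∈ Subgroup.normalClosure ({ModularGroup.T ^ N} : Set SL(2, ℤ)),
      δ⁻¹ * γ ∈ CongruenceSubgroup.Gamma N' := by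
  obtain ⟨h1, h2, h3, -⟩ := dvd_of_mem_Gamma h
  obtain ⟨u, v, huv⟩ := hco
  set a := γ 0 0 with ha
  set b := γ 0 1 with hb
  set c := γ 1 0 with hc
  set d := γ 1 1 with hd
  have hdet : a * d - b * c = 1 := by
    have := γ.det_coe
    rwa [Matrix.det_fin_two] at this
  have hM : ModularGroup.T ^ (1 : ℤ) * lowerUnipotent (a - 1) * (ModularGroup.T ^ (1 : ℤ))⁻¹ ∈
      Subgroup.normalClosure ({ModularGroup.T ^ N} : Set SL(2, ℤ)) :=
    Subgroup.normalClosure_normal.conj_mem _ (lowerUnipotent_mem_normalClosure h1) _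
  have hx : (N : ℤ) ∣ u * (b - (1 - a)) :=
    Dvd.dvd.mul_left (by simpa [sub_eq_add_neg, add_comm, add_left_comm] using dvd_add h2 h1) _
  have hy : (N : ℤ) ∣ u * (c - (a - 1)) := Dvd.dvd.mul_left (dvd_sub h3 h1) _
  refine ⟨_, mul_mem (mul_mem (lowerUnipotent_mem_normalClosure hy) hM)
    (T_zpow_mem_normalClosure hx), ?_⟩
  have hnorm := CongruenceSubgroup.Gamma_normal N'
  rw [CongruenceSubgroup.Gamma_mem', map_mul, map_inv, inv_mul_eq_one]
  have hua : (u : ZMod N') * a = 1 := by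
    have := congrArg (Int.cast : ℤ → ZMod N') huv
    push_cast at this
    simpa using this
  have hdet' : (a : ZMod N') * d - b * c = 1 := by
    exact_mod_cast congrArg (Int.cast : ℤ → ZMod N') hdet
  rw [← zpow_neg]
  refine Matrix.SpecialLinearGroup.ext _ _ fun i j ↦ ?_
  have hg : ∀ g : SL(2, ℤ), ∀ i j,
      (Matrix.SpecialLinearGroup.map (Int.castRingHom (ZMod N')) g) i j =
        ((g i j : ℤ) : ZMod N') := fun _ _ _ ↦ rfl
  rw [hg, hg]
  simp only [mul_entry, T_zpow_entry, lowerUnipotent_entry]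
  fin_cases i <;> fin_cases j
  · simp [← ha]
  · simp [← hb]
    linear_combination ((b : ZMod N') - (1 - a)) * hua
  · simp [← hc]
    linear_combination ((c : ZMod N') - (a - 1)) * hua
  · simp [← hd]
    -- The lower right entry is forced by the determinant; the comparison is made after
    -- multiplication by the unit `a`.
    have hcancel : ∀ x : ZMod N', (a : ZMod N') * x = 0 → x = 0 := fun x hx ↦ by
      linear_combination (-x) * hua + (u : ZMod N') * hx
    rw [← sub_eq_zero]
    refine hcancel _ ?_
    linear_combination ((u * a + 1 : ZMod N') * (b - (1 - a)) * (c - (a - 1)) +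
      (b - (1 - a)) * (a - 1) - (c - (a - 1)) * (a - 1)) * hua - hdet'

/-- Left multiplication by `T^{sN}` changes the upper left entry from `a` to `a + sNc`. Since `a` is
prime to `Nc`, a suitable `s` makes it prime to `N'`. -/
theorem exists_normalClosure_mul_Gamma {γ : SL(2, ℤ)} (h : γ ∈ CongruenceSubgroup.Gamma N)
    (hN' : 0 < N') :
    ∃ δ ∈ Subgroup.normalClosure ({ModularGroup.T ^ N} : Set SL(2, ℤ)),
      δ⁻¹ * γ ∈ CongruenceSubgroup.Gamma N' := by
  obtain ⟨h1, h2, h3, -⟩ := dvd_of_mem_Gamma h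
  have hac : IsCoprime (γ 0 0) (N * γ 1 0) := by
    refine IsCoprime.mul_right ?_ ?_
    · obtain ⟨t, ht⟩ := h1
      exact ⟨1, -t, by linear_combination ht⟩
    · have := γ.det_coe
      rw [Matrix.det_fin_two] at this
      exact ⟨γ 1 1, -γ 0 1, by linear_combination this⟩
  obtain ⟨s, hs⟩ := exists_isCoprime_add_mul hac hN'
  have hT : (ModularGroup.T ^ (s * N) : SL(2, ℤ)) ∈
      Subgroup.normalClosure ({ModularGroup.T ^ N} : Set SL(2, ℤ)) :=
    T_zpow_mem_normalClosure (dvd_mul_left _ _)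
  have hT' : (ModularGroup.T ^ (s * N) : SL(2, ℤ)) ∈ CongruenceSubgroup.Gamma N := by
    simpa using CongruenceSubgroup.ModularGroup_T_pow_mem_Gamma N (s * N) (dvd_mul_left _ _)
  obtain ⟨δ, hδ, hδγ⟩ := Gamma_le_of_isCoprime (N' := N') (mul_mem hT' h) (by
    rw [mul_entry, T_zpow_entry, T_zpow_entry]
    simpa [mul_assoc] using hs)
  refine ⟨(ModularGroup.T ^ (s * N) : SL(2, ℤ))⁻¹ * δ, mul_mem (inv_mem hT) hδ, ?_⟩
  simpa [mul_assoc] using hδγ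

/-- An element of `Mp₂(ℤ)` over `Γ(N)` is a product of an element of the normal closure of `T^N`
and of an element over `Γ(N')`. -/
theorem Mp2Z.exists_normalClosure_mul_Gamma {γ : Mp2Z}
    (h : γ.mat ∈ CongruenceSubgroup.Gamma N) (hN' : 0 < N') :
    ∃ δ ∈ Subgroup.normalClosure ({Mp2Z.T ^ N} : Set Mp2Z), ∃ γ' : Mp2Z,
      γ'.mat ∈ CongruenceSubgroup.Gamma N' ∧ γ = δ * γ' := by
  obtain ⟨δ, hδ, hδγ⟩ := LatticeJacobi.exists_normalClosure_mul_Gamma h hN'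
  have himg : Mp2Z.toSL '' {Mp2Z.T ^ N} = {ModularGroup.T ^ N} := by simp
  rw [← himg, ← Subgroup.map_normalClosure _ _ Mp2Z.toSL_surjective] at hδ
  obtain ⟨δ', hδ', rfl⟩ := hδ
  exact ⟨δ', hδ', δ'⁻¹ * γ, hδγ, by simp⟩

end NormalClosure

/-! ### Theta functions of one variable -/

/-- The term `q^{k²/4a} e(kz)`. -/
def thTerm (a : ℕ) (τ : ℍ) (z : ℂ) (k : ℤ) : ℂ := e ((k : ℂ) ^ 2 / (4 * a) * τ + k * z)

/-- The theta function `∑_{k ≡ s mod 2a} q^{k²/4a} e(kz)`. -/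
def th (a : ℕ) (s : ℤ) (τ : ℍ) (z : ℂ) : ℂ :=
  ∑' k : ℤ, if (2 * a : ℤ) ∣ k - s then thTerm a τ z k else 0

/-- The slash action of weight `1 / 2` and index `a` on functions on `ℍ × ℂ`. -/
def halfSlash (a : ℕ) (α : Mp2Z) : (ℍ → ℂ → ℂ) →ₗ[ℂ] (ℍ → ℂ → ℂ) where
  toFun F := fun τ z ↦ F (α.mat • τ) ((aut α.mat τ)⁻¹ * z) *
    e (-(α.mat 1 0 : ℂ) * (a * z ^ 2) / aut α.mat τ) * (α.root τ)⁻¹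
  map_add' F G := by funext τ z; simp [add_mul]
  map_smul' c F := by funext τ z; simp [mul_assoc]

theorem halfSlash_apply (a : ℕ) (α : Mp2Z) (F : ℍ → ℂ → ℂ) (τ : ℍ) (z : ℂ) :
    halfSlash a α F τ z = F (α.mat • τ) ((aut α.mat τ)⁻¹ * z) *
      e (-(α.mat 1 0 : ℂ) * (a * z ^ 2) / aut α.mat τ) * (α.root τ)⁻¹ := rfl

theorem halfSlash_mul (a : ℕ) (α γ : Mp2Z) (F : ℍ → ℂ → ℂ) :
    halfSlash a (α * γ) F = halfSlash a γ (halfSlash a α F) := by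
  funext τ z
  have hA := aut_ne_zero α.mat (γ.mat • τ)
  have hB := aut_ne_zero γ.mat τ
  have h := aut_cocycle α.mat γ.mat τ
  have he : e (-((α.mat * γ.mat) 1 0 : ℂ) * (a * z ^ 2) / aut (α.mat * γ.mat) τ) =
      e (-(α.mat 1 0 : ℂ) * (a * ((aut γ.mat τ)⁻¹ * z) ^ 2) / aut α.mat (γ.mat • τ)) *
        e (-(γ.mat 1 0 : ℂ) * (a * z ^ 2) / aut γ.mat τ) := by
    rw [← e_add]
    congr 1
    have h6 : -((α.mat * γ.mat) 1 0 : ℂ) * (a * z ^ 2) / aut (α.mat * γ.mat) τ =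
      -(((α.mat * γ.mat) 1 0 : ℂ) / aut (α.mat * γ.mat) τ) * (a * z ^ 2) := by ring
    rw [h6, h]
    field_simp
    ring
  simp only [halfSlash_apply, Mp2Z.mul_mat, Mp2Z.mul_root]
  rw [he, aut_mul, mul_inv, mul_smul α.mat γ.mat τ, mul_inv]
  ring_nf

theorem halfSlash_one (a : ℕ) (F : ℍ → ℂ → ℂ) : halfSlash a 1 F = F := by
  funext τ z
  simp [halfSlash_apply, aut_one, e_zero]

theorem ofReal_mul_cpow {r : ℝ} (hr : 0 < r) {x : ℂ} (hx : x ≠ 0) (s : ℂ) :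
    ((r : ℂ) * x) ^ s = (r : ℂ) ^ s * x ^ s := by
  have hr' : (r : ℂ) ≠ 0 := by exact_mod_cast hr.ne'
  rw [Complex.cpow_def_of_ne_zero (mul_ne_zero hr' hx), Complex.cpow_def_of_ne_zero hr',
    Complex.cpow_def_of_ne_zero hx, Complex.log_ofReal_mul hr hx, Complex.ofReal_log hr.le,
    add_mul, Complex.exp_add]

theorem thTerm_eq_jacobiTheta₂_term {a : ℕ} (ha : 0 < a) (τ : ℍ) (z : ℂ) (k : ℤ) :
    thTerm a τ z k = jacobiTheta₂_term k z (τ / (2 * a)) := by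
  have : (a : ℂ) ≠ 0 := by exact_mod_cast ha.ne'
  rw [thTerm, jacobiTheta₂_term, e]
  congr 1
  field_simp
  ring

theorem im_div_pos {a : ℕ} (ha : 0 < a) (τ : ℍ) : 0 < ((τ : ℂ) / (2 * a)).im := by
  have h : ((τ : ℂ) / (2 * a)) = (((2 * a : ℝ)⁻¹ : ℝ) : ℂ) * τ := by
    push_cast; rw [div_eq_inv_mul]
  rw [h, Complex.im_ofReal_mul]
  have := τ.im_pos
  have : 0 < (τ : ℂ).im := this
  positivity

theorem summable_thTerm {a : ℕ} (ha : 0 < a) (τ : ℍ) (z : ℂ) : Summable (thTerm a τ z) := by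
  have h := (summable_jacobiTheta₂_term_iff z (τ / (2 * a))).2 (im_div_pos ha τ)
  exact h.congr fun k ↦ (thTerm_eq_jacobiTheta₂_term ha τ z k).symm

theorem hasSum_thTerm {a : ℕ} (ha : 0 < a) (τ : ℍ) (z : ℂ) :
    HasSum (thTerm a τ z) (jacobiTheta₂ z (τ / (2 * a))) := by
  refine (hasSum_jacobiTheta₂_term z (im_div_pos ha τ)).congr_fun fun k ↦ ?_
  exact thTerm_eq_jacobiTheta₂_term ha τ z k

theorem summable_th {a : ℕ} (ha : 0 < a) (s : ℤ) (τ : ℍ) (z : ℂ) :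
    Summable fun k : ℤ ↦ if (2 * a : ℤ) ∣ k - s then thTerm a τ z k else 0 := by
  refine (summable_thTerm ha τ z).norm.of_norm_bounded fun k ↦ ?_
  split_ifs <;> simp

theorem hasSum_th {a : ℕ} (ha : 0 < a) (s : ℤ) (τ : ℍ) (z : ℂ) :
    HasSum (fun k : ℤ ↦ if (2 * a : ℤ) ∣ k - s then thTerm a τ z k else 0) (th a s τ z) :=
  (summable_th ha s τ z).hasSum

theorem th_congr {a : ℕ} {s s' : ℤ} (h : (2 * a : ℤ) ∣ s - s') : th a s = th a s' := by
  funext τ z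
  refine tsum_congr fun k ↦ ?_
  have : (2 * a : ℤ) ∣ k - s ↔ (2 * a : ℤ) ∣ k - s' := by
    rw [show k - s' = k - s + (s - s') by ring]
    exact (dvd_add_left h).symm
  simp only [this]

/-- Orthogonality of the characters of `ℤ / 2aℤ`. -/
theorem sum_e_eq {a : ℕ} (ha : 0 < a) (k : ℤ) :
    ∑ j ∈ Finset.range (2 * a), e ((j : ℂ) * k / (2 * a)) =
      if (2 * a : ℤ) ∣ k then (2 * a : ℂ) else 0 := by
  have ha' : (a : ℂ) ≠ 0 := by exact_mod_cast ha.ne'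
  have h1 : ∀ j : ℕ, e ((j : ℂ) * k / (2 * a)) = e (k / (2 * a)) ^ j := fun j ↦ by
    rw [← e_nat_mul, mul_div_assoc]
  simp only [h1]
  split_ifs with h
  · obtain ⟨t, rfl⟩ := h
    have : e (((2 * a * t : ℤ) : ℂ) / (2 * a)) = 1 := by
      rw [← e_int t]
      congr 1
      push_cast
      field_simp
    rw [this]
    simp
  · have hne : e ((k : ℂ) / (2 * a)) ≠ 1 := by
      rw [Ne, e_eq_one_iff]
      rintro ⟨t, ht⟩
      apply h
      refine ⟨t, ?_⟩
      rw [div_eq_iff (mul_ne_zero two_ne_zero ha')] at ht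
      have : (k : ℂ) = ((2 * a * t : ℤ) : ℂ) := by rw [ht]; push_cast; ring
      exact_mod_cast this
    have hpow : e ((k : ℂ) / (2 * a)) ^ (2 * a) = 1 := by
      rw [← e_nat_mul, ← e_int k]
      congr 1
      push_cast
      field_simp
    have := geom_sum_mul (e ((k : ℂ) / (2 * a))) (2 * a)
    rw [hpow, sub_self] at this
    exact (mul_eq_zero.1 this).resolve_right (sub_ne_zero.2 hne)

/-- The theta functions in terms of Mathlib's two-variable theta function. -/
theorem th_eq_sum {a : ℕ} (ha : 0 < a) (s : ℤ) (τ : ℍ) (z : ℂ) :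
    th a s τ z = (2 * a : ℂ)⁻¹ * ∑ j ∈ Finset.range (2 * a),
      e (-((j : ℂ) * s / (2 * a))) * jacobiTheta₂ (z + j / (2 * a)) (τ / (2 * a)) := by
  have ha' : (a : ℂ) ≠ 0 := by exact_mod_cast ha.ne'
  have h := (hasSum_sum (s := Finset.range (2 * a)) fun (j : ℕ) _ ↦
    (hasSum_thTerm ha τ (z + j / (2 * a))).mul_left (e (-((j : ℂ) * s / (2 * a))))).mul_left
      (2 * a : ℂ)⁻¹
  refine (hasSum_th ha s τ z).unique (h.congr_fun fun k ↦ ?_)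
  have h1 : ∀ j : ℕ, e (-((j : ℂ) * s / (2 * a))) * thTerm a τ (z + j / (2 * a)) k =
      e ((j : ℂ) * ((k - s : ℤ) : ℂ) / (2 * a)) * thTerm a τ z k := fun j ↦ by
    rw [thTerm, thTerm, ← e_add, ← e_add]
    congr 1
    push_cast
    field_simp
    ring
  simp only [h1, ← Finset.sum_mul, sum_e_eq ha]
  split_ifs
  · field_simp
  · simp

/-- Put `k = 2am + s` and pull out the term with `m = 0`. Here `τ` becomes `2aτ`, while in
`th_eq_sum` it becomes `τ/2a`; the inversion exchanges the two descriptions. -/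
theorem th_eq_jacobiTheta₂ {a : ℕ} (ha : 0 < a) (s : ℤ) (τ : ℍ) (z : ℂ) :
    th a s τ z = e ((s : ℂ) ^ 2 / (4 * a) * τ + s * z) *
      jacobiTheta₂ (2 * a * z + s * τ) (2 * a * τ) := by
  have ha' : (a : ℂ) ≠ 0 := by exact_mod_cast ha.ne'
  have hinj : Function.Injective fun m : ℤ ↦ 2 * a * m + s := fun m m' h ↦ by
    have : (2 * a : ℤ) ≠ 0 := by positivity
    simpa [this] using h
  have him : 0 < (2 * a * (τ : ℂ)).im := by
    have : (2 * a * (τ : ℂ)).im = 2 * a * τ.im := by simp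
    rw [this]
    have := τ.im_pos
    positivity
  have h := (hasSum_jacobiTheta₂_term (2 * a * z + s * τ) him).mul_left
    (e ((s : ℂ) ^ 2 / (4 * a) * τ + s * z))
  refine (hasSum_th ha s τ z).unique ?_
  rw [← hinj.hasSum_iff]
  · refine h.congr_fun fun m ↦ ?_
    simp only [Function.comp_apply]
    rw [if_pos ⟨m, by ring⟩, thTerm, jacobiTheta₂_term, e, e, ← Complex.exp_add]
    congr 1
    push_cast
    field_simp
    ring
  · intro k hk
    rw [if_neg]
    rintro ⟨t, ht⟩
    exact hk ⟨t, by simp only; linarith⟩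

/-- If `k ≡ s mod 2a`, then `k²/4a ≡ s²/4a mod ℤ`. -/
theorem halfSlash_T_th {a : ℕ} (ha : 0 < a) (s : ℤ) :
    halfSlash a Mp2Z.T (th a s) = e ((s : ℂ) ^ 2 / (4 * a)) • th a s := by
  have ha' : (a : ℂ) ≠ 0 := by exact_mod_cast ha.ne'
  funext τ z
  have h10 : (ModularGroup.T 1 0 : ℤ) = 0 := rfl
  have haut : aut ModularGroup.T τ = 1 := by simpa using aut_T_pow 1 τ
  simp only [halfSlash_apply, Mp2Z.T_mat, Mp2Z.T_root, h10, haut, Pi.smul_apply, smul_eq_mul]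
  simp only [Int.cast_zero, neg_zero, zero_mul, zero_div, e_zero, inv_one, one_mul, mul_one]
  rw [th, th, ← tsum_mul_left]
  refine tsum_congr fun k ↦ ?_
  split_ifs with h
  · obtain ⟨t, ht⟩ := h
    rw [thTerm, thTerm, ← e_add, coe_T_smul]
    refine e_eq_of_sub_eq_int (t * s + a * t ^ 2) ?_
    have hk : (k : ℂ) = s + 2 * a * t := by
      have : k = s + 2 * a * t := by linarith
      rw [this]; push_cast; ring
    rw [hk]
    push_cast
    field_simp
    ring
  · simp

/-- Poisson summation: at `-1/τ`, expand by `th_eq_sum`; the functional equation of `jacobiTheta₂`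
carries the `j`-th summand to `th a j τ z` in the form of `th_eq_jacobiTheta₂`. The value of the
constant is irrelevant. -/
theorem halfSlash_S_th {a : ℕ} (ha : 0 < a) (s : ℤ) : ∃ c : ℂ, halfSlash a Mp2Z.S (th a s) =
    c • ∑ j ∈ Finset.range (2 * a), e (-((j : ℂ) * s / (2 * a))) • th a j := by
  have ha' : (a : ℂ) ≠ 0 := by exact_mod_cast ha.ne'
  refine ⟨(2 * a : ℂ)⁻¹ * (2 * a : ℂ) ^ (1 / 2 : ℂ) * (e (1 / 8))⁻¹, ?_⟩
  funext τ z
  have hτ := UpperHalfPlane.ne_zero τ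
  have h10 : (ModularGroup.S 1 0 : ℤ) = 1 := rfl
  have haut : aut ModularGroup.S τ = τ := by simp [aut, ModularGroup.S]
  have hroot : ((-Complex.I * (τ : ℂ)) ^ (1 / 2 : ℂ)) ≠ 0 := by
    simp [Complex.cpow_eq_zero_iff, hτ]
  have hmul : (-Complex.I * (2 * a * τ : ℂ)) ^ (1 / 2 : ℂ) =
      (2 * a : ℂ) ^ (1 / 2 : ℂ) * (-Complex.I * τ) ^ (1 / 2 : ℂ) := by
    rw [show (-Complex.I * (2 * a * τ : ℂ)) = ((2 * a : ℝ) : ℂ) * (-Complex.I * τ) by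
      push_cast; ring, ofReal_mul_cpow (by positivity) (by simp [hτ])]
    push_cast
    rfl
  have h2a : (2 * a : ℂ) ^ (1 / 2 : ℂ) ≠ 0 := by
    simp [Complex.cpow_eq_zero_iff, ha']
  have key : ∀ j : ℕ, jacobiTheta₂ ((τ : ℂ)⁻¹ * z + j / (2 * a))
      (((ModularGroup.S • τ : ℍ) : ℂ) / (2 * a)) =
      (2 * a : ℂ) ^ (1 / 2 : ℂ) * (-Complex.I * τ) ^ (1 / 2 : ℂ) * e (a * z ^ 2 / τ) *
        th a j τ z := fun j ↦ by
    rw [th_eq_jacobiTheta₂ ha, jacobiTheta₂_functional_equation (2 * a * z + (j : ℤ) * τ), hmul]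
    have h3 : (2 * a * z + (j : ℤ) * τ) / (2 * a * τ) = (τ : ℂ)⁻¹ * z + j / (2 * a) := by
      push_cast
      field_simp
    have h4 : -1 / (2 * a * (τ : ℂ)) = ((ModularGroup.S • τ : ℍ) : ℂ) / (2 * a) := by
      rw [coe_S_smul]
      field_simp
    rw [h3, h4]
    -- Completing the square: the Gaussian of the functional equation cancels the prefactor of `th a
    -- j` and the index factor of the slash action.
    have h5 : e (a * z ^ 2 / τ) * e (((j : ℤ) : ℂ) ^ 2 / (4 * a) * τ + (j : ℤ) * z) *
        Complex.exp (-Real.pi * Complex.I * (2 * a * z + (j : ℤ) * τ) ^ 2 / (2 * a * τ)) = 1 := by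
      rw [← e_add, e, ← Complex.exp_add, ← Complex.exp_zero]
      congr 1
      field_simp
      ring
    generalize jacobiTheta₂ ((τ : ℂ)⁻¹ * z + j / (2 * a))
      (((ModularGroup.S • τ : ℍ) : ℂ) / (2 * a)) = J
    generalize e (a * z ^ 2 / τ) = x1 at h5 ⊢
    generalize e (((j : ℤ) : ℂ) ^ 2 / (4 * a) * τ + (j : ℤ) * z) = x2 at h5 ⊢
    generalize Complex.exp (-Real.pi * Complex.I * (2 * a * z + (j : ℤ) * τ) ^ 2 / (2 * a * τ)) =
      x3 at h5 ⊢
    field_simp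
    linear_combination (-J) * h5
  simp only [halfSlash_apply, Mp2Z.S_mat, Mp2Z.S_root, h10, haut, Pi.smul_apply, smul_eq_mul,
    Finset.sum_apply]
  rw [th_eq_sum ha]
  simp only [key]
  have h6 : e (-((1 : ℤ) : ℂ) * (a * z ^ 2) / τ) = (e (a * z ^ 2 / τ))⁻¹ := by
    rw [← e_neg]; congr 1; push_cast; ring
  have h7 := e_ne_zero (a * z ^ 2 / τ)
  rw [h6, Finset.mul_sum, Finset.mul_sum, Finset.sum_mul, Finset.sum_mul]
  refine Finset.sum_congr rfl fun j _ ↦ ?_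
  have h8 := e_ne_zero (1 / 8)
  field_simp

/-- The space spanned by the theta functions `th a s`. -/
def thSpace (a : ℕ) : Submodule ℂ (ℍ → ℂ → ℂ) :=
  Submodule.span ℂ (Set.range (th a))

theorem th_mem_thSpace (a : ℕ) (s : ℤ) : th a s ∈ thSpace a :=
  Submodule.subset_span ⟨s, rfl⟩

theorem halfSlash_mem_of_th {a : ℕ} {α : Mp2Z} (h : ∀ s, halfSlash a α (th a s) ∈ thSpace a)
    {F : ℍ → ℂ → ℂ} (hF : F ∈ thSpace a) : halfSlash a α F ∈ thSpace a := by
  induction hF using Submodule.span_induction with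
  | mem x hx => obtain ⟨s, rfl⟩ := hx; exact h s
  | zero => simp
  | add x y _ _ hx hy => rw [map_add]; exact add_mem hx hy
  | smul c x _ hx => rw [map_smul]; exact Submodule.smul_mem _ c hx

theorem halfSlash_mem_thSpace {a : ℕ} (ha : 0 < a) (α : Mp2Z) {F : ℍ → ℂ → ℂ}
    (hF : F ∈ thSpace a) : halfSlash a α F ∈ thSpace a := by
  induction α using Mp2Z.generator_induction generalizing F with
  | hS =>
    refine halfSlash_mem_of_th (fun s ↦ ?_) hF
    obtain ⟨c, hc⟩ := halfSlash_S_th ha s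
    rw [hc]
    exact Submodule.smul_mem _ _ (sum_mem fun j _ ↦
      Submodule.smul_mem _ _ (th_mem_thSpace a j))
  | hT =>
    refine halfSlash_mem_of_th (fun s ↦ ?_) hF
    rw [halfSlash_T_th ha]
    exact Submodule.smul_mem _ _ (th_mem_thSpace a s)
  | hT' =>
    refine halfSlash_mem_of_th (fun s ↦ ?_) hF
    have h : halfSlash a Mp2Z.T⁻¹ (halfSlash a Mp2Z.T (th a s)) = th a s := by
      rw [← halfSlash_mul, mul_inv_cancel, halfSlash_one]
    rw [halfSlash_T_th ha, map_smul] at h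
    have h2 : halfSlash a Mp2Z.T⁻¹ (th a s) = (e ((s : ℂ) ^ 2 / (4 * a)))⁻¹ • th a s := by
      rw [← h, smul_smul, inv_mul_cancel₀ (e_ne_zero _), one_smul, h]
    rw [h2]
    exact Submodule.smul_mem _ _ (th_mem_thSpace a s)
  | hZ =>
    have h : halfSlash a Mp2Z.Z F = (-1 : ℂ) • F := by
      funext τ z
      simp [halfSlash_apply, aut_one, e_zero]
    rw [h]
    exact Submodule.smul_mem _ _ hF
  | hmul α γ hα hγ =>
    rw [halfSlash_mul]
    exact hγ (hα hF)

/-- The average over the translations of the second variable by `(2a)⁻¹ℤ`. -/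
def translationAverage (a : ℕ) : (ℍ → ℂ → ℂ) →ₗ[ℂ] (ℍ → ℂ → ℂ) where
  toFun F := fun τ z ↦ (2 * a : ℂ)⁻¹ * ∑ j ∈ Finset.range (2 * a), F τ (z + j / (2 * a))
  map_add' F G := by funext τ z; simp [Finset.sum_add_distrib, mul_add]
  map_smul' c F := by funext τ z; simp [← Finset.mul_sum, mul_left_comm]

theorem th_add_div {a : ℕ} (ha : 0 < a) (s : ℤ) (j : ℕ) (τ : ℍ) (z : ℂ) :
    th a s τ (z + j / (2 * a)) = e ((j : ℂ) * s / (2 * a)) * th a s τ z := by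
  have ha' : (a : ℂ) ≠ 0 := by exact_mod_cast ha.ne'
  rw [th, th, ← tsum_mul_left]
  refine tsum_congr fun k ↦ ?_
  split_ifs with h
  · obtain ⟨t, ht⟩ := h
    rw [thTerm, thTerm, ← e_add]
    refine e_eq_of_sub_eq_int (j * t) ?_
    have hk : (k : ℂ) = s + 2 * a * t := by
      have : k = s + 2 * a * t := by linarith
      rw [this]; push_cast; ring
    rw [hk]
    push_cast
    field_simp
    ring
  · simp

/-- The translation by `j/2a` multiplies `th a s` by `e(js/2a)`, so by orthogonality of characters
only the class `s ≡ 0 mod 2a` survives the average. -/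
theorem translationAverage_mem {a : ℕ} (ha : 0 < a) {F : ℍ → ℂ → ℂ} (hF : F ∈ thSpace a) :
    ∃ c : ℂ, translationAverage a F = c • th a 0 := by
  have ha' : (a : ℂ) ≠ 0 := by exact_mod_cast ha.ne'
  induction hF using Submodule.span_induction with
  | mem x hx =>
    obtain ⟨s, rfl⟩ := hx
    have h : translationAverage a (th a s) = (if (2 * a : ℤ) ∣ s then (1 : ℂ) else 0) • th a s := by
      funext τ z
      change (2 * a : ℂ)⁻¹ * ∑ j ∈ Finset.range (2 * a), th a s τ (z + j / (2 * a)) = _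
      simp only [th_add_div ha, ← Finset.sum_mul, sum_e_eq ha]
      split_ifs
      · simp; field_simp
      · simp
    rw [h]
    split_ifs with h'
    · exact ⟨1, by rw [th_congr (s := s) (s' := 0) (by simpa using h')]⟩
    · exact ⟨0, by simp⟩
  | zero => exact ⟨0, by simp⟩
  | add x y _ _ hx hy =>
    obtain ⟨c, hc⟩ := hx
    obtain ⟨d, hd⟩ := hy
    exact ⟨c + d, by rw [map_add, hc, hd, add_smul]⟩
  | smul c x _ hx =>
    obtain ⟨d, hd⟩ := hx
    exact ⟨c * d, by rw [map_smul, hd, mul_smul]⟩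

/-- The behaviour of `th a 0` under the translations by `ℤτ + (2a)⁻¹ℤ`. -/
theorem th_zero_add {a : ℕ} (ha : 0 < a) (x y : ℤ) (τ : ℍ) (z : ℂ) :
    th a 0 τ (z + x * τ + y / (2 * a)) = e (-(a * x ^ 2 * τ + 2 * a * x * z)) * th a 0 τ z := by
  have ha' : (a : ℂ) ≠ 0 := by exact_mod_cast ha.ne'
  rw [th, th, ← tsum_mul_left, ← (Equiv.subRight (2 * a * x)).tsum_eq]
  refine tsum_congr fun k ↦ ?_
  have hdvd : (2 * a : ℤ) ∣ Equiv.subRight (2 * a * x) k - 0 ↔ (2 * a : ℤ) ∣ k - 0 := by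
    simp only [Equiv.subRight_apply, sub_zero]
    exact dvd_sub_left (dvd_mul_right _ _)
  simp only [hdvd]
  split_ifs with h
  · obtain ⟨t, ht⟩ := h
    rw [thTerm, thTerm, ← e_add]
    have hk : k = 2 * a * t := by linarith
    refine e_eq_of_sub_eq_int (y * (t - x)) ?_
    rw [hk]
    simp only [Equiv.subRight_apply]
    push_cast
    field_simp
    ring
  · simp

/-- All theta functions of index `a` are translates of `th a 0` by `sτ/2a`, up to an exponential
factor, so a scalar found for `th a 0` spreads to the others. -/
theorem th_eq_th_zero {a : ℕ} (ha : 0 < a) (s : ℤ) (τ : ℍ) (z : ℂ) :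
    th a s τ z = e ((s : ℂ) ^ 2 / (4 * a) * τ + s * z) * th a 0 τ (z + s * τ / (2 * a)) := by
  have ha' : (a : ℂ) ≠ 0 := by exact_mod_cast ha.ne'
  rw [th_eq_jacobiTheta₂ ha, th_eq_jacobiTheta₂ ha]
  have h1 : (2 * a * (z + s * τ / (2 * a)) + ((0 : ℤ) : ℂ) * τ) = 2 * a * z + s * τ := by
    push_cast; field_simp; ring
  rw [h1]
  simp [e_zero]

/-- This rewrites `x/(cτ+d)` as a combination of `Aτ` and `1`, so that translations can be carried
through the action of `A`. -/
theorem one_div_aut (A : SL(2, ℤ)) (τ : ℍ) :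
    (aut A τ)⁻¹ = A 0 0 - A 1 0 * ((A • τ : ℍ) : ℂ) := by
  have h := aut_ne_zero A τ
  rw [smul_coe, inv_eq_iff_eq_inv, eq_comm, inv_eq_iff_eq_inv, eq_comm]
  field_simp
  rw [aut]
  linear_combination - det_eq_one A

/-- An element over `Γ(4a)` acts on `th a 0` by a scalar. -/
theorem exists_halfSlash_th_zero {a : ℕ} (ha : 0 < a) {γ : Mp2Z}
    (hγ : γ.mat ∈ CongruenceSubgroup.Gamma (4 * a)) :
    ∃ c : ℂ, halfSlash a γ (th a 0) = c • th a 0 := by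
  have ha' : (a : ℂ) ≠ 0 := by exact_mod_cast ha.ne'
  obtain ⟨c, hc⟩ := translationAverage_mem ha
    (halfSlash_mem_thSpace ha γ (th_mem_thSpace a 0))
  refine ⟨c, ?_⟩
  rw [← hc]
  obtain ⟨hA, hB, ⟨t, ht⟩, hD⟩ := dvd_of_mem_Gamma hγ
  funext τ z
  -- As `4a ∣ c`, the translation by `j/2a` becomes one by an element of `ℤ·Aτ + (2a)⁻¹ℤ`, under
  -- which `th a 0` is quasi-periodic. The slashed function thus equals its own average, which is a
  -- multiple of `th a 0`.
  have hinv : ∀ j : ℕ, halfSlash a γ (th a 0) τ (z + j / (2 * a)) =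
      halfSlash a γ (th a 0) τ z := fun j ↦ by
    simp only [halfSlash_apply]
    have hj := aut_ne_zero γ.mat τ
    have h10 : (γ.mat 1 0 : ℂ) = 4 * a * t := by rw [ht]; push_cast; ring
    have h1 : (aut γ.mat τ)⁻¹ * (z + j / (2 * a)) = (aut γ.mat τ)⁻¹ * z +
        ((-(2 * t * j) : ℤ) : ℂ) * ((γ.mat • τ : ℍ) : ℂ) +
          ((γ.mat 0 0 * j : ℤ) : ℂ) / (2 * a) := by
      have h2 : (aut γ.mat τ)⁻¹ * (j / (2 * a) : ℂ) = ((-(2 * t * j) : ℤ) : ℂ) *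
          ((γ.mat • τ : ℍ) : ℂ) + ((γ.mat 0 0 * j : ℤ) : ℂ) / (2 * a) := by
        rw [one_div_aut, h10]
        push_cast
        field_simp
        ring
      rw [mul_add, h2]
      ring
    rw [h1, th_zero_add ha]
    have h3 : e (-(a * ((-(2 * t * j) : ℤ) : ℂ) ^ 2 * ((γ.mat • τ : ℍ) : ℂ) +
          2 * a * ((-(2 * t * j) : ℤ) : ℂ) * ((aut γ.mat τ)⁻¹ * z))) *
        e (-(γ.mat 1 0 : ℂ) * (a * (z + j / (2 * a)) ^ 2) / aut γ.mat τ) =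
        e (-(γ.mat 1 0 : ℂ) * (a * z ^ 2) / aut γ.mat τ) := by
      rw [← e_add]
      refine e_eq_of_sub_eq_int (-(t * j ^ 2 * γ.mat 0 0)) ?_
      have h4 := one_div_aut γ.mat τ
      have h5 : (γ.mat 1 0 : ℂ) * ((γ.mat • τ : ℍ) : ℂ) = γ.mat 0 0 - (aut γ.mat τ)⁻¹ := by
        rw [h4]; ring
      rw [h10] at h5 ⊢
      simp only [div_eq_mul_inv _ (aut γ.mat τ)]
      generalize (aut γ.mat τ)⁻¹ = u at h5 ⊢
      generalize ((γ.mat • τ : ℍ) : ℂ) = σ at h5 ⊢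
      push_cast
      field_simp
      linear_combination (-(4 * t * j ^ 2) : ℂ) * h5
    rw [mul_comm (e _) (th _ _ _ _), mul_assoc (th _ _ _ _), h3]
  change _ = (2 * a : ℂ)⁻¹ * ∑ j ∈ Finset.range (2 * a),
    halfSlash a γ (th a 0) τ (z + j / (2 * a))
  simp only [hinv]
  simp
  field_simp

/-- An element over `Γ(4a)` acts on all `th a s` by the same scalar. -/
theorem halfSlash_th_of_th_zero {a : ℕ} (ha : 0 < a) {γ : Mp2Z}
    (hγ : γ.mat ∈ CongruenceSubgroup.Gamma (4 * a)) {c : ℂ}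
    (hc : halfSlash a γ (th a 0) = c • th a 0) (s : ℤ) :
    halfSlash a γ (th a s) = c • th a s := by
  have ha' : (a : ℂ) ≠ 0 := by exact_mod_cast ha.ne'
  obtain ⟨⟨x, hx⟩, ⟨y, hy⟩, -, -⟩ := dvd_of_mem_Gamma hγ
  funext τ z
  have hj := aut_ne_zero γ.mat τ
  have hA : (γ.mat 0 0 : ℂ) = 1 + 4 * a * x := by
    have : γ.mat 0 0 = 1 + 4 * a * x := by push_cast at hx; linarith
    rw [this]; push_cast; ring
  have hB : (γ.mat 0 1 : ℂ) = 4 * a * y := by rw [hy]; push_cast; ring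
  -- Chosen so that `z'/(cτ+d) = z/(cτ+d) + s·Aτ/2a`. Since `A ≡ 1 mod 4a`, it differs from `z +
  -- sτ/2a` by an element of `ℤτ + (2a)⁻¹ℤ`.
  set z' : ℂ := z + s * (γ.mat 0 0 * τ + γ.mat 0 1) / (2 * a) with hz'
  have h1 := congrFun (congrFun hc τ) z'
  simp only [halfSlash_apply, Pi.smul_apply, smul_eq_mul] at h1 ⊢
  have h2 : z' = z + s * τ / (2 * a) + ((2 * x * s : ℤ) : ℂ) * τ +
      ((4 * a * y * s : ℤ) : ℂ) / (2 * a) := by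
    rw [hz', hA, hB]
    push_cast
    field_simp
    ring
  have h3 : (aut γ.mat τ)⁻¹ * z + s * ((γ.mat • τ : ℍ) : ℂ) / (2 * a) =
      (aut γ.mat τ)⁻¹ * z' := by
    rw [hz', smul_coe]
    field_simp
  rw [th_eq_th_zero ha s (γ.mat • τ), h3, th_eq_th_zero ha s τ z]
  have h4 : th a 0 τ z' = e (-(a * ((2 * x * s : ℤ) : ℂ) ^ 2 * τ +
      2 * a * ((2 * x * s : ℤ) : ℂ) * (z + s * τ / (2 * a)))) * th a 0 τ (z + s * τ / (2 * a)) := by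
    rw [h2, th_zero_add ha]
  rw [h4] at h1
  have h5 : e ((s : ℂ) ^ 2 / (4 * a) * ((γ.mat • τ : ℍ) : ℂ) + s * ((aut γ.mat τ)⁻¹ * z)) *
      e (-(γ.mat 1 0 : ℂ) * (a * z ^ 2) / aut γ.mat τ) *
      e (-(a * ((2 * x * s : ℤ) : ℂ) ^ 2 * τ +
        2 * a * ((2 * x * s : ℤ) : ℂ) * (z + s * τ / (2 * a)))) =
      e (-(γ.mat 1 0 : ℂ) * (a * z' ^ 2) / aut γ.mat τ) *
        e ((s : ℂ) ^ 2 / (4 * a) * τ + s * z) := by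
    rw [← e_add, ← e_add, ← e_add]
    refine e_eq_of_sub_eq_int (s ^ 2 * y * γ.mat 0 0) ?_
    have hR : (aut γ.mat τ)⁻¹ + γ.mat 1 0 * ((γ.mat 0 0 * τ + γ.mat 0 1) * (aut γ.mat τ)⁻¹) =
        γ.mat 0 0 := by
      rw [← div_eq_mul_inv (_ + _), ← smul_coe, one_div_aut]
      ring
    rw [hz', smul_coe]
    simp only [div_eq_mul_inv _ (aut γ.mat τ)]
    generalize (aut γ.mat τ)⁻¹ = u at hR ⊢
    push_cast
    rw [hA, hB] at hR ⊢
    rw [← sub_eq_zero] at hR ⊢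
    rw [← mul_zero (s * z + s ^ 2 * ((1 + 4 * a * x) * τ + 4 * a * y) / (4 * a) : ℂ), ← hR]
    field_simp
    ring
  have h6 := e_ne_zero (-(a * ((2 * x * s : ℤ) : ℂ) ^ 2 * τ +
        2 * a * ((2 * x * s : ℤ) : ℂ) * (z + s * τ / (2 * a))))
  refine mul_right_cancel₀ h6 ?_
  linear_combination (th a 0 (γ.mat • τ) ((aut γ.mat τ)⁻¹ * z') * (γ.root τ)⁻¹) * h5 +
    e ((s : ℂ) ^ 2 / (4 * a) * τ + s * z) * h1

/-! ### The theta multiplier on principal congruence subgroups -/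

theorem hasSum_of_residues {d : ℕ} (hd : 0 < d) {f : ℤ → ℂ} {g : ℕ → ℂ}
    (h : ∀ ρ ∈ Finset.range d, HasSum (fun x : ℤ ↦ f (d * x + ρ)) (g ρ)) :
    HasSum f (∑ ρ ∈ Finset.range d, g ρ) := by
  have h1 : ∀ ρ ∈ Finset.range d,
      HasSum (fun m : ℤ ↦ if (d : ℤ) ∣ m - ρ then f m else 0) (g ρ) := fun ρ hρ ↦ by
    have hinj : Function.Injective fun x : ℤ ↦ d * x + (ρ : ℤ) := fun x y hxy ↦ by
      simpa [hd.ne'] using hxy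
    rw [← hinj.hasSum_iff]
    · refine (h ρ hρ).congr_fun fun x ↦ ?_
      simp
    · intro m hm
      rw [if_neg]
      rintro ⟨t, ht⟩
      exact hm ⟨t, by simp only; linarith⟩
  refine (hasSum_sum h1).congr_fun fun m ↦ ?_
  have hd' : (0 : ℤ) < d := by exact_mod_cast hd
  have hnn := Int.emod_nonneg m hd'.ne'
  have hlt := Int.emod_lt_of_pos m hd'
  rw [Finset.sum_eq_single (m % d).toNat]
  · rw [if_pos]
    rw [Int.toNat_of_nonneg hnn]
    exact Int.dvd_self_sub_emod
  · intro ρ hρ hne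
    rw [if_neg]
    intro hdvd
    apply hne
    have h2 : m % d = (ρ : ℤ) % d := ((Int.modEq_iff_dvd).2 hdvd).symm
    rw [Int.emod_eq_of_lt (a := (ρ : ℤ)) (by positivity)
      (by exact_mod_cast Finset.mem_range.1 hρ)] at h2
    rw [h2]
    simp
  · intro hm
    exact absurd (Finset.mem_range.2 (by omega)) hm

/-- Only the term `n = 0` survives as `Im w → ∞`; for `Im w ≥ 1` the terms are dominated by those at
`w = i`. -/
theorem tendsto_jacobiTheta₂_one (x : ℝ) :
    Tendsto (fun w : ℂ ↦ jacobiTheta₂ x w) (comap Complex.im atTop) (𝓝 1) := by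
  have hone : (1 : ℂ) = ∑' n : ℤ, if n = 0 then 1 else 0 := by simp
  rw [hone]
  refine tendsto_tsum_of_dominated_convergence
    (bound := fun n : ℤ ↦ ‖jacobiTheta₂_term n 0 Complex.I‖) ?_ ?_ ?_
  · exact ((summable_jacobiTheta₂_term_iff 0 Complex.I).2 (by simp)).norm
  · intro n
    split_ifs with hn
    · simpa [hn, jacobiTheta₂_term] using tendsto_const_nhds
    · rw [tendsto_zero_iff_norm_tendsto_zero]
      simp only [norm_jacobiTheta₂_term]
      refine Real.tendsto_exp_atBot.comp ?_
      have hpos : 0 < Real.pi * (n : ℝ) ^ 2 := by positivity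
      have h : Tendsto (fun w : ℂ ↦ (Real.pi * (n : ℝ) ^ 2) * w.im)
          (comap Complex.im atTop) atTop := tendsto_comap.const_mul_atTop hpos
      refine (tendsto_neg_atTop_atBot.comp h).congr fun w ↦ ?_
      simp
  · filter_upwards [preimage_mem_comap (Ici_mem_atTop (1 : ℝ))] with w hw n
    rw [norm_jacobiTheta₂_term, norm_jacobiTheta₂_term, Real.exp_le_exp]
    have hw' : (1 : ℝ) ≤ w.im := hw
    have hpos : 0 ≤ Real.pi * (n : ℝ) ^ 2 := by positivity
    simp
    nlinarith

theorem th_zero_apply_zero {a : ℕ} (ha : 0 < a) (τ : ℍ) :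
    th a 0 τ 0 = jacobiTheta₂ 0 (2 * a * τ) := by
  rw [th_eq_jacobiTheta₂ ha]
  simp [e_zero]

theorem theta_eq_th (τ : ℍ) : theta τ = th 1 0 τ 0 := by
  rw [th_zero_apply_zero one_pos, theta, jacobiTheta₂]
  refine tsum_congr fun r ↦ ?_
  rw [e, jacobiTheta₂_term]
  congr 1
  push_cast
  ring

/-- The expansion of `∑ q^{am²}` near the rational point `B / d`. -/
theorem th_zero_near_rational {a d : ℕ} (ha : 0 < a) (hd : 0 < d) (B : ℤ) (σ s : ℍ)
    (hσ : (σ : ℂ) = B / d + s) :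
    th a 0 σ 0 * (-Complex.I * (2 * a * d ^ 2 * s)) ^ (1 / 2 : ℂ) =
      ∑ ρ ∈ Finset.range d, e (a * B * (ρ : ℂ) ^ 2 / d) *
        jacobiTheta₂ ((ρ / d : ℝ) : ℂ) (-1 / (2 * a * d ^ 2 * s)) := by
  have ha' : (a : ℂ) ≠ 0 := by exact_mod_cast ha.ne'
  have hd' : (d : ℂ) ≠ 0 := by exact_mod_cast hd.ne'
  have hs := UpperHalfPlane.ne_zero s
  have him : 0 < (2 * a * (σ : ℂ)).im := by
    have : (2 * a * (σ : ℂ)).im = 2 * a * σ.im := by simp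
    rw [this]
    have := σ.im_pos
    positivity
  have hims : 0 < (2 * a * d ^ 2 * (s : ℂ)).im := by
    have h : (2 * a * d ^ 2 * (s : ℂ)) = ((2 * a * d ^ 2 : ℝ) : ℂ) * s := by push_cast; ring
    rw [h, Complex.im_ofReal_mul]
    have := s.im_pos
    have : 0 < (s : ℂ).im := this
    positivity
  set R := (-Complex.I * (2 * a * d ^ 2 * (s : ℂ))) ^ (1 / 2 : ℂ) with hR
  have hR0 : R ≠ 0 := by
    simp [hR, Complex.cpow_eq_zero_iff, ha', hd', hs]
  rw [th_zero_apply_zero ha]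
  -- Split the summation index as `dx + ρ`: the factor `e(aBm²/d)` depends only on `ρ`, and Poisson
  -- summation applies to the sum over `x`.
  have h1 : ∀ ρ ∈ Finset.range d,
      HasSum (fun x : ℤ ↦ jacobiTheta₂_term (d * x + ρ) 0 (2 * a * σ))
        (e (a * B * (ρ : ℂ) ^ 2 / d) * R⁻¹ *
          jacobiTheta₂ ((ρ / d : ℝ) : ℂ) (-1 / (2 * a * d ^ 2 * s))) := fun ρ _ ↦ by
    have h2 := (hasSum_jacobiTheta₂_term (2 * a * d * ρ * s) hims).mul_left
      (e (a * B * (ρ : ℂ) ^ 2 / d) * e (a * ρ ^ 2 * s))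
    rw [jacobiTheta₂_functional_equation] at h2
    have h3 : (2 * a * d * ρ * (s : ℂ)) / (2 * a * d ^ 2 * s) = ((ρ / d : ℝ) : ℂ) := by
      push_cast
      field_simp
    have h4 : e (a * ρ ^ 2 * (s : ℂ)) * Complex.exp (-Real.pi * Complex.I *
        (2 * a * d * ρ * (s : ℂ)) ^ 2 / (2 * a * d ^ 2 * s)) = 1 := by
      rw [e, ← Complex.exp_add, ← Complex.exp_zero]
      congr 1
      field_simp
      ring
    rw [h3, ← hR] at h2
    have h5 : e (a * B * (ρ : ℂ) ^ 2 / d) * R⁻¹ *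
          jacobiTheta₂ ((ρ / d : ℝ) : ℂ) (-1 / (2 * a * d ^ 2 * s)) =
        e (a * B * (ρ : ℂ) ^ 2 / d) * e (a * ρ ^ 2 * (s : ℂ)) * (1 / R *
          Complex.exp (-Real.pi * Complex.I *
            (2 * a * d * ρ * (s : ℂ)) ^ 2 / (2 * a * d ^ 2 * s)) *
          jacobiTheta₂ ((ρ / d : ℝ) : ℂ) (-1 / (2 * a * d ^ 2 * s))) := by
      rw [one_div]
      linear_combination (-(e (a * B * (ρ : ℂ) ^ 2 / d) * R⁻¹ *
          jacobiTheta₂ ((ρ / d : ℝ) : ℂ) (-1 / (2 * a * d ^ 2 * s)))) * h4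
    rw [h5]
    refine h2.congr_fun fun x ↦ ?_
    have h6 : e (a * B * (d * x ^ 2 + 2 * x * ρ) : ℂ) = 1 := by
      rw [← e_int (a * B * (d * x ^ 2 + 2 * x * ρ))]
      congr 1
      push_cast
      ring
    have h7 : jacobiTheta₂_term (d * x + ρ) 0 (2 * a * σ) =
        e (a * B * (d * x ^ 2 + 2 * x * ρ) : ℂ) * (e (a * B * (ρ : ℂ) ^ 2 / d) *
          e (a * ρ ^ 2 * (s : ℂ)) * jacobiTheta₂_term x (2 * a * d * ρ * s)
            (2 * a * d ^ 2 * s)) := by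
      simp only [jacobiTheta₂_term, e, ← Complex.exp_add]
      congr 1
      rw [hσ]
      push_cast
      field_simp
      ring
    rw [h7, h6, one_mul]
  have h8 := (hasSum_jacobiTheta₂_term 0 him).unique (hasSum_of_residues hd h1)
  rw [h8, Finset.sum_mul]
  refine Finset.sum_congr rfl fun ρ _ ↦ ?_
  field_simp

/-- The filter of neighbourhoods of the cusp `0` in `ℍ`. -/
def atCuspZero : Filter ℍ := comap (fun τ : ℍ ↦ (-1 / (τ : ℂ)).im) atTop

instance : atCuspZero.NeBot := by
  refine comap_neBot fun s hs ↦ ?_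
  obtain ⟨t, ht⟩ := mem_atTop_sets.1 hs
  have hpos : 0 < max t 1 := lt_of_lt_of_le one_pos (le_max_right _ _)
  refine ⟨⟨Complex.I / (max t 1 : ℝ), ?_⟩, ht _ ?_⟩
  · rw [Complex.div_ofReal_im]
    simp
  · have h : (-1 / (Complex.I / ((max t 1 : ℝ) : ℂ))) = Complex.I * (max t 1 : ℝ) := by
      have := Complex.I_ne_zero
      have : ((max t 1 : ℝ) : ℂ) ≠ 0 := by exact_mod_cast hpos.ne'
      field_simp
      simp
    change t ≤ (-1 / (Complex.I / ((max t 1 : ℝ) : ℂ))).im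
    rw [h]
    simp

theorem tendsto_jacobiTheta₂_atCuspZero (x : ℝ) {g : ℍ → ℂ} {r : ℝ} (hr : 0 < r)
    (hg : ∀ τ : ℍ, (g τ).im = r * (-1 / (τ : ℂ)).im) :
    Tendsto (fun τ ↦ jacobiTheta₂ x (g τ)) atCuspZero (𝓝 1) := by
  refine (tendsto_jacobiTheta₂_one x).comp (tendsto_comap_iff.2 ?_)
  have h : Tendsto (fun τ : ℍ ↦ r * (-1 / (τ : ℂ)).im) atCuspZero atTop :=
    tendsto_comap.const_mul_atTop hr
  exact h.congr fun τ ↦ (hg τ).symm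

/-- The quadratic Gauss sum `∑_{ρ mod d} e(bρ²/d)`. -/
def quadGauss (b : ℤ) (d : ℕ) : ℂ := ∑ ρ ∈ Finset.range d, e (b * (ρ : ℂ) ^ 2 / d)

/-- The correction factor in the comparison of theta functions at the cusps `0` and `γ0`. -/
def cuspFactor (γ : Mp2Z) (τ : ℍ) : ℂ :=
  γ.root τ * (-Complex.I * ((γ.mat 1 1 : ℂ) * τ / aut γ.mat τ)) ^ (1 / 2 : ℂ) /
    (-Complex.I * τ) ^ (1 / 2 : ℂ)

theorem cpow_half_sq (x : ℂ) : (x ^ (1 / 2 : ℂ)) ^ 2 = x := by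
  rw [← Complex.cpow_nat_mul]
  simp

/-- The branches of the square roots disappear on squaring. The sign of `cuspFactor` itself is never
needed, because the factor does not depend on the index `a`. -/
theorem cuspFactor_sq (γ : Mp2Z) (τ : ℍ) : cuspFactor γ τ ^ 2 = γ.mat 1 1 := by
  have hτ := UpperHalfPlane.ne_zero τ
  have hj := aut_ne_zero γ.mat τ
  rw [cuspFactor, div_pow, mul_pow, cpow_half_sq, cpow_half_sq, γ.sq]
  have := Complex.I_ne_zero
  field_simp

/-- The multiplier of `th a 0` is determined by a Gauss sum. -/
theorem tendsto_mul_cuspFactor {a d : ℕ} (ha : 0 < a) (hd : 0 < d) {γ : Mp2Z}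
    (hγ : γ.mat 1 1 = d) {c : ℂ} (hc : halfSlash a γ (th a 0) = c • th a 0) :
    Tendsto (fun τ ↦ c * cuspFactor γ τ) atCuspZero (𝓝 (quadGauss (a * γ.mat 0 1) d)) := by
  have ha' : (a : ℂ) ≠ 0 := by exact_mod_cast ha.ne'
  have hd' : (d : ℂ) ≠ 0 := by exact_mod_cast hd.ne'
  have hD : (γ.mat 1 1 : ℂ) = d := by rw [hγ]; simp
  -- At the cusp `0` all theta functions in the expansion near `b/d` tend to `1`, which leaves the
  -- Gauss sum.
  have hF : Tendsto (fun τ : ℍ ↦ ∑ ρ ∈ Finset.range d, e (a * γ.mat 0 1 * (ρ : ℂ) ^ 2 / d) *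
      jacobiTheta₂ ((ρ / d : ℝ) : ℂ) (-(aut γ.mat τ) / (2 * a * d * τ))) atCuspZero
      (𝓝 (∑ ρ ∈ Finset.range d, e (a * γ.mat 0 1 * (ρ : ℂ) ^ 2 / d) * 1)) := by
    refine tendsto_finsetSum _ fun ρ _ ↦ Tendsto.const_mul _ ?_
    refine tendsto_jacobiTheta₂_atCuspZero _ (r := (2 * a : ℝ)⁻¹) (by positivity) fun τ ↦ ?_
    have hτ := UpperHalfPlane.ne_zero τ
    have h : -(aut γ.mat τ) / (2 * a * d * (τ : ℂ)) =
        ((-(γ.mat 1 0) / (2 * a * d) : ℝ) : ℂ) + ((2 * a : ℝ)⁻¹ : ℝ) * (-1 / (τ : ℂ)) := by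
      rw [aut, hD]
      push_cast
      field_simp
      ring
    rw [h, Complex.add_im, Complex.ofReal_im, Complex.im_ofReal_mul, zero_add]
  have hH : Tendsto (fun τ : ℍ ↦ jacobiTheta₂ ((0 : ℝ) : ℂ) (-1 / (2 * a * τ))) atCuspZero
      (𝓝 1) := by
    refine tendsto_jacobiTheta₂_atCuspZero _ (r := (2 * a : ℝ)⁻¹) (by positivity) fun τ ↦ ?_
    have hτ := UpperHalfPlane.ne_zero τ
    have h : -1 / (2 * a * (τ : ℂ)) = ((2 * a : ℝ)⁻¹ : ℝ) * (-1 / (τ : ℂ)) := by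
      push_cast
      field_simp
    rw [h, Complex.im_ofReal_mul]
  have hG : quadGauss (a * γ.mat 0 1) d =
      (∑ ρ ∈ Finset.range d, e (a * γ.mat 0 1 * (ρ : ℂ) ^ 2 / d) * 1) / 1 := by
    simp [quadGauss]
  rw [hG]
  refine (hF.div hH one_ne_zero).congr' ?_
  filter_upwards [hH.eventually_ne one_ne_zero] with τ hne
  have hτ := UpperHalfPlane.ne_zero τ
  have hj := aut_ne_zero γ.mat τ
  -- From `ad - bc = 1` one gets `γτ = b/d + τ/(d(cτ+d))`; the second summand plays the role of `s`
  -- in `th_zero_near_rational`.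
  have him : 0 < ((τ : ℂ) / (d * aut γ.mat τ)).im := by
    have h : (τ : ℂ) / (d * aut γ.mat τ) =
        ((γ.mat • τ : ℍ) : ℂ) - ((γ.mat 0 1 / d : ℝ) : ℂ) := by
      rw [smul_coe]
      push_cast
      field_simp
      rw [aut, hD]
      linear_combination (-(τ : ℂ)) * det_eq_one γ.mat + γ.mat 0 0 * τ * hD
    rw [h, Complex.sub_im, Complex.ofReal_im, sub_zero]
    exact (γ.mat • τ).im_pos
  have h1 := th_zero_near_rational ha hd (γ.mat 0 1) (γ.mat • τ) ⟨_, him⟩ (by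
    change _ = _ + (τ : ℂ) / (d * aut γ.mat τ)
    rw [smul_coe]
    field_simp
    rw [aut, hD]
    linear_combination (τ : ℂ) * det_eq_one γ.mat - γ.mat 0 0 * τ * hD)
  have h2 := th_zero_near_rational ha one_pos 0 τ τ (by simp)
  have h3 := congrFun (congrFun hc τ) 0
  simp only [halfSlash_apply, Pi.smul_apply, smul_eq_mul, mul_zero, ne_eq, OfNat.ofNat_ne_zero,
    not_false_eq_true, zero_pow, zero_div, e_zero, mul_one] at h3
  have hroot := γ.root_ne_zero τ
  have h4 : -1 / (2 * a * d ^ 2 * ((τ : ℂ) / (d * aut γ.mat τ))) =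
      -(aut γ.mat τ) / (2 * a * d * τ) := by field_simp
  have hI := Complex.I_ne_zero
  have h5 : (-Complex.I * (2 * a * d ^ 2 * ((τ : ℂ) / (d * aut γ.mat τ)))) ^ (1 / 2 : ℂ) =
      (2 * a : ℂ) ^ (1 / 2 : ℂ) *
        (-Complex.I * ((γ.mat 1 1 : ℂ) * τ / aut γ.mat τ)) ^ (1 / 2 : ℂ) := by
    rw [show (-Complex.I * (2 * a * d ^ 2 * ((τ : ℂ) / (d * aut γ.mat τ)))) =
      ((2 * a : ℝ) : ℂ) * (-Complex.I * ((γ.mat 1 1 : ℂ) * τ / aut γ.mat τ)) by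
        rw [hD]; push_cast; field_simp, ofReal_mul_cpow (by positivity)]
    · push_cast; rfl
    · rw [hD]
      exact mul_ne_zero (neg_ne_zero.2 hI) (div_ne_zero (mul_ne_zero hd' hτ) hj)
  have h6 : (-Complex.I * (2 * a * ((1 : ℕ) : ℂ) ^ 2 * (τ : ℂ))) ^ (1 / 2 : ℂ) =
      (2 * a : ℂ) ^ (1 / 2 : ℂ) * (-Complex.I * (τ : ℂ)) ^ (1 / 2 : ℂ) := by
    rw [show (-Complex.I * (2 * a * ((1 : ℕ) : ℂ) ^ 2 * (τ : ℂ))) =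
      ((2 * a : ℝ) : ℂ) * (-Complex.I * (τ : ℂ)) by push_cast; ring,
      ofReal_mul_cpow (by positivity) (mul_ne_zero (neg_ne_zero.2 hI) hτ)]
    push_cast; rfl
  have h7 : (2 * a : ℂ) ^ (1 / 2 : ℂ) ≠ 0 := by simp [Complex.cpow_eq_zero_iff, ha']
  have h8 : (-Complex.I * (τ : ℂ)) ^ (1 / 2 : ℂ) ≠ 0 := by
    simp [Complex.cpow_eq_zero_iff, hτ]
  rw [UpperHalfPlane.coe_mk, h4, h5] at h1
  rw [h6] at h2
  simp only [Finset.sum_range_one, Nat.cast_one, Nat.cast_zero, Int.cast_zero, mul_zero, div_one,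
    e_zero, one_mul, one_pow, mul_one, zero_mul] at h2
  simp only [Pi.div_apply]
  rw [← h1, ← h2, cuspFactor]
  have h9 : th a 0 τ 0 ≠ 0 := fun h ↦ hne (by rw [← h2, h, zero_mul])
  have h10 : th a 0 (γ.mat • τ) 0 = c * th a 0 τ 0 * γ.root τ := by
    rw [← h3]; field_simp
  rw [h10]
  field_simp

/-- The substitution `ρ ↦ uρ` permutes the residues modulo `d`. -/
theorem quadGauss_eq_of_sq {d : ℕ} [NeZero d] {b b' : ℤ} (u : (ZMod d)ˣ)
    (h : (b : ZMod d) = b' * u ^ 2) : quadGauss b d = quadGauss b' d := by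
  have hd' : (d : ℂ) ≠ 0 := by exact_mod_cast NeZero.ne d
  have key : ∀ b : ℤ, quadGauss b d = ∑ x : ZMod d, e (b * (x.val : ℂ) ^ 2 / d) := fun b ↦ by
    rw [quadGauss]
    refine Finset.sum_bij (fun ρ _ ↦ (ρ : ZMod d)) (fun _ _ ↦ Finset.mem_univ _)
      (fun ρ hρ ρ' hρ' hh ↦ ?_) (fun x _ ↦ ?_) (fun ρ hρ ↦ ?_)
    · have := congrArg ZMod.val hh
      rwa [ZMod.val_cast_of_lt (Finset.mem_range.1 hρ),
        ZMod.val_cast_of_lt (Finset.mem_range.1 hρ')] at this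
    · exact ⟨x.val, Finset.mem_range.2 (ZMod.val_lt x), ZMod.natCast_zmod_val x⟩
    · rw [ZMod.val_cast_of_lt (Finset.mem_range.1 hρ)]
  rw [key, key]
  refine Fintype.sum_equiv u.mulLeft _ _ fun x ↦ ?_
  have hz : ((b * (x.val : ℤ) ^ 2 - b' * (((u : ZMod d) * x).val : ℤ) ^ 2 : ℤ) : ZMod d) = 0 := by
    push_cast
    rw [ZMod.natCast_zmod_val, ZMod.natCast_zmod_val, h]
    ring
  rw [ZMod.intCast_zmod_eq_zero_iff_dvd] at hz
  obtain ⟨t, ht⟩ := hz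
  refine e_eq_of_sub_eq_int t ?_
  have ht' := congrArg (Int.cast : ℤ → ℂ) ht
  push_cast at ht'
  rw [← sub_div, div_eq_iff hd', mul_comm (t : ℂ), ← ht']
  rfl

theorem halfSlash_T_pow_th {a : ℕ} (ha : 0 < a) (s : ℤ) (n : ℕ) :
    halfSlash a (Mp2Z.T ^ n) (th a s) = e (n * ((s : ℂ) ^ 2 / (4 * a))) • th a s := by
  induction n with
  | zero => simp [halfSlash_one, e_zero]
  | succ n ih =>
    rw [pow_succ, halfSlash_mul, ih, map_smul, halfSlash_T_th ha, smul_smul, ← e_add]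
    congr 2
    push_cast
    ring

theorem halfSlash_T_zpow_th {a N : ℕ} (ha : 0 < a) (hN : 4 * a ∣ N) (s t : ℤ) :
    halfSlash a ((Mp2Z.T ^ N) ^ t) (th a s) = th a s := by
  have ha' : (a : ℂ) ≠ 0 := by exact_mod_cast ha.ne'
  obtain ⟨x, rfl⟩ := hN
  have h1 : halfSlash a (Mp2Z.T ^ (4 * a * x)) (th a s) = th a s := by
    rw [halfSlash_T_pow_th ha]
    have : e (((4 * a * x : ℕ) : ℂ) * ((s : ℂ) ^ 2 / (4 * a))) = 1 := by
      rw [← e_int (x * s ^ 2)]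
      congr 1
      push_cast
      field_simp
    rw [this, one_smul]
  have h2 : halfSlash a (Mp2Z.T ^ (4 * a * x))⁻¹ (th a s) = th a s := by
    conv_lhs => rw [← h1]
    rw [← halfSlash_mul, mul_inv_cancel, halfSlash_one]
  induction t using Int.induction_on with
  | zero => rw [zpow_zero, halfSlash_one]
  | succ n ih => rw [zpow_add_one, halfSlash_mul, ih, h1]
  | pred n ih => rw [zpow_sub_one, halfSlash_mul, ih, h2]

theorem Gamma_le_of_dvd {N N' : ℕ} (h : N ∣ N') {γ : SL(2, ℤ)}
    (hγ : γ ∈ CongruenceSubgroup.Gamma N') : γ ∈ CongruenceSubgroup.Gamma N := by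
  obtain ⟨h1, h2, h3, h4⟩ := dvd_of_mem_Gamma hγ
  have hd : (N : ℤ) ∣ N' := Int.natCast_dvd_natCast.2 h
  rw [CongruenceSubgroup.Gamma_mem]
  have key : ∀ x : ℤ, (N' : ℤ) ∣ x → (x : ZMod N) = 0 := fun x hx ↦
    (ZMod.intCast_zmod_eq_zero_iff_dvd _ _).2 (hd.trans hx)
  refine ⟨?_, key _ h2, key _ h3, ?_⟩
  · have := key _ h1
    push_cast at this
    exact sub_eq_zero.1 this
  · have := key _ h4
    push_cast at this
    exact sub_eq_zero.1 this

/-- The scalars by which an element over `Γ(4a)` acts on the theta functions of index `a` and of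
index `1` agree, if `a` and `-1` are squares modulo the lower right entry. -/
theorem exists_scalar_of_isSquare {a d : ℕ} (ha : 0 < a) [NeZero d] {γ : Mp2Z}
    (hγ : γ.mat ∈ CongruenceSubgroup.Gamma (4 * a)) (hd : γ.mat 1 1 = d)
    (hsq : ∃ u : (ZMod d)ˣ, (a : ZMod d) = u ^ 2) (hneg : ∃ v : (ZMod d)ˣ, (-1 : ZMod d) = v ^ 2) :
    ∃ c : ℂ, (∀ s, halfSlash a γ (th a s) = c • th a s) ∧
      (∀ s, halfSlash 1 γ (th 1 s) = c • th 1 s) ∧ ∃ x : ℝ, 0 ≤ x ∧ c ^ 2 = x := by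
  have hd0 : 0 < d := Nat.pos_of_ne_zero (NeZero.ne d)
  have hγ1 : γ.mat ∈ CongruenceSubgroup.Gamma (4 * 1) := Gamma_le_of_dvd ⟨a, by ring⟩ hγ
  obtain ⟨c, hc⟩ := exists_halfSlash_th_zero ha hγ
  obtain ⟨c', hc'⟩ := exists_halfSlash_th_zero one_pos hγ1
  have h1 := tendsto_mul_cuspFactor ha hd0 hd hc
  have h2 := tendsto_mul_cuspFactor one_pos hd0 hd hc'
  obtain ⟨u, hu⟩ := hsq
  have hG : quadGauss (a * γ.mat 0 1) d = quadGauss ((1 : ℕ) * γ.mat 0 1) d :=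
    quadGauss_eq_of_sq u (by push_cast; rw [hu]; ring)
  obtain ⟨v, hv⟩ := hneg
  have hG' : quadGauss (-(a * γ.mat 0 1)) d = quadGauss (a * γ.mat 0 1) d :=
    quadGauss_eq_of_sq v (by push_cast; rw [← hv]; ring)
  have hD : (γ.mat 1 1 : ℂ) = d := by rw [hd]; simp
  have hd' : (d : ℂ) ≠ 0 := by exact_mod_cast NeZero.ne d
  -- `c` and `c'` multiplied by the same `cuspFactor` have the same limit, and the square of that
  -- factor is the nonzero constant `d`.
  have hcc : c = c' := by
    rw [hG] at h1
    have h3 := (h1.sub h2).pow 2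
    have h4 : (fun τ ↦ (c * cuspFactor γ τ - c' * cuspFactor γ τ) ^ 2) =
        fun _ ↦ (c - c') ^ 2 * d := by
      funext τ
      rw [← sub_mul, mul_pow, cuspFactor_sq, hD]
    rw [h4, sub_self] at h3
    have h5 := tendsto_nhds_unique tendsto_const_nhds h3
    have h6 : (c - c') ^ 2 = 0 := by
      rcases mul_eq_zero.1 (h5.trans (by simp)) with h | h
      · exact h
      · exact absurd h hd'
    exact sub_eq_zero.1 (pow_eq_zero_iff two_ne_zero |>.1 h6)
  subst hcc
  refine ⟨c, halfSlash_th_of_th_zero ha hγ hc, halfSlash_th_of_th_zero one_pos hγ1 hc', ?_⟩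
  -- Since `-1` is a square modulo `d`, the Gauss sum is real; hence `c²d` is the square of a real
  -- number.
  have hconj : (starRingEnd ℂ) (quadGauss (a * γ.mat 0 1) d) = quadGauss (a * γ.mat 0 1) d := by
    refine Eq.trans ?_ hG'
    simp only [quadGauss, map_sum]
    refine Finset.sum_congr rfl fun ρ _ ↦ ?_
    rw [e, e, ← Complex.exp_conj]
    congr 1
    simp only [map_mul, map_div₀, map_pow, Complex.conj_ofReal, Complex.conj_I, map_natCast,
      map_intCast, map_ofNat]
    push_cast
    ring
  obtain ⟨g, hg⟩ := Complex.conj_eq_iff_real.1 hconj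
  have h3 := h1.pow 2
  have h4 : (fun τ ↦ (c * cuspFactor γ τ) ^ 2) = fun _ ↦ c ^ 2 * d := by
    funext τ
    rw [mul_pow, cuspFactor_sq, hD]
  rw [h4, hg] at h3
  have h5 := tendsto_nhds_unique tendsto_const_nhds h3
  refine ⟨g ^ 2 / d, by positivity, ?_⟩
  push_cast
  rw [← h5]
  field_simp

/-- By quadratic reciprocity the symbol of `a` modulo an odd `p` depends only on `p mod 4a`, and `p
≡ 1`. Moreover `p ≡ 1 mod 4` makes `-1` a square. -/
theorem exists_unit_sq_of_prime {a p : ℕ} (ha : 0 < a) (hp : p.Prime) (h : (4 * a : ℤ) ∣ p - 1) :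
    (∃ u : (ZMod p)ˣ, (a : ZMod p) = u ^ 2) ∧ ∃ v : (ZMod p)ˣ, (-1 : ZMod p) = v ^ 2 := by
  have : Fact p.Prime := ⟨hp⟩
  have hmod : p % (4 * a) = 1 % (4 * a) := by
    have : ((1 : ℕ) : ℤ) ≡ p [ZMOD (4 * a : ℕ)] := Int.modEq_iff_dvd.2 (by exact_mod_cast h)
    exact (Int.natCast_modEq_iff.1 this).symm
  have hmod4 : p % 4 = 1 := by
    have : p % (4 * a) % 4 = p % 4 := Nat.mod_mul_right_mod p 4 a
    rw [← this, hmod, Nat.mod_mul_right_mod]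
  have hodd : Odd p := Nat.odd_iff.2 (by omega)
  have hsq : ∀ x : ZMod p, x ≠ 0 → IsSquare x → ∃ u : (ZMod p)ˣ, x = u ^ 2 := by
    rintro x hx ⟨y, rfl⟩
    have hy : y ≠ 0 := fun hy ↦ hx (by rw [hy, mul_zero])
    exact ⟨Units.mk0 y hy, by simp [sq]⟩
  constructor
  · have hJ : jacobiSym a p = 1 := by
      rw [jacobiSym.mod_right _ hodd]
      simp only [Int.natAbs_natCast, hmod]
      rw [Nat.mod_eq_of_lt (by omega), jacobiSym.one_right]
    rw [← jacobiSym.legendreSym.to_jacobiSym] at hJ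
    have hne : ((a : ℤ) : ZMod p) ≠ 0 := fun h0 ↦ by
      rw [(legendreSym.eq_zero_iff p a).2 h0] at hJ
      exact zero_ne_one hJ
    have := hsq _ hne ((legendreSym.eq_one_iff p hne).1 hJ)
    simpa using this
  · refine hsq _ (neg_ne_zero.2 one_ne_zero) (ZMod.exists_sq_eq_neg_one_iff.2 (by omega))

/-- An element over `Γ(4a)` acts by the same scalar on all theta functions of index `a` and of
index `1`. -/
theorem exists_scalar {a : ℕ} (ha : 0 < a) {γ : Mp2Z}
    (hγ : γ.mat ∈ CongruenceSubgroup.Gamma (4 * a)) :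
    ∃ c : ℂ, (∀ s, halfSlash a γ (th a s) = c • th a s) ∧
      (∀ s, halfSlash 1 γ (th 1 s) = c • th 1 s) ∧ ∃ x : ℝ, 0 ≤ x ∧ c ^ 2 = x := by
  obtain ⟨-, hB, hC, hD⟩ := dvd_of_mem_Gamma hγ
  push_cast at hB hC hD
  have hdet : γ.mat 0 0 * γ.mat 1 1 - γ.mat 0 1 * γ.mat 1 0 = 1 := by
    have := γ.mat.det_coe
    rwa [Matrix.det_fin_two] at this
  -- If `c = 0`, then `d = ±1`, and `d ≡ 1 mod 4a` excludes `-1`; modulo `1` everything is a square.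
  rcases eq_or_ne (γ.mat 1 0) 0 with h0 | h0
  · have hD1 : γ.mat 1 1 = 1 := by
      rw [h0, mul_zero, sub_zero] at hdet
      rcases Int.mul_eq_one_iff_eq_one_or_neg_one.1 hdet with ⟨-, h⟩ | ⟨-, h⟩
      · exact h
      · rw [h] at hD
        have := Int.le_of_dvd (by norm_num) ((dvd_neg.2 hD) : (4 * a : ℤ) ∣ -(-1 - 1))
        omega
    exact exists_scalar_of_isSquare (d := 1) ha hγ (by simpa using hD1)
      ⟨1, Subsingleton.elim _ _⟩ ⟨1, Subsingleton.elim _ _⟩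
  · have hco : IsCoprime (γ.mat 1 1) (4 * a * γ.mat 1 0) := by
      refine IsCoprime.mul_right ?_ ⟨γ.mat 0 0, -γ.mat 0 1, by linear_combination hdet⟩
      obtain ⟨t, ht⟩ := hD
      exact ⟨1, -t, by linear_combination ht⟩
    obtain ⟨p, t, hp, -, hpt⟩ := exists_prime_eq_add_mul hco
      (mul_ne_zero (by positivity) h0) 0
    have : NeZero p := ⟨hp.ne_zero⟩
    -- Right multiplication by `T^{4at}` replaces `d` by the prime `d + 4atc` and does not affect
    -- the action on theta functions whose index `b` satisfies `4b ∣ 4a`.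
    set γ' := γ * (Mp2Z.T ^ (4 * a)) ^ t with hγ'
    have hmat : γ'.mat = γ.mat * ModularGroup.T ^ (4 * a * t) := by
      rw [hγ', Mp2Z.mul_mat, ← zpow_natCast, ← zpow_mul, Mp2Z.T_zpow_mat]
      push_cast
      rfl
    have hT : (ModularGroup.T ^ (4 * a * t : ℤ) : SL(2, ℤ)) ∈
        CongruenceSubgroup.Gamma (4 * a) := by
      simpa using CongruenceSubgroup.ModularGroup_T_pow_mem_Gamma (4 * a : ℕ) (4 * a * t)
        (by push_cast; exact dvd_mul_right _ _)
    have hγ'mem : γ'.mat ∈ CongruenceSubgroup.Gamma (4 * a) := by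
      rw [hmat]
      exact mul_mem hγ hT
    have h11 : γ'.mat 1 1 = p := by
      rw [hmat, mul_entry, T_zpow_entry, T_zpow_entry, ← hpt]
      simp
      ring
    have hp1 : (4 * a : ℤ) ∣ p - 1 := by
      rw [← hpt, show γ.mat 1 1 + t * (4 * a * γ.mat 1 0) - 1 =
        (γ.mat 1 1 - 1) + 4 * a * (t * γ.mat 1 0) by ring]
      exact dvd_add hD (dvd_mul_right _ _)
    obtain ⟨hu, hv⟩ := exists_unit_sq_of_prime ha hp hp1
    obtain ⟨c, h1, h2, h3⟩ := exists_scalar_of_isSquare ha hγ'mem h11 hu hv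
    have hback : ∀ {b : ℕ} (_ : 0 < b) (_ : 4 * b ∣ 4 * a) (s : ℤ),
        halfSlash b γ' (th b s) = c • th b s → halfSlash b γ (th b s) = c • th b s := by
      intro b hb hba s h
      have hγγ' : γ = γ' * (Mp2Z.T ^ (4 * a)) ^ (-t) := by rw [hγ']; group
      rw [hγγ', halfSlash_mul, h, map_smul, halfSlash_T_zpow_th hb hba]
    exact ⟨c, fun s ↦ hback ha dvd_rfl s (h1 s),
      fun s ↦ hback one_pos ⟨a, by ring⟩ s (h2 s), h3⟩

/-! ### The theta function has no zeros -/

/-- `n² ≡ n mod 2`, so `e(n²/2) = e(n/2)`. -/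
theorem jacobiTheta₂_add_one_right (z τ : ℂ) :
    jacobiTheta₂ z (τ + 1) = jacobiTheta₂ (z + 1 / 2) τ := by
  refine tsum_congr fun n ↦ ?_
  have h : Even (n * (n - 1)) := Int.even_mul_pred_self n
  obtain ⟨t, ht⟩ := h
  rw [jacobiTheta₂_term, jacobiTheta₂_term, Complex.exp_eq_exp_iff_exists_int]
  refine ⟨t, ?_⟩
  have ht' := congrArg (Int.cast : ℤ → ℂ) ht
  push_cast at ht'
  linear_combination (Real.pi * Complex.I) * ht'

/-- The product of the three even theta constants, up to a factor without zeros. -/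
def thetaProduct (τ : ℂ) : ℂ := jacobiTheta₂ 0 τ * jacobiTheta₂ (1 / 2) τ * jacobiTheta₂ (τ / 2) τ

theorem thetaProduct_add_one (τ : ℂ) : thetaProduct (τ + 1) = thetaProduct τ := by
  simp only [thetaProduct, jacobiTheta₂_add_one_right]
  have h1 : jacobiTheta₂ (1 / 2 + 1 / 2) τ = jacobiTheta₂ 0 τ := by
    rw [show (1 / 2 + 1 / 2 : ℂ) = 0 + 1 by norm_num, jacobiTheta₂_add_left]
  have h2 : jacobiTheta₂ ((τ + 1) / 2 + 1 / 2) τ = jacobiTheta₂ (τ / 2) τ := by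
    rw [show (τ + 1) / 2 + 1 / 2 = τ / 2 + 1 by ring, jacobiTheta₂_add_left]
  rw [h1, h2, zero_add]
  ring

/-- Up to nonvanishing factors, the inversion fixes the first theta constant and exchanges the other
two. -/
theorem thetaProduct_neg_inv {τ : ℂ} (hτ : τ ≠ 0) :
    thetaProduct τ = 0 ↔ thetaProduct (-1 / τ) = 0 := by
  have key : ∀ z, jacobiTheta₂ z τ = 0 ↔ jacobiTheta₂ (z / τ) (-1 / τ) = 0 := fun z ↦ by
    rw [jacobiTheta₂_functional_equation]
    simp [hτ]
  simp only [thetaProduct, mul_eq_zero, key]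
  have h1 : (τ / 2) / τ = 1 / 2 := by field_simp
  have h2 : (1 / 2) / τ = -(-1 / τ / 2) := by ring
  rw [h1, h2, jacobiTheta₂_neg_left, zero_div]
  tauto

theorem thetaProduct_smul (A : SL(2, ℤ)) (τ : ℍ) :
    thetaProduct τ = 0 ↔ thetaProduct (A • τ : ℍ) = 0 := by
  have h : A ∈ Subgroup.closure ({ModularGroup.S, ModularGroup.T} : Set SL(2, ℤ)) := by
    rw [SpecialLinearGroup.SL2Z_generators]; trivial
  induction h using Subgroup.closure_induction generalizing τ with
  | mem x hx =>
    rcases hx with rfl | rfl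
    · rw [coe_S_smul]
      exact thetaProduct_neg_inv (UpperHalfPlane.ne_zero τ)
    · rw [coe_T_smul, thetaProduct_add_one]
  | one => simp
  | mul x y _ _ hx hy => exact (hy τ).trans (by rw [mul_smul]; exact hx (y • τ))
  | inv x _ hx =>
    have := hx (x⁻¹ • τ)
    rw [smul_inv_smul] at this
    exact this.symm

/-- The tail is at most `r/(1-r)`, which is below `1/2` exactly when `r < 1/3`. -/
theorem norm_sub_one_lt {g : ℕ → ℂ} {S : ℂ} {r : ℝ} (hS : HasSum g S) (h0 : g 0 = 1)
    (hr0 : 0 ≤ r) (hr : r < 1 / 3) (hg : ∀ n, ‖g (n + 1)‖ ≤ r ^ (n + 1)) : ‖S - 1‖ < 1 / 2 := by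
  have h1 : HasSum (fun n ↦ g (n + 1)) (S - 1) := by
    rw [hasSum_nat_add_iff 1]
    simpa [h0] using hS
  have h2 : HasSum (fun n ↦ r ^ (n + 1)) (r * (1 - r)⁻¹) := by
    simp_rw [pow_succ']
    exact (hasSum_geometric_of_lt_one hr0 (by linarith)).mul_left r
  rw [← h1.tsum_eq]
  refine (tsum_of_norm_bounded h2 hg).trans_lt ?_
  rw [← div_eq_mul_inv, div_lt_iff₀ (by linarith)]
  linarith

/-- The zero set is invariant under `SL₂(ℤ)`, so it suffices to treat the fundamental domain, where
`Im τ ≥ √3/2`. There `e^{-π Im τ} < 1/3`, and each theta constant is dominated by its leading terms.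
-/
theorem thetaProduct_ne_zero_of_fd {τ : ℍ} (h : 3 ≤ 4 * τ.im ^ 2) : thetaProduct τ ≠ 0 := by
  have hy : (4 : ℝ) / 5 ≤ τ.im := by nlinarith [τ.im_pos]
  have him : (τ : ℂ).im = τ.im := rfl
  set r := Real.exp (-Real.pi * τ.im) with hr
  have hr3 : r < 1 / 3 := by
    have h1 : (12 : ℝ) / 5 ≤ Real.pi * τ.im := by
      nlinarith [Real.pi_gt_three]
    have h2 := Real.add_one_le_exp (Real.pi * τ.im)
    rw [hr, neg_mul, Real.exp_neg, inv_eq_one_div]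
    exact one_div_lt_one_div_of_lt (by norm_num) (by linarith)
  have hr0 : 0 ≤ r := (Real.exp_pos _).le
  have hr1 : r ≤ 1 := by linarith
  have hreal : ∀ x : ℝ, jacobiTheta₂ x τ ≠ 0 := fun x ↦ by
    -- Pairing `n` with `-n` counts the term at `0` twice, so the sum after halving is `(θ + 1)/2`.
    -- If `θ` vanished, its distance from `1` would be exactly `1/2`.
    have hs := ((hasSum_jacobiTheta₂_term (x : ℂ) τ.im_pos).nat_add_neg).div_const 2
    have hn : ∀ n : ℤ, ‖jacobiTheta₂_term n x τ‖ = r ^ (n.natAbs ^ 2) := fun n ↦ by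
      rw [norm_jacobiTheta₂_term, hr, ← Real.exp_nat_mul]
      congr 1
      have : ((n.natAbs ^ 2 : ℕ) : ℝ) = (n : ℝ) ^ 2 := by
        rw [Nat.cast_pow, Nat.cast_natAbs, Int.cast_abs, sq_abs]
      rw [this, him, Complex.ofReal_im]
      ring
    have h0 : jacobiTheta₂_term 0 x τ = 1 := by simp [jacobiTheta₂_term]
    have := norm_sub_one_lt (r := r) hs (by simp [h0]) hr0 hr3 fun n ↦ by
      rw [norm_div, Complex.norm_two, div_le_iff₀ two_pos]
      refine (norm_add_le _ _).trans ?_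
      rw [hn, hn]
      have h1 : r ^ ((((n + 1 : ℕ) : ℤ)).natAbs ^ 2) ≤ r ^ (n + 1) :=
        pow_le_pow_of_le_one hr0 hr1 (by rw [Int.natAbs_natCast]; nlinarith)
      rw [Int.natAbs_neg]
      linarith
    rw [h0] at this
    intro hz
    rw [hz] at this
    norm_num at this
  have hhalf : jacobiTheta₂ (τ / 2) τ ≠ 0 := by
    -- At `z = τ/2` the terms for `n` and `-n-1` coincide, so half of the theta value is a series
    -- starting with `1`.
    have hs := ((hasSum_jacobiTheta₂_term ((τ : ℂ) / 2) τ.im_pos).nat_add_neg_add_one).div_const 2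
    have hsymm : ∀ n : ℕ, jacobiTheta₂_term (-(n + 1 : ℤ)) ((τ : ℂ) / 2) τ =
        jacobiTheta₂_term n ((τ : ℂ) / 2) τ := fun n ↦ by
      rw [jacobiTheta₂_term, jacobiTheta₂_term]
      congr 1
      push_cast
      ring
    have := norm_sub_one_lt (r := r) hs (by
        have := hsymm 0
        simp only [Nat.cast_zero] at this ⊢
        rw [this]
        simp [jacobiTheta₂_term]) hr0 hr3 fun n ↦ by
      rw [hsymm, ← two_mul, mul_div_cancel_left₀ _ two_ne_zero, norm_jacobiTheta₂_term, hr,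
        ← Real.exp_nat_mul, Real.exp_le_exp]
      have h2 : ((τ : ℂ) / 2).im = τ.im / 2 := by simp
      rw [him, h2]
      push_cast
      have := Real.pi_pos
      have h3 : 0 ≤ Real.pi * τ.im := by have := τ.im_pos; positivity
      have h4 : (0 : ℝ) ≤ n := n.cast_nonneg
      nlinarith [mul_nonneg h3 h4, mul_nonneg (mul_nonneg h3 h4) h4]
    intro hz
    rw [hz] at this
    norm_num at this
  have h0 := hreal 0
  have h1 := hreal (1 / 2)
  push_cast at h0 h1
  exact mul_ne_zero (mul_ne_zero h0 h1) hhalf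

theorem jacobiTheta₂_zero_ne_zero (τ : ℍ) : jacobiTheta₂ 0 τ ≠ 0 := by
  obtain ⟨A, hA⟩ := ModularGroup.exists_smul_mem_fd τ
  have h := thetaProduct_ne_zero_of_fd (ModularGroup.three_le_four_mul_im_sq_of_mem_fd hA)
  rw [Ne, ← thetaProduct_smul] at h
  exact fun h0 ↦ h (by rw [thetaProduct, h0, zero_mul, zero_mul])

theorem theta_ne_zero (τ : ℍ) : theta τ ≠ 0 := by
  rw [theta_eq_th, th_zero_apply_zero one_pos]
  have him : 0 < (2 * ((1 : ℕ) : ℂ) * (τ : ℂ)).im := by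
    simpa using τ.im_pos
  exact jacobiTheta₂_zero_ne_zero ⟨_, him⟩

/-! ### The Dedekind eta function as a theta function -/

/-- The integers `6m - 1` form the class `-1 mod 6`, and the parity of `m` separates the classes
`-1` and `5` modulo `12`. -/
theorem hasSum_pentagonal (τ : ℍ) :
    HasSum (fun m : ℤ ↦ ((Int.negOnePow m : ℤ) : ℂ) * e ((6 * m - 1) ^ 2 / 24 * τ))
      (th 6 (-1) τ 0 - th 6 5 τ 0) := by
  have h := (hasSum_th (a := 6) (by norm_num) (-1) τ 0).sub
    (hasSum_th (a := 6) (by norm_num) 5 τ 0)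
  have hinj : Function.Injective fun m : ℤ ↦ 6 * m - 1 := fun m m' h ↦ by
    simp only at h; omega
  rw [← hinj.hasSum_iff] at h
  · refine h.congr_fun fun m ↦ ?_
    simp only [Function.comp_apply]
    have hterm : thTerm 6 τ 0 (6 * m - 1) = e ((6 * m - 1) ^ 2 / 24 * τ) := by
      rw [thTerm]
      congr 1
      push_cast
      ring
    rw [hterm]
    rcases Int.even_or_odd m with hm | hm
    · rw [Int.negOnePow_even m hm]
      obtain ⟨t, rfl⟩ := hm
      rw [if_pos (by push_cast; omega), if_neg (by push_cast; omega)]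
      simp
    · rw [Int.negOnePow_odd m hm]
      obtain ⟨t, rfl⟩ := hm
      rw [if_neg (by push_cast; omega), if_pos (by push_cast; omega)]
      simp
  · intro k hk
    rw [if_neg, if_neg, sub_zero]
    · rintro ⟨t, ht⟩
      exact hk ⟨2 * t + 1, by push_cast at ht; simp only; omega⟩
    · rintro ⟨t, ht⟩
      exact hk ⟨2 * t, by push_cast at ht; simp only; omega⟩

/-- Euler's pentagonal number theorem. The work lies in the convergence hypotheses of
`Pentagonal.tprod_one_sub_pow`, all met by comparison with the geometric series in `‖q‖`. -/
theorem tprod_one_sub_pow_eq {q : ℂ} (hq : ‖q‖ < 1) :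
    ∏' n : ℕ, (1 - q ^ (n + 1)) =
      ∑' k : ℕ, (-1) ^ k * (q ^ pentagonal (-k) - q ^ pentagonal (k + 1)) := by
  have hq0 := norm_nonneg q
  have hgeom := summable_geometric_of_lt_one hq0 hq
  set C := Real.exp (∑' i : ℕ, ‖q‖ ^ i) with hC
  have hprod : ∀ k n : ℕ, ‖∏ i ∈ Finset.range (n + 1), (1 - q ^ (k + i + 1))‖ ≤ C := fun k n ↦ by
    rw [norm_prod]
    calc ∏ i ∈ Finset.range (n + 1), ‖1 - q ^ (k + i + 1)‖
        ≤ ∏ i ∈ Finset.range (n + 1), Real.exp (‖q‖ ^ i) := by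
          refine Finset.prod_le_prod (fun _ _ ↦ norm_nonneg _) fun i _ ↦ ?_
          refine (norm_sub_le _ _).trans ?_
          rw [norm_one, norm_pow, add_comm]
          refine le_trans ?_ (Real.add_one_le_exp _)
          have : ‖q‖ ^ (k + i + 1) ≤ ‖q‖ ^ i := pow_le_pow_of_le_one hq0 hq.le (by omega)
          linarith
      _ = Real.exp (∑ i ∈ Finset.range (n + 1), ‖q‖ ^ i) := (Real.exp_sum _ _).symm
      _ ≤ C := Real.exp_le_exp.2 (hgeom.sum_le_tsum _ fun i _ ↦ by positivity)
  have hbound : ∀ k n : ℕ, ‖q ^ ((k + 1) * n) *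
      ∏ i ∈ Finset.range (n + 1), (1 - q ^ (k + i + 1))‖ ≤ ‖q‖ ^ n * C := fun k n ↦ by
    rw [norm_mul, norm_pow]
    exact mul_le_mul (pow_le_pow_of_le_one hq0 hq.le (by nlinarith)) (hprod k n)
      (norm_nonneg _) (by positivity)
  have hpow : ∀ {f : ℕ → ℕ}, (∀ k, k ≤ f k) → ∀ k, ‖q ^ f k‖ ≤ ‖q‖ ^ k := fun hf k ↦ by
    rw [norm_pow]
    exact pow_le_pow_of_le_one hq0 hq.le (hf k)
  have hp1 : ∀ k : ℕ, k ≤ pentagonal (-k) := fun k ↦ by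
    have := two_mul_natCast_pentagonal_neg k
    have h : (2 * k : ℤ) ≤ 2 * pentagonal (-k) := by
      rw [this]
      rcases Nat.eq_zero_or_pos k with rfl | hk
      · simp
      · have : (1 : ℤ) ≤ k := by exact_mod_cast hk
        nlinarith
    omega
  have hp2 : ∀ k : ℕ, k ≤ pentagonal (k + 1) := fun k ↦ by
    have := two_mul_natCast_pentagonal (k + 1)
    have h : (2 * k : ℤ) ≤ 2 * pentagonal (k + 1) := by
      rw [this]
      have : (0 : ℤ) ≤ k := by positivity
      nlinarith
    omega
  refine Pentagonal.tprod_one_sub_pow ?_ (fun k ↦ ?_) (fun k ↦ ?_) ?_ ?_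
  · exact tendsto_pow_atTop_nhds_zero_of_norm_lt_one hq
  · exact Summable.of_norm_bounded (hgeom.mul_right C) (hbound k)
  · have : Summable fun n : ℕ ↦ ‖-q ^ (n + k + 1)‖ := by
      refine Summable.of_nonneg_of_le (fun _ ↦ norm_nonneg _) (fun n ↦ ?_) hgeom
      rw [norm_neg, norm_pow]
      exact pow_le_pow_of_le_one hq0 hq.le (by omega)
    simpa [sub_eq_add_neg] using multipliable_one_add_of_summable this
  · refine Summable.of_norm_bounded (hgeom.mul_left 2) fun k ↦ ?_
    rw [norm_mul, norm_pow, norm_neg, norm_one, one_pow, one_mul]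
    refine (norm_sub_le _ _).trans ?_
    have h1 := hpow hp1 k
    have h2 := hpow hp2 k
    linarith
  · refine squeeze_zero_norm (a := fun k ↦ ‖q‖ ^ k * ∑' n : ℕ, ‖q‖ ^ n * C) (fun k ↦ ?_) ?_
    · rw [norm_mul, norm_mul, norm_pow, norm_neg, norm_one, one_pow, one_mul]
      refine mul_le_mul (hpow (f := fun k ↦ (k + 1) * (3 * k + 4) / 2) (fun k ↦ ?_) k)
        (tsum_of_norm_bounded (hgeom.mul_right C).hasSum (hbound k)) (norm_nonneg _)
        (by positivity)
      rw [Nat.le_div_iff_mul_le two_pos]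
      nlinarith
    · simpa using (tendsto_pow_atTop_nhds_zero_of_lt_one hq0 hq).mul_const
        (∑' n : ℕ, ‖q‖ ^ n * C)

/-- Completing the square: `m(3m-1)/2 + 1/24 = (6m-1)²/24`. -/
theorem eta_eq_th (τ : ℍ) : ModularForm.eta τ = th 6 (-1) τ 0 - th 6 5 τ 0 := by
  have hq : ‖e τ‖ < 1 := by
    rw [norm_e, Real.exp_lt_one_iff]
    have := τ.im_pos
    have h : 0 < (τ : ℂ).im := this
    have := Real.pi_pos
    simpa using by positivity
  have h1 : ModularForm.eta τ = e (τ / 24) * ∏' n : ℕ, (1 - e τ ^ (n + 1)) := by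
    rw [ModularForm.eta]
    congr 1
    · rw [Function.Periodic.qParam, e]
      congr 1
      push_cast
      ring
    · simp only [ModularForm.eta_q, Function.Periodic.qParam, e]
      simp
  have h2 := (hasSum_pentagonal τ)
  -- The pentagonal series groups the indices `-k` and `k + 1`; after the sign change these are the
  -- indices paired by `nat_add_neg_add_one`.
  rw [← (Equiv.neg ℤ).hasSum_iff] at h2
  have h3 := h2.nat_add_neg_add_one
  rw [h1, tprod_one_sub_pow_eq hq, ← tsum_mul_left, ← h3.tsum_eq]
  refine tsum_congr fun k ↦ ?_
  have hp : ∀ m : ℤ, e (τ / 24) * e τ ^ pentagonal m = e ((6 * m - 1) ^ 2 / 24 * τ) := fun m ↦ by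
    rw [← e_nat_mul, ← e_add]
    congr 1
    have := congrArg (Int.cast : ℤ → ℂ) (two_mul_natCast_pentagonal m)
    push_cast at this
    linear_combination (τ / 2 : ℂ) * this
  have h4 := hp (-k)
  have h5 := hp (k + 1)
  simp only [Function.comp_apply, Equiv.neg_apply, neg_neg]
  push_cast at h4 h5 ⊢
  rw [← h4, ← h5, Int.negOnePow_neg, Int.negOnePow_succ]
  have h6 : ((Int.negOnePow (k : ℤ) : ℤ) : ℂ) = (-1) ^ k := by
    rw [Int.negOnePow_def]
    simp
  push_cast
  rw [h6]
  ring

/-- `η` is a fixed combination of theta functions of index `6` at `z = 0`, so a scalar common to all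
of them is the value of `ε`. -/
theorem eps_eq_scalar {γ : Mp2Z} {c : ℂ}
    (hc : ∀ s, halfSlash 6 γ (th 6 s) = c • th 6 s) : (eps γ : ℂ) = c := by
  set τ := UpperHalfPlane.I
  have key : ∀ s, th 6 s (γ.mat • τ) 0 = c * γ.root τ * th 6 s τ 0 := fun s ↦ by
    have h := congrFun (congrFun (hc s) τ) 0
    simp only [halfSlash_apply, Pi.smul_apply, smul_eq_mul, mul_zero, ne_eq, OfNat.ofNat_ne_zero,
      not_false_eq_true, zero_pow, zero_div, e_zero, mul_one] at h
    have := γ.root_ne_zero τ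
    field_simp at h
    linear_combination h
  change etaQuotient γ τ = c
  rw [etaQuotient, div_eq_iff (mul_ne_zero (eta_ne_zero _) (γ.root_ne_zero _)), eta_eq_th,
    eta_eq_th, key, key]
  ring

/-! ### The theta multiplier -/

theorem kappa_eq_scalar {γ : Mp2Z} {c : ℂ} (hc : halfSlash 1 γ (th 1 0) = c • th 1 0) (τ : ℍ) :
    kappa γ τ = c := by
  have h := congrFun (congrFun hc τ) 0
  simp only [halfSlash_apply, Pi.smul_apply, smul_eq_mul, mul_zero, ne_eq, OfNat.ofNat_ne_zero,
    not_false_eq_true, zero_pow, zero_div, e_zero, mul_one] at h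
  have h1 := γ.root_ne_zero τ
  rw [kappa, div_eq_iff (mul_ne_zero (theta_ne_zero _) h1), theta_eq_th, theta_eq_th]
  field_simp at h
  linear_combination h

/-- On `Γ(24)` the eta character agrees with the theta multiplier, and both have order two. -/
theorem eps_sq_eq_one {γ : Mp2Z} (hγ : γ.mat ∈ CongruenceSubgroup.Gamma 24) :
    (eps γ : ℂ) ^ 2 = 1 := by
  obtain ⟨c, h6, -, x, hx, hcx⟩ := exists_scalar (a := 6) (by norm_num) hγ
  have hc : (eps γ : ℂ) = c := eps_eq_scalar h6
  -- `c` is a 24th root of unity whose square is a non-negative real number, so that square is `1`.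
  have h24 : c ^ 24 = 1 := hc ▸ etaQuotient_pow γ _
  have hx12 : x ^ 12 = 1 := by
    have : ((x ^ 12 : ℝ) : ℂ) = 1 := by
      rw [Complex.ofReal_pow, ← hcx, ← pow_mul, h24]
    exact_mod_cast this
  rw [hc, hcx, (pow_eq_one_iff_of_nonneg hx (by norm_num)).1 hx12, Complex.ofReal_one]

theorem th_one_zero_ne_zero (τ : ℍ) : th 1 0 τ 0 ≠ 0 := theta_eq_th τ ▸ theta_ne_zero τ

/-- For `a = 6` the group `Γ(4a)` is `Γ(24)`, and index `6` shares its scalar with index `1`. This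
is the bridge from the eta character to the theta multiplier. -/
theorem halfSlash_one_th_zero {γ : Mp2Z} (hγ : γ.mat ∈ CongruenceSubgroup.Gamma 24) :
    halfSlash 1 γ (th 1 0) = (eps γ : ℂ) • th 1 0 := by
  obtain ⟨c, h6, h1, -⟩ := exists_scalar (a := 6) (by norm_num) hγ
  rw [eps_eq_scalar h6]
  exact h1 0

/-- An element over `Γ(N)`, where `24` and `4a` divide `N`, acts on all theta functions of index
`a` by the eta character. -/
theorem halfSlash_th_eq_eps {N a : ℕ} (ha : 0 < a) (hN : 24 ∣ N) (haN : 4 * a ∣ N) {γ : Mp2Z}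
    (hγ : γ.mat ∈ CongruenceSubgroup.Gamma N) (s : ℤ) :
    halfSlash a γ (th a s) = (eps γ : ℂ) • th a s := by
  obtain ⟨c, h, h1, -⟩ := exists_scalar ha (Gamma_le_of_dvd haN hγ)
  have h2 := halfSlash_one_th_zero (Gamma_le_of_dvd hN hγ)
  rw [h1 0] at h2
  have h3 := congrFun (congrFun h2 UpperHalfPlane.I) 0
  simp only [Pi.smul_apply, smul_eq_mul] at h3
  rw [h s, mul_right_cancel₀ (th_one_zero_ne_zero _) h3]

/-- The elements acting trivially on a stable set form a normal subgroup. -/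
theorem eq_self_of_mem_normalClosure {X : Type*} (act : Mp2Z → X → X) (hone : ∀ x, act 1 x = x)
    (hmul : ∀ α γ x, act (α * γ) x = act γ (act α x)) (V : Set X)
    (hV : ∀ α, ∀ x ∈ V, act α x ∈ V) {g : Mp2Z} (hg : ∀ x ∈ V, act g x = x) {δ : Mp2Z}
    (hδ : δ ∈ Subgroup.normalClosure {g}) : ∀ x ∈ V, act δ x = x := by
  let K : Subgroup Mp2Z :=
    { carrier := {δ | ∀ x ∈ V, act δ x = x}
      one_mem' := fun x _ ↦ hone x
      mul_mem' := fun {α γ} hα hγ x hx ↦ by rw [hmul, hα x hx, hγ x hx]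
      inv_mem' := fun {α} hα x hx ↦ by
        conv_lhs => rw [← hα x hx]
        rw [← hmul, mul_inv_cancel, hone] }
  have hK : K.Normal := ⟨fun δ hδ α x hx ↦ by
    rw [hmul, hmul, hδ _ (hV α x hx), ← hmul, mul_inv_cancel, hone]⟩
  exact Subgroup.normalClosure_le_normal (N := K) (Set.singleton_subset_iff.2 hg) hδ

/-- `T^N` multiplies `th 1 s` by `e(Ns²/4) = 1`, so it fixes the whole stable space `thSpace 1`. -/
theorem halfSlash_normalClosure {N : ℕ} (hN : 4 ∣ N) {δ : Mp2Z}
    (hδ : δ ∈ Subgroup.normalClosure {Mp2Z.T ^ N}) : halfSlash 1 δ (th 1 0) = th 1 0 := by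
  refine eq_self_of_mem_normalClosure (fun α F ↦ halfSlash 1 α F)
    (fun F ↦ by rw [halfSlash_one]) (fun α γ F ↦ by rw [halfSlash_mul])
    (thSpace 1) (fun α F hF ↦ halfSlash_mem_thSpace one_pos α hF) (fun F hF ↦ ?_) hδ _
    (th_mem_thSpace 1 0)
  induction hF using Submodule.span_induction with
  | mem x hx =>
    obtain ⟨s, rfl⟩ := hx
    obtain ⟨t, rfl⟩ := hN
    rw [halfSlash_T_pow_th one_pos]
    have : e (((4 * t : ℕ) : ℂ) * ((s : ℂ) ^ 2 / (4 * (1 : ℕ)))) = 1 := by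
      rw [← e_int (t * s ^ 2)]
      congr 1
      push_cast
      ring
    rw [this, one_smul]
  | zero => simp
  | add x y _ _ hx hy => rw [map_add, hx, hy]
  | smul c x _ hx => rw [map_smul, hx]

/-- With the decomposition of `Γ(N)` this computes the theta multiplier on every `Γ(N)` with `4 ∣
N`; as `ε` is a character, invariance under conjugation follows. -/
theorem kappa_mul_eq_eps {N : ℕ} (hN : 4 ∣ N) {δ γ : Mp2Z}
    (hδ : δ ∈ Subgroup.normalClosure {Mp2Z.T ^ N}) (hγ : γ.mat ∈ CongruenceSubgroup.Gamma 24)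
    (τ : ℍ) : kappa (δ * γ) τ = eps γ := by
  refine kappa_eq_scalar ?_ τ
  rw [halfSlash_mul, halfSlash_normalClosure hN hδ, halfSlash_one_th_zero hγ]

theorem Gamma_conj_mem {N : ℕ} {γ : Mp2Z} (hγ : γ.mat ∈ CongruenceSubgroup.Gamma N) (α : Mp2Z) :
    (α * γ * α⁻¹).mat ∈ CongruenceSubgroup.Gamma N :=
  (CongruenceSubgroup.Gamma_normal N).conj_mem _ hγ _

/-- The theta multiplier on `Γ(N)`, where `4 ∣ N`, is constant and invariant under conjugation. -/
theorem exists_kappa_eq {N : ℕ} (hN : 4 ∣ N) {γ : Mp2Z}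
    (hγ : γ.mat ∈ CongruenceSubgroup.Gamma N) :
    ∃ c : ℂ, c ^ 2 = 1 ∧ ∀ α τ, kappa (α * γ * α⁻¹) τ = c := by
  obtain ⟨δ, hδ, γ', hγ', rfl⟩ := Mp2Z.exists_normalClosure_mul_Gamma hγ (N' := 24) (by norm_num)
  refine ⟨eps γ', eps_sq_eq_one hγ', fun α τ ↦ ?_⟩
  rw [show α * (δ * γ') * α⁻¹ = (α * δ * α⁻¹) * (α * γ' * α⁻¹) by group,
    kappa_mul_eq_eps hN (Subgroup.normalClosure_normal.conj_mem _ hδ _) (Gamma_conj_mem hγ' α)]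
  simp [mul_comm]

/-! ### Absolutely convergent Fourier series in several variables -/

theorem hasSum_mul_prod {X Y : Type*} {f : X → ℂ} {g : Y → ℂ} {s t : ℂ} (hf : HasSum f s)
    (hg : HasSum g t) : HasSum (fun p : X × Y ↦ f p.1 * g p.2) (s * t) :=
  hf.mul hg (summable_mul_of_summable_norm hf.summable.norm hg.summable.norm)

theorem hasSum_prod_pi {n : ℕ} (f : Fin n → ℤ → ℂ) (s : Fin n → ℂ)
    (hf : ∀ i, HasSum (f i) (s i)) :
    HasSum (fun κ : Fin n → ℤ ↦ ∏ i, f i (κ i)) (∏ i, s i) := by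
  induction n with
  | zero =>
    simp only [Finset.univ_eq_empty, Finset.prod_empty]
    exact hasSum_unique (fun _ : Fin 0 → ℤ ↦ (1 : ℂ))
  | succ n ih =>
    have h1 := ih (fun i ↦ f i.succ) (fun i ↦ s i.succ) fun i ↦ hf i.succ
    have h2 := hasSum_mul_prod (hf 0) h1
    rw [← (Fin.consEquiv fun _ ↦ ℤ).hasSum_iff, Fin.prod_univ_succ]
    refine h2.congr_fun fun p ↦ ?_
    simp [Fin.consEquiv, Fin.prod_univ_succ]

/-- An absolutely convergent Fourier series converges uniformly on the torus, so its coefficients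
are recovered by pairing with the characters. -/
theorem eq_zero_of_hasSum_fourier {ι : Type*} [Fintype ι] {d : (ι → ℤ) → ℂ}
    (h : ∀ u : ι → ℝ, HasSum (fun κ : ι → ℤ ↦ d κ * e (∑ i, κ i * u i)) 0) : d = 0 := by
  classical
  have hs : Summable d := by simpa [e_zero] using (h 0).summable
  have h1 : Summable fun κ ↦ d κ • (UnitAddTorus.mFourier κ : C(UnitAddTorus ι, ℂ)) := by
    refine Summable.of_norm ?_
    simpa only [norm_smul, UnitAddTorus.mFourier_norm, mul_one] using hs.norm
  have h2 : ∑' κ, d κ • (UnitAddTorus.mFourier κ : C(UnitAddTorus ι, ℂ)) = 0 := by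
    ext x
    have h3 := h1.hasSum.map (ContinuousMap.evalCLM ℂ x) (ContinuousMap.evalCLM ℂ x).continuous
    obtain ⟨u, rfl⟩ : ∃ u : ι → ℝ, (fun i ↦ (u i : UnitAddCircle)) = x := by
      choose u hu using fun i ↦ QuotientAddGroup.mk_surjective (x i)
      exact ⟨u, funext hu⟩
    refine h3.unique ((h u).congr_fun fun κ ↦ ?_)
    simp [UnitAddTorus.mFourier, e, ← Complex.exp_sum, Finset.mul_sum,
      mul_assoc]
  have h4 := h1.hasSum
  rw [h2] at h4
  funext κ
  let _ : MeasureTheory.MeasureSpace UnitAddCircle := ⟨AddCircle.haarAddCircle⟩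
  have : MeasureTheory.IsProbabilityMeasure
      (MeasureTheory.volume : MeasureTheory.Measure UnitAddCircle) :=
    inferInstanceAs (MeasureTheory.IsProbabilityMeasure AddCircle.haarAddCircle)
  -- The continuous functional taking the `κ`-th Fourier coefficient, as an inner product in `L²`.
  let ℓ : C(UnitAddTorus ι, ℂ) →L[ℂ] ℂ :=
    (innerSL ℂ (UnitAddTorus.mFourierLp (d := ι) 2 κ)).comp
      (ContinuousMap.toLp (E := ℂ) 2 MeasureTheory.volume ℂ)
  have hℓ : ∀ κ', ℓ (UnitAddTorus.mFourier κ') = if κ = κ' then 1 else 0 := fun κ' ↦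
    (orthonormal_iff_ite.1 (UnitAddTorus.orthonormal_mFourier (d := ι))) κ κ'
  have h5 := ℓ.hasSum h4
  simp only [map_smul, hℓ, map_zero, smul_eq_mul, mul_ite, mul_one, mul_zero] at h5
  exact ((hasSum_ite_eq κ (d κ)).congr_fun fun κ' ↦ by
    by_cases h : κ = κ' <;> simp [h, eq_comm]).unique h5

/-! ### Orthogonal frames of a lattice -/

section Lattice

variable {L : Type*} [AddCommGroup L]

/-- Orthogonal vectors of even norm `2aᵢ` in a lattice which span it over `ℚ`. -/
structure OrthFrame (β : LinearMap.BilinForm ℤ L) where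
  v : Fin (Module.finrank ℤ L) → L
  a : Fin (Module.finrank ℤ L) → ℕ
  a_pos : ∀ i, 0 < a i
  orth : ∀ i j, i ≠ j → β (v i) (v j) = 0
  self : ∀ i, β (v i) (v i) = 2 * a i

theorem exists_smul_eq_tmul (w : ℚ ⊗[ℤ] L) : ∃ d : ℕ, 0 < d ∧ ∃ x : L, (d : ℚ) • w = 1 ⊗ₜ x := by
  induction w using TensorProduct.induction_on with
  | zero => exact ⟨1, one_pos, 0, by simp⟩
  | tmul q x =>
    refine ⟨q.den, q.pos, q.num • x, ?_⟩
    rw [TensorProduct.smul_tmul', TensorProduct.tmul_smul, TensorProduct.smul_tmul',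
      smul_eq_mul, Rat.den_mul_eq_num, zsmul_one]
  | add y z hy hz =>
    obtain ⟨d, hd, x, hx⟩ := hy
    obtain ⟨d', hd', x', hx'⟩ := hz
    refine ⟨d * d', Nat.mul_pos hd hd', d' • x + d • x', ?_⟩
    have h1 : ((d * d' : ℕ) : ℚ) • (y + z) = (d' : ℚ) • ((d : ℚ) • y) + (d : ℚ) • ((d' : ℚ) • z) := by
      push_cast
      module
    rw [h1, hx, hx', TensorProduct.tmul_add, Nat.cast_smul_eq_nsmul, Nat.cast_smul_eq_nsmul,
      TensorProduct.tmul_smul, TensorProduct.tmul_smul]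

theorem baseChange_one_tmul (K : Type*) [CommRing K] (β : LinearMap.BilinForm ℤ L) (x y : L) :
    β.baseChange K (1 ⊗ₜ x) (1 ⊗ₜ y) = (β x y : K) := by
  rw [LinearMap.BilinForm.baseChange_tmul]
  simp

theorem baseChange_isSymm (K : Type*) [CommRing K] {β : LinearMap.BilinForm ℤ L}
    (hsymm : β.IsSymm) : (β.baseChange K).IsSymm :=
  LinearMap.BilinForm.isSymm_iff.2
    (LinearMap.BilinForm.IsSymm.baseChange K (LinearMap.BilinForm.isSymm_iff.1 hsymm))

theorem nonempty_orthFrame [Module.Free ℤ L] [Module.Finite ℤ L] {β : LinearMap.BilinForm ℤ L}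
    (hsymm : β.IsSymm) (hpos : ∀ x : L, x ≠ 0 → 0 < β x x) : Nonempty (OrthFrame β) := by
  have hfin : Module.finrank ℚ (ℚ ⊗[ℤ] L) = Module.finrank ℤ L := Module.finrank_baseChange
  have : Invertible (2 : ℚ) := invertibleOfNonzero two_ne_zero
  have hs : (β.baseChange ℚ).IsSymm := baseChange_isSymm ℚ hsymm
  -- Orthogonalise over `ℚ`, clear denominators, and double each vector so that its norm `4β(x, x)`
  -- is twice a positive integer.
  obtain ⟨w, hw⟩ := LinearMap.BilinForm.exists_orthogonal_basis (LinearMap.BilinForm.isSymm_iff.1 hs)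
  choose d hd x hx using fun i ↦ exists_smul_eq_tmul (w i)
  have hx0 : ∀ i, x i ≠ 0 := fun i h ↦ by
    have := hx i
    rw [h, TensorProduct.tmul_zero, smul_eq_zero] at this
    rcases this with h | h
    · exact (hd i).ne' (by exact_mod_cast h)
    · exact w.ne_zero i h
  have horth : ∀ i j, i ≠ j → β (x i) (x j) = 0 := fun i j hij ↦ by
    have h : ((β (x i) (x j) : ℤ) : ℚ) = 0 := by
      rw [← baseChange_one_tmul, ← hx, ← hx]
      simp only [map_smul, LinearMap.smul_apply, smul_eq_mul]
      rw [hw hij]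
      simp
    exact_mod_cast h
  let σ : Fin (Module.finrank ℤ L) ≃ Fin (Module.finrank ℚ (ℚ ⊗[ℤ] L)) := finCongr hfin.symm
  refine ⟨⟨fun i ↦ 2 • x (σ i), fun i ↦ 2 * (β (x (σ i)) (x (σ i))).toNat, fun i ↦ ?_,
    fun i j hij ↦ ?_, fun i ↦ ?_⟩⟩
  · have := hpos _ (hx0 (σ i))
    omega
  · simp [horth _ _ (σ.injective.ne hij)]
  · have := hpos _ (hx0 (σ i))
    simp only [map_nsmul, LinearMap.smul_apply, nsmul_eq_mul]
    push_cast
    rw [Int.toNat_of_nonneg this.le]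

namespace OrthFrame

variable {β : LinearMap.BilinForm ℤ L} (F : OrthFrame β)

theorem baseChange_v {K : Type*} [Field K] (i j) :
    β.baseChange K (1 ⊗ₜ F.v i) (1 ⊗ₜ F.v j) = if i = j then 2 * (F.a i : K) else 0 := by
  rw [baseChange_one_tmul]
  split_ifs with h
  · subst h
    rw [F.self]
    push_cast
    rfl
  · rw [F.orth i j h, Int.cast_zero]

theorem a_ne_zero (K : Type*) [Field K] [CharZero K] (i) : (F.a i : K) ≠ 0 :=
  Nat.cast_ne_zero.2 (F.a_pos i).ne'

/-- The coordinates `β(z, vᵢ) / (2aᵢ)`. -/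
def coord {K : Type*} [Field K] [CharZero K] (z : K ⊗[ℤ] L) (i : Fin (Module.finrank ℤ L)) : K :=
  β.baseChange K z (1 ⊗ₜ F.v i) / (2 * F.a i)

variable {K : Type*} [Field K] [CharZero K]

theorem coord_sum (c : Fin (Module.finrank ℤ L) → K) :
    F.coord (∑ i, c i • (1 : K) ⊗ₜ[ℤ] F.v i) = c := by
  funext j
  have h := F.a_ne_zero K j
  simp only [coord, map_sum, map_smul, LinearMap.sum_apply, LinearMap.smul_apply, baseChange_v,
    smul_eq_mul, mul_ite, mul_zero, Finset.sum_ite_eq', Finset.mem_univ, if_true]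
  field_simp

/-- Orthogonal vectors of nonzero norm are independent, and there are as many of them as the rank.
-/
theorem sum_coord_smul [Module.Free ℤ L] [Module.Finite ℤ L] (z : K ⊗[ℤ] L) :
    ∑ i, F.coord z i • (1 : K) ⊗ₜ[ℤ] F.v i = z := by
  have hli : LinearIndependent K fun i ↦ (1 : K) ⊗ₜ[ℤ] F.v i := by
    refine LinearMap.linearIndependent_of_isOrthoᵢ (B := β.baseChange K) (fun i j hij ↦ ?_)
      fun i h ↦ ?_
    · change β.baseChange K (1 ⊗ₜ F.v i) (1 ⊗ₜ F.v j) = 0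
      rw [baseChange_v, if_neg hij]
    · have h' : β.baseChange K (1 ⊗ₜ F.v i) (1 ⊗ₜ F.v i) = 0 := h
      rw [baseChange_v, if_pos rfl] at h'
      exact mul_ne_zero two_ne_zero (F.a_ne_zero K i) h'
  have hcard : Fintype.card (Fin (Module.finrank ℤ L)) = Module.finrank K (K ⊗[ℤ] L) := by
    rw [Fintype.card_fin, Module.finrank_baseChange]
  have hspan := hli.span_eq_top_of_card_eq_finrank' hcard
  obtain ⟨c, rfl⟩ := (Submodule.mem_span_range_iff_exists_fun K).1
    (hspan ▸ Submodule.mem_top : z ∈ Submodule.span K (Set.range fun i ↦ (1 : K) ⊗ₜ[ℤ] F.v i))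
  rw [coord_sum]

theorem baseChange_eq_sum [Module.Free ℤ L] [Module.Finite ℤ L] (hsymm : β.IsSymm)
    (y z : K ⊗[ℤ] L) :
    β.baseChange K y z = ∑ i, 2 * (F.a i : K) * F.coord y i * F.coord z i := by
  conv_lhs => rw [← F.sum_coord_smul y]
  simp only [map_sum, map_smul, LinearMap.sum_apply, LinearMap.smul_apply, smul_eq_mul]
  refine Finset.sum_congr rfl fun i _ ↦ ?_
  have h := F.a_ne_zero K i
  rw [(baseChange_isSymm K hsymm).eq]
  simp only [coord]
  field_simp

theorem coord_add (y z : K ⊗[ℤ] L) : F.coord (y + z) = F.coord y + F.coord z := by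
  funext i
  simp [coord, add_div]

theorem coord_smul (c : K) (z : K ⊗[ℤ] L) : F.coord (c • z) = c • F.coord z := by
  funext i
  simp [coord, mul_div_assoc]

theorem coord_tmul (c : K) (x : L) (i) :
    F.coord (c ⊗ₜ x : K ⊗[ℤ] L) i = c * (β x (F.v i) / (2 * F.a i)) := by
  simp only [coord, LinearMap.BilinForm.baseChange_tmul, mul_one, zsmul_eq_mul]
  ring

theorem coord_injective [Module.Free ℤ L] [Module.Finite ℤ L] :
    Function.Injective (F.coord : K ⊗[ℤ] L → _) := fun y z h ↦ by
  rw [← F.sum_coord_smul y, h, F.sum_coord_smul]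

theorem ratToComplex_tmul (q : ℚ) (x : L) : ratToComplex (q ⊗ₜ[ℤ] x) = (q : ℂ) ⊗ₜ[ℤ] x := rfl

theorem baseChange_ratToComplex (β : LinearMap.BilinForm ℤ L) (r s : ℚ ⊗[ℤ] L) :
    β.baseChange ℂ (ratToComplex r) (ratToComplex s) = (β.baseChange ℚ r s : ℂ) := by
  induction r using TensorProduct.induction_on with
  | zero => simp
  | add y z hy hz => simp [hy, hz]
  | tmul q x =>
    induction s using TensorProduct.induction_on with
    | zero => simp
    | add y z hy hz => simp [hy, hz]
    | tmul q' x' => simp [ratToComplex_tmul, LinearMap.BilinForm.baseChange_tmul]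

theorem coord_ratToComplex (r : ℚ ⊗[ℤ] L) (i) :
    F.coord (ratToComplex r) i = ((F.coord r i : ℚ) : ℂ) := by
  have h := baseChange_ratToComplex β r (1 ⊗ₜ F.v i)
  rw [ratToComplex_tmul, Rat.cast_one] at h
  simp [coord, h]

end OrthFrame

end Lattice

/-! ### Integral coordinates on the shadow and theta series as Fourier series. -/

section Lattice

variable {L : Type*} [AddCommGroup L] {β : LinearMap.BilinForm ℤ L}

theorem add_tmul_mem_shadow {r : ℚ ⊗[ℤ] L} (hr : r ∈ shadow β) (x : L) :
    r + 1 ⊗ₜ x ∈ shadow β := fun y ↦ by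
  obtain ⟨m, hm⟩ := hr y
  refine ⟨m + β x y, ?_⟩
  rw [map_add, LinearMap.add_apply, baseChange_one_tmul]
  push_cast
  linear_combination hm

theorem e_half_sq (x : ℤ) : e ((x : ℂ) / 2) * e ((x : ℂ) / 2) = 1 := by
  rw [← e_add, ← e_int x]
  congr 1
  ring

/-- `β(x, y)` is an integer, so `x ↦ e(β(x))` is a character of `L`; by `e_half_sq` its values are
`±1`. -/
theorem e_half_add (hsymm : β.IsSymm) (x y : L) :
    e ((β (x + y) (x + y) : ℂ) / 2) = e ((β x x : ℂ) / 2) * e ((β y y : ℂ) / 2) := by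
  rw [← e_add]
  refine e_eq_of_sub_eq_int (β x y) ?_
  simp only [map_add, LinearMap.add_apply, hsymm.eq y x]
  push_cast
  ring

namespace OrthFrame

variable (F : OrthFrame β)

/-- The integral coordinates `β(r, vᵢ)` of a vector in the shadow. -/
def index (r : ℚ ⊗[ℤ] L) (i : Fin (Module.finrank ℤ L)) : ℤ :=
  ⌊β.baseChange ℚ r (1 ⊗ₜ F.v i)⌋

/-- The vector `r` with `β(r, vᵢ) = κᵢ`. -/
def point (κ : Fin (Module.finrank ℤ L) → ℤ) : ℚ ⊗[ℤ] L :=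
  ∑ i, ((κ i : ℚ) / (2 * F.a i)) • (1 : ℚ) ⊗ₜ[ℤ] F.v i

theorem coord_point (κ : Fin (Module.finrank ℤ L) → ℤ) (i) :
    F.coord (F.point κ) i = κ i / (2 * F.a i) := by
  rw [point, coord_sum]

/-- On the shadow `β(r, vᵢ) ≡ β(vᵢ, vᵢ)/2 = aᵢ mod ℤ`. Because `vᵢ` has even norm this is an
integer, and the floor in `index` changes nothing. -/
theorem index_eq {r : ℚ ⊗[ℤ] L} (hr : r ∈ shadow β) (i) :
    (F.index r i : ℚ) = 2 * F.a i * F.coord r i := by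
  obtain ⟨m, hm⟩ := hr (F.v i)
  have h := F.a_ne_zero ℚ i
  have h1 : β.baseChange ℚ r (1 ⊗ₜ F.v i) = ((m + F.a i : ℤ) : ℚ) := by
    rw [F.self] at hm
    push_cast at hm ⊢
    linear_combination hm
  rw [index, coord, h1, Int.floor_intCast]
  field_simp

theorem index_point (κ : Fin (Module.finrank ℤ L) → ℤ) : F.index (F.point κ) = κ := by
  funext i
  have h := F.a_ne_zero ℚ i
  have h1 : β.baseChange ℚ (F.point κ) (1 ⊗ₜ F.v i) = κ i := by
    have := F.coord_point κ i
    rw [coord] at this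
    field_simp at this
    exact this
  rw [index, h1, Int.floor_intCast]

theorem point_index [Module.Free ℤ L] [Module.Finite ℤ L] {r : ℚ ⊗[ℤ] L} (hr : r ∈ shadow β) :
    F.point (F.index r) = r := by
  refine F.coord_injective (funext fun i ↦ ?_)
  have h := F.a_ne_zero ℚ i
  rw [coord_point, index_eq F hr]
  field_simp

theorem point_add (κ : Fin (Module.finrank ℤ L) → ℤ) [Module.Free ℤ L] [Module.Finite ℤ L]
    (x : L) : F.point (fun i ↦ κ i + β x (F.v i)) = F.point κ + 1 ⊗ₜ x := by
  refine F.coord_injective (funext fun i ↦ ?_)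
  rw [coord_add, Pi.add_apply, coord_point, coord_point, coord_tmul]
  push_cast
  ring

/-- The function `e(β(r)τ + β(r, z))` for `β(r, vᵢ) = κᵢ`. -/
def term (κ : Fin (Module.finrank ℤ L) → ℤ) (τ : ℍ) (z : ℂ ⊗[ℤ] L) : ℂ :=
  e ((∑ i, (κ i : ℂ) ^ 2 / (4 * F.a i)) * τ + ∑ i, κ i * F.coord z i)

theorem term_eq_prod (κ : Fin (Module.finrank ℤ L) → ℤ) (τ : ℍ) (z : ℂ ⊗[ℤ] L) :
    F.term κ τ z = ∏ i, thTerm (F.a i) τ (F.coord z i) (κ i) := by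
  simp only [thTerm, ← e_sum, term, Finset.sum_add_distrib, Finset.sum_mul]

theorem quad_point [Module.Free ℤ L] [Module.Finite ℤ L] (hsymm : β.IsSymm)
    (κ : Fin (Module.finrank ℤ L) → ℤ) :
    β.baseChange ℚ (F.point κ) (F.point κ) / 2 = ∑ i, (κ i : ℚ) ^ 2 / (4 * F.a i) := by
  rw [F.baseChange_eq_sum hsymm, Finset.sum_div]
  refine Finset.sum_congr rfl fun i _ ↦ ?_
  have h := F.a_ne_zero ℚ i
  rw [coord_point]
  field_simp
  ring

theorem term_eq [Module.Free ℤ L] [Module.Finite ℤ L] (hsymm : β.IsSymm)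
    (κ : Fin (Module.finrank ℤ L) → ℤ) (τ : ℍ) (z : ℂ ⊗[ℤ] L) :
    F.term κ τ z = e (((β.baseChange ℚ (F.point κ) (F.point κ) / 2 : ℚ) : ℂ) * τ +
      β.baseChange ℂ (ratToComplex (F.point κ)) z) := by
  rw [F.quad_point hsymm, F.baseChange_eq_sum hsymm, term]
  push_cast
  congr 2
  refine Finset.sum_congr rfl fun i _ ↦ ?_
  have h := F.a_ne_zero ℂ i
  rw [coord_ratToComplex, coord_point]
  push_cast
  field_simp

/-- The extension by zero of a function on the shadow. -/
def extend (lam : shadow β → ℂ) (κ : Fin (Module.finrank ℤ L) → ℤ) : ℂ :=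
  open Classical in if h : F.point κ ∈ shadow β then lam ⟨F.point κ, h⟩ else 0

theorem extend_of_mem (lam : shadow β → ℂ) {κ : Fin (Module.finrank ℤ L) → ℤ}
    (h : F.point κ ∈ shadow β) : F.extend lam κ = lam ⟨F.point κ, h⟩ := dif_pos h

theorem extend_of_notMem (lam : shadow β → ℂ) {κ : Fin (Module.finrank ℤ L) → ℤ}
    (h : F.point κ ∉ shadow β) : F.extend lam κ = 0 := dif_neg h

theorem extend_index [Module.Free ℤ L] [Module.Finite ℤ L] (lam : shadow β → ℂ) (r : shadow β) :
    F.extend lam (F.index (r : ℚ ⊗[ℤ] L)) = lam r := by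
  have h := F.point_index r.2
  rw [extend_of_mem F lam (h.symm ▸ r.2 : F.point (F.index (r : ℚ ⊗[ℤ] L)) ∈ shadow β)]
  congr 1
  exact Subtype.ext h

theorem index_injective [Module.Free ℤ L] [Module.Finite ℤ L] :
    Function.Injective fun r : shadow β ↦ F.index (r : ℚ ⊗[ℤ] L) := fun r s h ↦ by
  have h' : F.index (r : ℚ ⊗[ℤ] L) = F.index (s : ℚ ⊗[ℤ] L) := h
  apply Subtype.ext
  rw [← F.point_index r.2, h', F.point_index s.2]

/-- The coordinates embed the shadow into `ℤⁿ`; extension by zero turns sums over the shadow into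
sums over the full lattice `ℤⁿ`, where series factor into coordinates. -/
theorem hasSum_shadow_iff [Module.Free ℤ L] [Module.Finite ℤ L] (hsymm : β.IsSymm)
    (lam : shadow β → ℂ) (τ : ℍ) (z : ℂ ⊗[ℤ] L) (s : ℂ) :
    HasSum (fun r : shadow β ↦ lam r *
      e (((β.baseChange ℚ (r : ℚ ⊗[ℤ] L) r / 2 : ℚ) : ℂ) * τ +
        β.baseChange ℂ (ratToComplex (r : ℚ ⊗[ℤ] L)) z)) s ↔
    HasSum (fun κ ↦ F.extend lam κ * F.term κ τ z) s := by
  rw [← F.index_injective.hasSum_iff]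
  · refine iff_of_eq (congrArg (HasSum · s _) (funext fun r ↦ ?_))
    simp only [Function.comp_apply]
    rw [F.extend_index, F.term_eq hsymm, F.point_index r.2]
  · intro κ hκ
    rw [extend_of_notMem, zero_mul]
    exact fun h ↦ hκ ⟨⟨_, h⟩, F.index_point κ⟩

/-- A theta series with coefficients `c κ`. -/
def HasTheta (c : (Fin (Module.finrank ℤ L) → ℤ) → ℂ) (φ : ℍ → (ℂ ⊗[ℤ] L) → ℂ) : Prop :=
  ∀ τ z, HasSum (fun κ ↦ c κ * F.term κ τ z) (φ τ z)

theorem term_ne_zero (κ : Fin (Module.finrank ℤ L) → ℤ) (τ : ℍ) (z : ℂ ⊗[ℤ] L) :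
    F.term κ τ z ≠ 0 := e_ne_zero _

/-- For real combinations `z` of the `vᵢ` the series is an absolutely convergent Fourier series in
the coordinates. A single `τ` suffices. -/
theorem eq_of_hasSum {c c' : (Fin (Module.finrank ℤ L) → ℤ) → ℂ} {τ : ℍ} {f : ℂ ⊗[ℤ] L → ℂ}
    (h : ∀ z, HasSum (fun κ ↦ c κ * F.term κ τ z) (f z))
    (h' : ∀ z, HasSum (fun κ ↦ c' κ * F.term κ τ z) (f z)) : c = c' := by
  have key := eq_zero_of_hasSum_fourier (d := fun κ ↦ (c κ - c' κ) * F.term κ τ 0) fun u ↦ by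
    have h1 := (h (∑ i, (u i : ℂ) • (1 : ℂ) ⊗ₜ[ℤ] F.v i)).sub
      (h' (∑ i, (u i : ℂ) • (1 : ℂ) ⊗ₜ[ℤ] F.v i))
    rw [sub_self] at h1
    refine h1.congr_fun fun κ ↦ ?_
    simp only [term, coord_sum]
    have h0 : F.coord (0 : ℂ ⊗[ℤ] L) = 0 := by funext i; simp [coord]
    rw [h0, ← sub_mul, mul_assoc, ← e_add]
    simp
  funext κ
  have := congrFun key κ
  simpa [sub_eq_zero, F.term_ne_zero] using this

end OrthFrame

end Lattice

/-! ### Quasi-periodicity under lattice translations. -/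

section Lattice

variable {L : Type*} [AddCommGroup L] {β : LinearMap.BilinForm ℤ L}

/-- The transformation law of Jacobi forms under translations by lattice vectors. -/
def IsQuasiPeriodic (β : LinearMap.BilinForm ℤ L) (φ : ℍ → (ℂ ⊗[ℤ] L) → ℂ) : Prop :=
  ∀ (x y : L) (τ : ℍ) (z : ℂ ⊗[ℤ] L),
    φ τ (z + (τ : ℂ) ⊗ₜ x + 1 ⊗ₜ y) *
        e ((τ : ℂ) * ((β x x : ℂ) / 2) + β.baseChange ℂ (1 ⊗ₜ x) z) =
      e ((β (x + y) (x + y) : ℂ) / 2) * φ τ z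

theorem IsQuasiPeriodic.jacobiSlash_of_translation {φ : ℍ → (ℂ ⊗[ℤ] L) → ℂ} (hsymm : β.IsSymm)
    (hφ : IsQuasiPeriodic β φ) (m : ℤ) {α : Mp2Z} (h0 : α.mat 1 0 = 0) (h1 : α.mat 1 1 = 1)
    {j : ℤ} (hj : ∀ τ : ℍ, ((α.mat • τ : ℍ) : ℂ) = τ + j) :
    IsQuasiPeriodic β (jacobiSlash β m α φ) := by
  intro x y τ z
  have haut : aut α.mat τ = 1 := by simp [aut, h0, h1]
  -- `(τ + j)x + (y - jx) = τx + y`: the shift of `τ` is absorbed into `y`.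
  have h2 := hφ x (y - j • x) (α.mat • τ) z
  rw [hj] at h2
  have h3 : z + ((τ : ℂ) + j) ⊗ₜ[ℤ] x + 1 ⊗ₜ[ℤ] (y - j • x) = z + (τ : ℂ) ⊗ₜ[ℤ] x + 1 ⊗ₜ[ℤ] y := by
    rw [TensorProduct.add_tmul, TensorProduct.tmul_sub, TensorProduct.tmul_smul,
      TensorProduct.smul_tmul', zsmul_one]
    abel
  have h4 : ((τ : ℂ) + j) * ((β x x : ℂ) / 2) + β.baseChange ℂ (1 ⊗ₜ x) z =
      ((τ : ℂ) * ((β x x : ℂ) / 2) + β.baseChange ℂ (1 ⊗ₜ x) z) + j * ((β x x : ℂ) / 2) := by ring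
  have h5 : e ((β (x + (y - j • x)) (x + (y - j • x)) : ℂ) / 2) =
      e ((β (x + y) (x + y) : ℂ) / 2) * e (j * ((β x x : ℂ) / 2)) := by
    obtain ⟨t, ht⟩ := Int.even_mul_pred_self j
    rw [← e_add]
    refine e_eq_of_sub_eq_int (β x x * t - j * β x x - j * β y x) ?_
    have ht' := congrArg (Int.cast : ℤ → ℂ) ht
    simp only [map_add, map_sub, map_smul, LinearMap.add_apply, LinearMap.sub_apply,
      LinearMap.smul_apply, smul_eq_mul, hsymm.eq y x]
    push_cast at ht' ⊢
    linear_combination (β x x : ℂ) / 2 * ht'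
  rw [h3, h4, h5, e_add, ← mul_assoc, mul_right_comm _ (e (j * _)) (φ _ _)] at h2
  have h6 := mul_right_cancel₀ (e_ne_zero _) h2
  simp only [jacobiSlash, haut, h0, Int.cast_zero, neg_zero, zero_mul, zero_div, e_zero, mul_one,
    inv_one, one_smul]
  linear_combination (α.root τ ^ (-m)) * h6

theorem IsQuasiPeriodic.jacobiSlash_S {φ : ℍ → (ℂ ⊗[ℤ] L) → ℂ} (hsymm : β.IsSymm)
    (hφ : IsQuasiPeriodic β φ) (m : ℤ) : IsQuasiPeriodic β (jacobiSlash β m Mp2Z.S φ) := by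
  intro x y τ z
  have hτ : (τ : ℂ) ≠ 0 := UpperHalfPlane.ne_zero τ
  have haut : aut Mp2Z.S.mat τ = τ := by
    rw [Mp2Z.S_mat, aut]
    simp [ModularGroup.S]
  have h10 : ((Mp2Z.S.mat 1 0 : ℤ) : ℂ) = 1 := by
    rw [Mp2Z.S_mat]
    simp [ModularGroup.S]
  have hsm : ((Mp2Z.S.mat • τ : ℍ) : ℂ) = -1 / τ := by rw [Mp2Z.S_mat, coe_S_smul]
  -- `(z + τx + y)/τ = z/τ + (-1/τ)(-y) + x`, so the inversion replaces `(x, y)` by `(-y, x)`.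
  have h2 := hφ (-y) x (Mp2Z.S.mat • τ) ((τ : ℂ)⁻¹ • z)
  rw [hsm] at h2
  have h3 : (τ : ℂ)⁻¹ • z + (-1 / (τ : ℂ)) ⊗ₜ[ℤ] (-y) + 1 ⊗ₜ[ℤ] x =
      (τ : ℂ)⁻¹ • (z + (τ : ℂ) ⊗ₜ[ℤ] x + 1 ⊗ₜ[ℤ] y) := by
    rw [smul_add, smul_add, TensorProduct.smul_tmul', TensorProduct.smul_tmul', smul_eq_mul,
      smul_eq_mul, inv_mul_cancel₀ hτ, mul_one, TensorProduct.tmul_neg, ← TensorProduct.neg_tmul,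
      neg_div, neg_neg, one_div]
    abel
  have hs := fun u v : ℂ ⊗[ℤ] L ↦ (baseChange_isSymm ℂ hsymm).eq u v
  have h4 : quad β (z + (τ : ℂ) ⊗ₜ[ℤ] x + 1 ⊗ₜ[ℤ] y) = quad β z + τ ^ 2 * (β x x / 2) +
      β y y / 2 + τ * β.baseChange ℂ (1 ⊗ₜ x) z + β.baseChange ℂ (1 ⊗ₜ y) z + τ * β x y := by
    have hx : (τ : ℂ) ⊗ₜ[ℤ] x = (τ : ℂ) • (1 : ℂ) ⊗ₜ[ℤ] x := by
      rw [TensorProduct.smul_tmul', smul_eq_mul, mul_one]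
    rw [quad, quad, hx]
    simp only [map_add, map_smul, LinearMap.add_apply, LinearMap.smul_apply, smul_eq_mul,
      baseChange_one_tmul, hs z, hsymm.eq y x]
    ring
  have h5 : e ((β (-y + x) (-y + x) : ℂ) / 2) = e ((β (x + y) (x + y) : ℂ) / 2) := by
    refine e_eq_of_sub_eq_int (-2 * β x y) ?_
    simp only [map_add, map_neg, LinearMap.add_apply, LinearMap.neg_apply, hsymm.eq y x]
    push_cast
    ring
  rw [h3, h5] at h2
  simp only [jacobiSlash, haut, h10, h4]
  have h6 : e (-1 * (quad β z + τ ^ 2 * (β x x / 2) + β y y / 2 +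
      τ * β.baseChange ℂ (1 ⊗ₜ x) z + β.baseChange ℂ (1 ⊗ₜ y) z + τ * β x y) / τ) *
      e (τ * (β x x / 2) + β.baseChange ℂ (1 ⊗ₜ x) z) =
      e (-1 / τ * ((β (-y) (-y) : ℂ) / 2) + β.baseChange ℂ (1 ⊗ₜ (-y)) ((τ : ℂ)⁻¹ • z)) *
        e (-1 * quad β z / τ) := by
    rw [← e_add, ← e_add]
    refine e_eq_of_sub_eq_int (-β x y) ?_
    simp only [map_neg, LinearMap.neg_apply, neg_neg, TensorProduct.tmul_neg, map_smul,
      smul_eq_mul]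
    push_cast
    field_simp
    ring
  calc _ = φ (Mp2Z.S.mat • τ) ((τ : ℂ)⁻¹ • (z + (τ : ℂ) ⊗ₜ[ℤ] x + 1 ⊗ₜ[ℤ] y)) *
        (e (-1 * (quad β z + τ ^ 2 * (β x x / 2) + β y y / 2 +
      τ * β.baseChange ℂ (1 ⊗ₜ x) z + β.baseChange ℂ (1 ⊗ₜ y) z + τ * β x y) / τ) *
      e (τ * (β x x / 2) + β.baseChange ℂ (1 ⊗ₜ x) z)) * Mp2Z.S.root τ ^ (-m) := by ring
    _ = _ := by
      rw [h6, ← mul_assoc, h2]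
      ring

theorem IsQuasiPeriodic.jacobiSlash {φ : ℍ → (ℂ ⊗[ℤ] L) → ℂ} (hsymm : β.IsSymm)
    (hφ : IsQuasiPeriodic β φ) (m : ℤ) (α : Mp2Z) : IsQuasiPeriodic β (jacobiSlash β m α φ) := by
  induction α using Mp2Z.generator_induction generalizing φ with
  | hS => exact hφ.jacobiSlash_S hsymm m
  | hT =>
    exact hφ.jacobiSlash_of_translation hsymm m (α := Mp2Z.T) (j := 1) rfl rfl fun τ ↦ by
      simpa using coe_T_zpow_smul 1 τ
  | hT' =>
    refine hφ.jacobiSlash_of_translation hsymm m (α := Mp2Z.T⁻¹) (j := -1) ?_ ?_ fun τ ↦ by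
      simpa using coe_T_zpow_smul (-1) τ
    · simp
    · simp
  | hZ =>
    exact hφ.jacobiSlash_of_translation hsymm m (α := Mp2Z.Z) (j := 0) rfl rfl fun τ ↦ by simp
  | hmul α γ hα hγ => rw [jacobiSlash_mul]; exact hγ (hα hφ)

/-! ### Products of one-variable theta functions, and theta functions inside their span. -/

namespace OrthFrame

variable (F : OrthFrame β)

/-- The product of the one-dimensional theta functions attached to the residue classes `tᵢ`. -/
def thProd (t : Fin (Module.finrank ℤ L) → ℤ) (τ : ℍ) (z : ℂ ⊗[ℤ] L) : ℂ :=
  ∏ i, th (F.a i) (t i) τ (F.coord z i)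

/-- The space spanned by the products of one-dimensional theta functions. -/
def thProdSpace : Submodule ℂ (ℍ → (ℂ ⊗[ℤ] L) → ℂ) := Submodule.span ℂ (Set.range F.thProd)

theorem prod_mem_thProdSpace {f : Fin (Module.finrank ℤ L) → ℍ → ℂ → ℂ}
    (hf : ∀ i, f i ∈ thSpace (F.a i)) :
    (fun τ z ↦ ∏ i, f i τ (F.coord z i)) ∈ F.thProdSpace := by
  choose c hc using fun i ↦ Finsupp.mem_span_range_iff_exists_finsupp.1 (hf i)
  have h : (fun τ z ↦ ∏ i, f i τ (F.coord z i)) =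
      ∑ t ∈ Fintype.piFinset fun i ↦ (c i).support, (∏ i, c i (t i)) • F.thProd t := by
    funext τ z
    simp only [Finset.sum_apply, Pi.smul_apply, smul_eq_mul, thProd, ← Finset.prod_mul_distrib]
    rw [← Finset.prod_univ_sum (fun i ↦ (c i).support)
      fun i s ↦ c i s * th (F.a i) s τ (F.coord z i)]
    refine Finset.prod_congr rfl fun i _ ↦ ?_
    rw [← hc i]
    simp [Finsupp.sum]
  rw [h]
  exact sum_mem fun t _ ↦ Submodule.smul_mem _ _ (Submodule.subset_span ⟨t, rfl⟩)

theorem quad_eq [Module.Free ℤ L] [Module.Finite ℤ L] (hsymm : β.IsSymm) (z : ℂ ⊗[ℤ] L) :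
    quad β z = ∑ i, F.a i * F.coord z i ^ 2 := by
  rw [quad, F.baseChange_eq_sum hsymm, Finset.sum_div]
  exact Finset.sum_congr rfl fun i _ ↦ by ring

/-- In the coordinates of the frame `β` is diagonal, and weight `n/2` is `n` times weight `1/2`, so
the action factors. -/
theorem jacobiSlash_prod [Module.Free ℤ L] [Module.Finite ℤ L] (hsymm : β.IsSymm) (α : Mp2Z)
    (f : Fin (Module.finrank ℤ L) → ℍ → ℂ → ℂ) :
    jacobiSlash β (Module.finrank ℤ L) α (fun τ z ↦ ∏ i, f i τ (F.coord z i)) =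
      fun τ z ↦ ∏ i, halfSlash (F.a i) α (f i) τ (F.coord z i) := by
  funext τ z
  simp only [jacobiSlash, halfSlash_apply, Finset.prod_mul_distrib, F.quad_eq hsymm, coord_smul,
    Pi.smul_apply, smul_eq_mul, ← e_sum, Finset.prod_const, Finset.card_univ, Fintype.card_fin]
  rw [Finset.mul_sum, Finset.sum_div, zpow_neg, zpow_natCast, inv_pow]

theorem jacobiSlash_mem_thProdSpace [Module.Free ℤ L] [Module.Finite ℤ L] (hsymm : β.IsSymm)
    (α : Mp2Z) {φ : ℍ → (ℂ ⊗[ℤ] L) → ℂ} (hφ : φ ∈ F.thProdSpace) :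
    jacobiSlash β (Module.finrank ℤ L) α φ ∈ F.thProdSpace := by
  have hlin : ∀ φ, jacobiSlash β (Module.finrank ℤ L) α φ =
      jacobiRep β (Module.finrank ℤ L) α⁻¹ φ := fun φ ↦ by simp [jacobiRep]
  induction hφ using Submodule.span_induction with
  | mem φ h =>
    obtain ⟨t, rfl⟩ := h
    have := F.jacobiSlash_prod hsymm α fun i ↦ th (F.a i) (t i)
    unfold thProd
    rw [this]
    exact F.prod_mem_thProdSpace fun i ↦
      halfSlash_mem_thSpace (F.a_pos i) α (th_mem_thSpace _ _)
  | zero => rw [hlin, map_zero]; exact zero_mem _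
  | add φ ψ _ _ hφ hψ => rw [hlin] at *; rw [map_add]; exact add_mem hφ hψ
  | smul c φ _ hφ => rw [hlin] at *; rw [map_smul]; exact Submodule.smul_mem _ c hφ

theorem hasTheta_thProd (t : Fin (Module.finrank ℤ L) → ℤ) :
    F.HasTheta (fun κ ↦ ∏ i, if (2 * F.a i : ℤ) ∣ κ i - t i then 1 else 0) (F.thProd t) := by
  intro τ z
  refine (hasSum_prod_pi _ _ fun i ↦ hasSum_th (F.a_pos i) (t i) τ (F.coord z i)).congr_fun
    fun κ ↦ ?_
  rw [term_eq_prod, ← Finset.prod_mul_distrib]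
  exact Finset.prod_congr rfl fun i _ ↦ by split_ifs <;> simp

theorem exists_hasTheta {φ : ℍ → (ℂ ⊗[ℤ] L) → ℂ} (hφ : φ ∈ F.thProdSpace) :
    ∃ c, F.HasTheta c φ := by
  induction hφ using Submodule.span_induction with
  | mem φ h =>
    obtain ⟨t, rfl⟩ := h
    exact ⟨_, F.hasTheta_thProd t⟩
  | zero => exact ⟨0, fun τ z ↦ by simp⟩
  | add φ ψ _ _ hφ hψ =>
    obtain ⟨c, hc⟩ := hφ
    obtain ⟨c', hc'⟩ := hψ
    exact ⟨c + c', fun τ z ↦ by simpa [add_mul] using (hc τ z).add (hc' τ z)⟩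
  | smul a φ _ hφ =>
    obtain ⟨c, hc⟩ := hφ
    exact ⟨a • c, fun τ z ↦ by simpa [mul_assoc] using (hc τ z).mul_left a⟩

/-- Such `κ` and `κ'` differ by a vector `x = ∑ mᵢvᵢ`, for which `β(x) = ∑ aᵢmᵢ²` is an integer.
Hence elements of `W(L)` depend only on residues modulo the `2aᵢ`. -/
theorem extend_eq_of_dvd [Module.Free ℤ L] [Module.Finite ℤ L] {lam : shadow β → ℂ}
    (hlam : lam ∈ W β) {κ κ' : Fin (Module.finrank ℤ L) → ℤ}
    (h : ∀ i, (2 * F.a i : ℤ) ∣ κ' i - κ i) : F.extend lam κ' = F.extend lam κ := by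
  choose m hm using h
  obtain ⟨x, hx⟩ : ∃ x : L, x = ∑ i, m i • F.v i := ⟨_, rfl⟩
  have hxv : ∀ i, β x (F.v i) = 2 * F.a i * m i := fun i ↦ by
    rw [hx, map_sum, LinearMap.sum_apply, Finset.sum_eq_single i]
    · simp [F.self, mul_comm]
    · intro j _ hj
      simp [F.orth j i hj]
    · simp
  have hp : F.point κ' = F.point κ + 1 ⊗ₜ x := by
    rw [← point_add]
    congr 1
    funext i
    rw [hxv]
    linarith [hm i]
  have hxx : e ((β x x : ℂ) / 2) = 1 := by
    rw [← e_int (∑ i, F.a i * m i ^ 2)]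
    congr 1
    have : β x x = ∑ i, 2 * F.a i * m i ^ 2 := by
      have h1 : β x x = β x (∑ i, m i • F.v i) := by rw [← hx]
      rw [h1, map_sum]
      refine Finset.sum_congr rfl fun i _ ↦ ?_
      rw [map_smul, hxv, smul_eq_mul]
      ring
    rw [this]
    push_cast
    rw [Finset.sum_div]
    exact Finset.sum_congr rfl fun i _ ↦ by ring
  by_cases hκ : F.point κ ∈ shadow β
  · have hκ' : F.point κ' ∈ shadow β := hp ▸ add_tmul_mem_shadow hκ x
    rw [F.extend_of_mem lam hκ, F.extend_of_mem lam hκ', hlam ⟨_, hκ⟩ ⟨_, hκ'⟩ x hp, hxx, one_mul]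
  · have hκ' : F.point κ' ∉ shadow β := fun h ↦ hκ (by
      have := add_tmul_mem_shadow h (-x)
      rwa [hp, TensorProduct.tmul_neg, add_neg_cancel_right] at this)
    rw [F.extend_of_notMem lam hκ, F.extend_of_notMem lam hκ']

/-- Grouping the indices by residues modulo the `2aᵢ`, on which alone the coefficients depend, gives
a finite combination of products. It also settles the convergence of the theta series. -/
theorem hasTheta_basicTheta_aux [Module.Free ℤ L] [Module.Finite ℤ L]
    {lam : shadow β → ℂ} (hlam : lam ∈ W β) :
    F.HasTheta (F.extend lam) (∑ t ∈ Fintype.piFinset fun i ↦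
      (Finset.range (2 * F.a i)).image (Nat.cast : ℕ → ℤ), F.extend lam t • F.thProd t) := by
  intro τ z
  have h := hasSum_sum (s := Fintype.piFinset fun i ↦
    (Finset.range (2 * F.a i)).image (Nat.cast : ℕ → ℤ)) fun t _ ↦
      (F.hasTheta_thProd t τ z).mul_left (F.extend lam t)
  simp only [Finset.sum_apply, Pi.smul_apply, smul_eq_mul]
  refine h.congr_fun fun κ ↦ ?_
  have ha : ∀ i, (0 : ℤ) < 2 * F.a i := fun i ↦ by have := F.a_pos i; omega
  beta_reduce
  rw [Finset.sum_eq_single fun i ↦ κ i % (2 * F.a i)]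
  · have h1 : ∀ i, (2 * F.a i : ℤ) ∣ κ i - κ i % (2 * F.a i) := fun i ↦ Int.dvd_self_sub_emod
    rw [F.extend_eq_of_dvd hlam h1, Finset.prod_eq_one fun i _ ↦ if_pos (h1 i), one_mul]
  · intro t ht hne
    obtain ⟨i, hi⟩ := Function.ne_iff.1 hne
    rw [Finset.prod_eq_zero (Finset.mem_univ i), zero_mul, mul_zero]
    rw [if_neg]
    intro hdvd
    apply hi
    obtain ⟨s, hs, hst⟩ := Finset.mem_image.1 (Fintype.mem_piFinset.1 ht i)
    rw [Finset.mem_range] at hs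
    rw [← hst] at hdvd ⊢
    rw [← Int.emod_eq_of_lt (a := (s : ℤ)) (b := 2 * F.a i) (by positivity) (by exact_mod_cast hs)]
    exact (Int.emod_eq_emod_iff_emod_sub_eq_zero.2 (Int.emod_eq_zero_of_dvd hdvd)).symm
  · intro hn
    refine absurd (Fintype.mem_piFinset.2 fun i ↦ Finset.mem_image.2 ⟨(κ i % (2 * F.a i)).toNat,
      ?_, Int.toNat_of_nonneg (Int.emod_nonneg _ (ha i).ne')⟩) hn
    rw [Finset.mem_range, Int.toNat_lt (Int.emod_nonneg _ (ha i).ne')]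
    exact_mod_cast Int.emod_lt_of_pos _ (ha i)

theorem hasTheta_basicTheta [Module.Free ℤ L] [Module.Finite ℤ L] (hsymm : β.IsSymm)
    {lam : shadow β → ℂ} (hlam : lam ∈ W β) : F.HasTheta (F.extend lam) (basicTheta β lam) := by
  intro τ z
  have h := F.hasTheta_basicTheta_aux hlam τ z
  have h' := (F.hasSum_shadow_iff hsymm lam τ z _).2 h
  rw [basicTheta, h'.tsum_eq]
  exact h

theorem basicTheta_mem_thProdSpace [Module.Free ℤ L] [Module.Finite ℤ L] (hsymm : β.IsSymm)
    {lam : shadow β → ℂ} (hlam : lam ∈ W β) : basicTheta β lam ∈ F.thProdSpace := by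
  have h : basicTheta β lam = ∑ t ∈ Fintype.piFinset fun i ↦
      (Finset.range (2 * F.a i)).image (Nat.cast : ℕ → ℤ), F.extend lam t • F.thProd t := by
    funext τ z
    exact (F.hasTheta_basicTheta hsymm hlam τ z).unique (F.hasTheta_basicTheta_aux hlam τ z)
  rw [h]
  exact sum_mem fun t _ ↦ Submodule.smul_mem _ _ (Submodule.subset_span ⟨t, rfl⟩)

theorem term_add [Module.Free ℤ L] [Module.Finite ℤ L] (hsymm : β.IsSymm)
    (κ : Fin (Module.finrank ℤ L) → ℤ) (x y : L) (τ : ℍ) (z : ℂ ⊗[ℤ] L) :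
    F.term κ τ (z + (τ : ℂ) ⊗ₜ x + 1 ⊗ₜ y) *
        e ((τ : ℂ) * ((β x x : ℂ) / 2) + β.baseChange ℂ (1 ⊗ₜ x) z) =
      e ((β.baseChange ℚ (F.point κ) (1 ⊗ₜ y) : ℚ) : ℂ) *
        F.term (fun i ↦ κ i + β x (F.v i)) τ z := by
  have h1 : (β x x : ℂ) = ∑ i, (β x (F.v i) : ℂ) ^ 2 / (2 * F.a i) := by
    rw [← baseChange_one_tmul ℂ β, F.baseChange_eq_sum hsymm]
    refine Finset.sum_congr rfl fun i _ ↦ ?_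
    have h := F.a_ne_zero ℂ i
    rw [coord_tmul]
    field_simp
  have h2 : β.baseChange ℂ (1 ⊗ₜ x) z = ∑ i, (β x (F.v i) : ℂ) * F.coord z i := by
    rw [F.baseChange_eq_sum hsymm]
    refine Finset.sum_congr rfl fun i _ ↦ ?_
    have h := F.a_ne_zero ℂ i
    rw [coord_tmul]
    field_simp
  have h3 : ((β.baseChange ℚ (F.point κ) (1 ⊗ₜ y) : ℚ) : ℂ) =
      ∑ i, (κ i : ℂ) * (β y (F.v i) : ℂ) / (2 * F.a i) := by
    rw [F.baseChange_eq_sum hsymm]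
    push_cast
    refine Finset.sum_congr rfl fun i _ ↦ ?_
    have h := F.a_ne_zero ℂ i
    rw [coord_tmul, coord_point]
    push_cast
    field_simp
  rw [h1, h2, h3, term, term, ← e_add, ← e_add]
  congr 1
  simp only [coord_add, Pi.add_apply, coord_tmul, Finset.sum_div, Finset.mul_sum, Finset.sum_mul,
    ← Finset.sum_add_distrib]
  refine Finset.sum_congr rfl fun i _ ↦ ?_
  have h := F.a_ne_zero ℂ i
  push_cast
  field_simp
  ring

/-- Translation of the coordinates by a lattice vector. -/
def shift (x : L) : (Fin (Module.finrank ℤ L) → ℤ) ≃ (Fin (Module.finrank ℤ L) → ℤ) :=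
  Equiv.addRight fun i ↦ β x (F.v i)

theorem point_shift [Module.Free ℤ L] [Module.Finite ℤ L] (x : L)
    (κ : Fin (Module.finrank ℤ L) → ℤ) : F.point (F.shift x κ) = F.point κ + 1 ⊗ₜ x :=
  F.point_add κ x

theorem hasSum_translate [Module.Free ℤ L] [Module.Finite ℤ L] (hsymm : β.IsSymm)
    {c : (Fin (Module.finrank ℤ L) → ℤ) → ℂ} {τ : ℍ} {f : ℂ ⊗[ℤ] L → ℂ}
    (h : ∀ z, HasSum (fun κ ↦ c κ * F.term κ τ z) (f z)) (x y : L) (z : ℂ ⊗[ℤ] L) :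
    HasSum (fun κ ↦ c ((F.shift x).symm κ) *
      e ((β.baseChange ℚ (F.point ((F.shift x).symm κ)) (1 ⊗ₜ y) : ℚ) : ℂ) * F.term κ τ z)
      (f (z + (τ : ℂ) ⊗ₜ x + 1 ⊗ₜ y) *
        e ((τ : ℂ) * ((β x x : ℂ) / 2) + β.baseChange ℂ (1 ⊗ₜ x) z)) := by
  rw [← (F.shift x).hasSum_iff]
  refine ((h _).mul_right _).congr_fun fun κ ↦ ?_
  simp only [Function.comp_apply, Equiv.symm_apply_apply]
  rw [mul_assoc (c κ), mul_assoc (c κ), F.term_add hsymm]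
  rfl

theorem e_baseChange_of_mem_shadow {r : ℚ ⊗[ℤ] L} (hr : r ∈ shadow β) (y : L) :
    e ((β.baseChange ℚ r (1 ⊗ₜ y) : ℚ) : ℂ) = e ((β y y : ℂ) / 2) := by
  obtain ⟨m, hm⟩ := hr y
  refine e_eq_of_sub_eq_int m ?_
  have := congrArg (Rat.cast : ℚ → ℂ) hm
  push_cast at this
  exact this

theorem isQuasiPeriodic_basicTheta (F : OrthFrame β) [Module.Free ℤ L] [Module.Finite ℤ L] (hsymm : β.IsSymm)
    {lam : shadow β → ℂ} (hlam : lam ∈ W β) : IsQuasiPeriodic β (basicTheta β lam) := by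
  intro x y τ z
  have h := F.hasTheta_basicTheta hsymm hlam τ
  refine (F.hasSum_translate hsymm h x y z).unique (((h z).mul_left _).congr_fun fun κ ↦ ?_)
  obtain ⟨κ, rfl⟩ := (F.shift x).surjective κ
  rw [Equiv.symm_apply_apply, ← mul_assoc]
  congr 1
  by_cases hκ : F.point κ ∈ shadow β
  · have hκ' : F.point (F.shift x κ) ∈ shadow β := F.point_shift x κ ▸ add_tmul_mem_shadow hκ x
    rw [F.extend_of_mem lam hκ, F.extend_of_mem lam hκ',
      hlam ⟨_, hκ⟩ ⟨_, hκ'⟩ x (F.point_shift x κ), e_baseChange_of_mem_shadow hκ,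
      e_half_add hsymm]
    linear_combination (-(e ((β y y : ℂ) / 2) * lam ⟨_, hκ⟩)) * e_half_sq (β x x)
  · have hκ' : F.point (F.shift x κ) ∉ shadow β := fun h ↦ hκ (by
      have := add_tmul_mem_shadow h (-x)
      rwa [F.point_shift, TensorProduct.tmul_neg, add_neg_cancel_right] at this)
    rw [F.extend_of_notMem lam hκ, F.extend_of_notMem lam hκ', zero_mul, mul_zero]

/-- A quasi-periodic theta series has coefficients in `W(L)`. -/
theorem exists_mem_W [Module.Free ℤ L] [Module.Finite ℤ L] (hsymm : β.IsSymm)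
    {c : (Fin (Module.finrank ℤ L) → ℤ) → ℂ} {τ : ℍ} {f : ℂ ⊗[ℤ] L → ℂ}
    (h : ∀ z, HasSum (fun κ ↦ c κ * F.term κ τ z) (f z))
    (hf : ∀ (x y : L) (z : ℂ ⊗[ℤ] L), f (z + (τ : ℂ) ⊗ₜ x + 1 ⊗ₜ y) *
        e ((τ : ℂ) * ((β x x : ℂ) / 2) + β.baseChange ℂ (1 ⊗ₜ x) z) =
      e ((β (x + y) (x + y) : ℂ) / 2) * f z) : ∃ lam ∈ W β, c = F.extend lam := by
  -- Compare the coefficients of the two Fourier expansions of the translated function. The case `x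
  -- = 0` confines the support to the shadow, and `y = 0` gives the transformation law of `W(L)`.
  have key : ∀ x y κ, c κ * e ((β.baseChange ℚ (F.point κ) (1 ⊗ₜ y) : ℚ) : ℂ) =
      e ((β (x + y) (x + y) : ℂ) / 2) * c (F.shift x κ) := fun x y κ ↦ by
    have := F.eq_of_hasSum (F.hasSum_translate hsymm h x y) fun z ↦ by
      rw [hf x y z]
      exact ((h z).mul_left (e ((β (x + y) (x + y) : ℂ) / 2))).congr_fun
        (g := fun κ ↦ (e ((β (x + y) (x + y) : ℂ) / 2) * c κ) * F.term κ τ z) fun κ ↦ by ring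
    simpa using congrFun this (F.shift x κ)
  have hsupp : ∀ κ, F.point κ ∉ shadow β → c κ = 0 := fun κ hκ ↦ by
    by_contra h0
    refine hκ fun y ↦ ?_
    have h1 := key 0 y κ
    have h2 : F.shift 0 κ = κ := by
      funext i
      simp [shift]
    rw [h2, zero_add, mul_comm] at h1
    have h3 := mul_right_cancel₀ h0 h1
    have h4 : e (((β.baseChange ℚ (F.point κ) (1 ⊗ₜ y) : ℚ) : ℂ) - (β y y : ℂ) / 2) = 1 := by
      rw [e_sub, h3, div_self (e_ne_zero _)]
    obtain ⟨m, hm⟩ := (e_eq_one_iff _).1 h4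
    exact ⟨m, by exact_mod_cast hm⟩
  refine ⟨fun r ↦ c (F.index (r : ℚ ⊗[ℤ] L)), fun r r' x hr ↦ ?_, ?_⟩
  · have h1 := key x 0 (F.index (r : ℚ ⊗[ℤ] L))
    have h2 : F.index (r' : ℚ ⊗[ℤ] L) = F.shift x (F.index (r : ℚ ⊗[ℤ] L)) := by
      rw [← F.index_point (F.shift x _), F.point_shift, F.point_index r.2, hr]
    simp only [TensorProduct.tmul_zero, map_zero, Rat.cast_zero, e_zero, mul_one, add_zero] at h1
    beta_reduce
    rw [h2, h1, ← mul_assoc, e_half_sq, one_mul]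
  · funext κ
    by_cases hκ : F.point κ ∈ shadow β
    · rw [F.extend_of_mem _ hκ, F.index_point]
    · rw [F.extend_of_notMem _ hκ, hsupp κ hκ]

end OrthFrame

end Lattice

/-! ### `Θ(L)` as a finite-dimensional module over the metaplectic group. -/

section Lattice

variable {L : Type*} [AddCommGroup L] {β : LinearMap.BilinForm ℤ L}

theorem jacobiSlash_T_pow (m : ℤ) (N : ℕ) (φ : ℍ → (ℂ ⊗[ℤ] L) → ℂ) (τ : ℍ) (z : ℂ ⊗[ℤ] L) :
    jacobiSlash β m (Mp2Z.T ^ N) φ τ z = φ (ModularGroup.T ^ N • τ) z := by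
  have h0 : (ModularGroup.T ^ N : SL(2, ℤ)) 1 0 = 0 := by
    simpa using T_zpow_entry N 1 0
  simp [jacobiSlash, aut_T_pow, h0, e_zero]

/-- A level on which the products of one-dimensional theta functions transform by scalars. -/
def OrthFrame.thetaLevel (F : OrthFrame β) : ℕ := 24 * ∏ i, 4 * F.a i

theorem OrthFrame.thetaLevel_pos (F : OrthFrame β) : 0 < F.thetaLevel :=
  Nat.mul_pos (by norm_num) (Finset.prod_pos fun i _ ↦ by have := F.a_pos i; omega)

variable [Module.Free ℤ L] [Module.Finite ℤ L]

namespace OrthFrame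

variable (F : OrthFrame β)

theorem extend_injective {lam lam' : shadow β → ℂ} (h : F.extend lam = F.extend lam') :
    lam = lam' := by
  funext r
  rw [← F.extend_index lam r, h, F.extend_index]

theorem eq_basicTheta (hsymm : β.IsSymm) {lam : shadow β → ℂ} (hlam : lam ∈ W β) {τ : ℍ}
    {z : ℂ ⊗[ℤ] L} {s : ℂ} (h : HasSum (fun κ ↦ F.extend lam κ * F.term κ τ z) s) :
    s = basicTheta β lam τ z :=
  h.unique (F.hasTheta_basicTheta hsymm hlam τ z)

theorem eq_of_basicTheta_eq (F : OrthFrame β) (hsymm : β.IsSymm) {lam lam' : shadow β → ℂ} (hlam : lam ∈ W β)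
    (hlam' : lam' ∈ W β) (τ : ℍ) (h : ∀ z, basicTheta β lam τ z = basicTheta β lam' τ z) :
    lam = lam' :=
  F.extend_injective (F.eq_of_hasSum (F.hasTheta_basicTheta hsymm hlam τ) fun z ↦ by
    rw [h z]
    exact F.hasTheta_basicTheta hsymm hlam' τ z)

/-- The linear map `lam ↦ ϑ_lam`. -/
def thetaLin (hsymm : β.IsSymm) : W β →ₗ[ℂ] (ℍ → (ℂ ⊗[ℤ] L) → ℂ) where
  toFun lam := basicTheta β lam
  map_add' lam lam' := by
    funext τ z
    refine (F.eq_basicTheta hsymm (lam + lam').2 (((F.hasTheta_basicTheta hsymm lam.2 τ z).add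
      (F.hasTheta_basicTheta hsymm lam'.2 τ z)).congr_fun fun κ ↦ ?_)).symm
    rw [← add_mul]
    congr 1
    simp only [extend]
    split_ifs <;> simp
  map_smul' c lam := by
    funext τ z
    refine (F.eq_basicTheta hsymm (c • lam).2 (((F.hasTheta_basicTheta hsymm lam.2 τ z).mul_left
      c).congr_fun fun κ ↦ ?_)).symm
    rw [← mul_assoc]
    congr 1
    simp only [extend]
    split_ifs <;> simp

theorem thetaLin_apply (hsymm : β.IsSymm) (lam : W β) : F.thetaLin hsymm lam = basicTheta β lam :=
  rfl

theorem thetaSpace_eq_range (hsymm : β.IsSymm) :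
    thetaSpace β = LinearMap.range (F.thetaLin hsymm) := by
  refine le_antisymm (Submodule.span_le.2 ?_) ?_
  · rintro _ ⟨lam, hlam, rfl⟩
    exact ⟨⟨lam, hlam⟩, rfl⟩
  · rintro _ ⟨lam, rfl⟩
    exact Submodule.subset_span ⟨lam, lam.2, rfl⟩

/-- Elements of `thProdSpace` have coefficients independent of `τ`, so quasi-periodicity at `τ = i`
already puts these coefficients in `W(L)`. -/
theorem exists_basicTheta_eq_of_mem (hsymm : β.IsSymm) {φ : ℍ → (ℂ ⊗[ℤ] L) → ℂ}
    (hφ : φ ∈ F.thProdSpace) (hqp : IsQuasiPeriodic β φ) : ∃ lam ∈ W β, φ = basicTheta β lam := by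
  obtain ⟨c, hc⟩ := F.exists_hasTheta hφ
  obtain ⟨lam, hlam, rfl⟩ := F.exists_mem_W hsymm (hc UpperHalfPlane.I)
    fun x y z ↦ hqp x y UpperHalfPlane.I z
  exact ⟨lam, hlam, funext₂ fun τ z ↦ F.eq_basicTheta hsymm hlam (hc τ z)⟩

/-- The slash action preserves both the span of the products and quasi-periodicity, and together
these characterise `Θ(L)`. -/
theorem jacobiSlash_mem_thetaSpace (F : OrthFrame β) (hsymm : β.IsSymm) (α : Mp2Z) {φ : ℍ → (ℂ ⊗[ℤ] L) → ℂ}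
    (hφ : φ ∈ thetaSpace β) : jacobiSlash β (Module.finrank ℤ L) α φ ∈ thetaSpace β := by
  rw [F.thetaSpace_eq_range hsymm] at hφ ⊢
  obtain ⟨lam, rfl⟩ := hφ
  obtain ⟨lam', hlam', h⟩ := F.exists_basicTheta_eq_of_mem hsymm
    (F.jacobiSlash_mem_thProdSpace hsymm α (F.basicTheta_mem_thProdSpace hsymm lam.2))
    ((F.isQuasiPeriodic_basicTheta hsymm lam.2).jacobiSlash hsymm _ α)
  exact ⟨⟨lam', hlam'⟩, h.symm⟩

/-- `Θ(L)` as a module over the metaplectic group. -/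
def thetaSubrep (hsymm : β.IsSymm) :
    Subrepresentation (jacobiRep β (Module.finrank ℤ L)) where
  toSubmodule := thetaSpace β
  apply_mem_toSubmodule α _ hφ := F.jacobiSlash_mem_thetaSpace hsymm α⁻¹ hφ

/-- Representatives of the residue classes modulo `2aᵢ`. -/
def residues : Finset (Fin (Module.finrank ℤ L) → ℤ) :=
  Fintype.piFinset fun i ↦ (Finset.range (2 * F.a i)).image (Nat.cast : ℕ → ℤ)

/-- The restriction of elements of `W(L)` to finitely many vectors. -/
def residueMap : W β →ₗ[ℂ] (F.residues → ℂ) where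
  toFun lam t := F.extend lam t
  map_add' lam lam' := by
    funext t
    simp only [extend, Pi.add_apply]
    split_ifs <;> simp
  map_smul' c lam := by
    funext t
    simp only [extend, Pi.smul_apply]
    split_ifs <;> simp

theorem residueMap_injective : Function.Injective F.residueMap := fun lam lam' h ↦ by
  refine Subtype.ext (F.extend_injective ?_)
  funext κ
  have ha : ∀ i, (0 : ℤ) < 2 * F.a i := fun i ↦ by have := F.a_pos i; omega
  have h1 : ∀ i, (2 * F.a i : ℤ) ∣ κ i - κ i % (2 * F.a i) := fun i ↦ Int.dvd_self_sub_emod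
  rw [F.extend_eq_of_dvd lam.2 h1, F.extend_eq_of_dvd lam'.2 h1]
  refine congrFun h ⟨_, Fintype.mem_piFinset.2 fun i ↦ Finset.mem_image.2
    ⟨(κ i % (2 * F.a i)).toNat, ?_, Int.toNat_of_nonneg (Int.emod_nonneg _ (ha i).ne')⟩⟩
  rw [Finset.mem_range, Int.toNat_lt (Int.emod_nonneg _ (ha i).ne')]
  exact_mod_cast Int.emod_lt_of_pos _ (ha i)

theorem finiteDimensional_W (F : OrthFrame β) : FiniteDimensional ℂ (W β) :=
  Module.Finite.of_injective F.residueMap F.residueMap_injective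

/-- Every linear form on `W(L)` is a combination of evaluations. -/
theorem exists_eq_sum_extend (l : W β →ₗ[ℂ] ℂ) :
    ∃ b : F.residues → ℂ, ∀ lam : W β, l lam = ∑ t : F.residues, b t * F.extend lam t := by
  obtain ⟨g, hg⟩ := F.residueMap.exists_leftInverse_of_injective
    (LinearMap.ker_eq_bot.2 F.residueMap_injective)
  refine ⟨fun t ↦ l (g (Pi.single t 1)), fun lam ↦ ?_⟩
  have h1 : l lam = (l ∘ₗ g) (F.residueMap lam) := by
    have := LinearMap.congr_fun hg lam
    simp only [LinearMap.comp_apply, LinearMap.id_apply] at this ⊢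
    rw [this]
  rw [h1, LinearMap.pi_apply_eq_sum_univ]
  refine Finset.sum_congr rfl fun t _ ↦ ?_
  rw [smul_eq_mul, mul_comm]
  congr 1
  change l (g _) = l (g _)
  congr 2
  funext s
  simp [Pi.single_apply, eq_comm]

/-! ### The action of congruence subgroups -/

/-- `T^N` multiplies the term of `r` by `e(Nβ(r)) = 1`. The weight plays no role, as the root of
`T^N` is `1`. -/
theorem jacobiSlash_T_pow_basicTheta (F : OrthFrame β) (hsymm : β.IsSymm) {N : ℕ}
    (hN : ∀ r ∈ shadow β, ∃ m : ℤ, (N : ℚ) * (β.baseChange ℚ r r / 2) = m) (m : ℤ)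
    {lam : shadow β → ℂ} (hlam : lam ∈ W β) :
    jacobiSlash β m (Mp2Z.T ^ N) (basicTheta β lam) = basicTheta β lam := by
  funext τ z
  rw [jacobiSlash_T_pow]
  refine F.eq_basicTheta hsymm hlam
    ((F.hasTheta_basicTheta hsymm hlam _ z).congr_fun fun κ ↦ ?_)
  by_cases hκ : F.point κ ∈ shadow β
  · congr 1
    obtain ⟨t, ht⟩ := hN _ hκ
    rw [F.term_eq hsymm, F.term_eq hsymm, coe_T_pow_smul]
    refine e_eq_of_sub_eq_int (-t) ?_
    have ht' := congrArg (Rat.cast : ℚ → ℂ) ht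
    push_cast at ht' ⊢
    linear_combination (-1 : ℂ) * ht'
  · rw [F.extend_of_notMem _ hκ, zero_mul, zero_mul]

/-- Both `24` and all `4aᵢ` divide `thetaLevel`, so each of the `n` factors of a product contributes
`ε(γ)`. -/
theorem jacobiSlash_of_mem_Gamma (hsymm : β.IsSymm) {γ : Mp2Z}
    (hγ : γ.mat ∈ CongruenceSubgroup.Gamma F.thetaLevel) {φ : ℍ → (ℂ ⊗[ℤ] L) → ℂ}
    (hφ : φ ∈ F.thProdSpace) :
    jacobiSlash β (Module.finrank ℤ L) γ φ = (eps γ : ℂ) ^ Module.finrank ℤ L • φ := by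
  have hlin : ∀ φ, jacobiSlash β (Module.finrank ℤ L) γ φ =
      jacobiRep β (Module.finrank ℤ L) γ⁻¹ φ := fun φ ↦ by simp [jacobiRep]
  induction hφ using Submodule.span_induction with
  | mem φ h =>
    obtain ⟨t, rfl⟩ := h
    have := F.jacobiSlash_prod hsymm γ fun i ↦ th (F.a i) (t i)
    unfold thProd
    rw [this]
    funext τ z
    have h1 : ∀ i, halfSlash (F.a i) γ (th (F.a i) (t i)) = (eps γ : ℂ) • th (F.a i) (t i) :=
      fun i ↦ halfSlash_th_eq_eps (F.a_pos i) (Dvd.intro _ rfl)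
        ((Finset.dvd_prod_of_mem (fun i ↦ 4 * F.a i) (Finset.mem_univ i)).mul_left 24) hγ _
    simp [h1, Finset.prod_mul_distrib]
  | zero => rw [hlin, map_zero, smul_zero]
  | add φ ψ _ _ hφ hψ => rw [hlin] at *; rw [map_add, hφ, hψ, smul_add]
  | smul c φ _ hφ => rw [hlin] at *; rw [map_smul, hφ, smul_comm]

/-- The action of `Γ(N)` on theta functions if `N β(r)` is integral on the shadow. -/
theorem jacobiSlash_mul_of_mem_Gamma (hsymm : β.IsSymm) {N : ℕ}
    (hN : ∀ r ∈ shadow β, ∃ m : ℤ, (N : ℚ) * (β.baseChange ℚ r r / 2) = m) {δ γ : Mp2Z}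
    (hδ : δ ∈ Subgroup.normalClosure {Mp2Z.T ^ N})
    (hγ : γ.mat ∈ CongruenceSubgroup.Gamma F.thetaLevel) {φ : ℍ → (ℂ ⊗[ℤ] L) → ℂ}
    (hφ : φ ∈ thetaSpace β) :
    jacobiSlash β (Module.finrank ℤ L) (δ * γ) φ = (eps γ : ℂ) ^ Module.finrank ℤ L • φ := by
  have h1 : jacobiSlash β (Module.finrank ℤ L) δ φ = φ := by
    refine eq_self_of_mem_normalClosure (jacobiSlash β (Module.finrank ℤ L))
      (fun φ ↦ ?_) (jacobiSlash_mul β _) (thetaSpace β)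
      (fun α φ hφ ↦ F.jacobiSlash_mem_thetaSpace hsymm α hφ) (fun φ hφ ↦ ?_) hδ φ hφ
    · funext τ z
      simp [jacobiSlash, aut_one, e_zero]
    · rw [F.thetaSpace_eq_range hsymm] at hφ
      obtain ⟨lam, rfl⟩ := hφ
      exact F.jacobiSlash_T_pow_basicTheta hsymm hN _ lam.2
  rw [F.thetaSpace_eq_range hsymm] at hφ
  obtain ⟨lam, rfl⟩ := hφ
  rw [jacobiSlash_mul, h1]
  exact F.jacobiSlash_of_mem_Gamma hsymm hγ (F.basicTheta_mem_thProdSpace hsymm lam.2)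

theorem thetaLevel_mul_quad (hsymm : β.IsSymm) :
    ∀ r ∈ shadow β, ∃ m : ℤ, (F.thetaLevel : ℚ) * (β.baseChange ℚ r r / 2) = m := by
  intro r hr
  rw [← F.point_index hr, F.quad_point hsymm]
  have h : ∀ i, ∃ d : ℕ, F.thetaLevel = 4 * F.a i * d := fun i ↦
    (Finset.dvd_prod_of_mem (fun i ↦ 4 * F.a i) (Finset.mem_univ i)).mul_left 24
  choose d hd using h
  refine ⟨∑ i, d i * F.index r i ^ 2, ?_⟩
  rw [Finset.mul_sum]
  push_cast
  refine Finset.sum_congr rfl fun i _ ↦ ?_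
  have h := F.a_ne_zero ℚ i
  rw [hd i]
  push_cast
  field_simp

/-! ### Holomorphy -/

theorem differentiableAt_th {a : ℕ} (ha : 0 < a) (s : ℤ) {E : Type*} [NormedAddCommGroup E]
    [NormedSpace ℂ E] {f g : E → ℂ} {p : E} (hf : DifferentiableAt ℂ f p)
    (hg : DifferentiableAt ℂ g p) (hp : 0 < (f p).im) :
    DifferentiableAt ℂ (fun q ↦ th a s (UpperHalfPlane.ofComplex (f q)) (g q)) p := by
  have h1 : ∀ᶠ q in 𝓝 p, 0 < (f q).im :=
    (Complex.continuous_im.continuousAt.comp hf.continuousAt).eventually (lt_mem_nhds hp)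
  have h2 : (fun q ↦ th a s (UpperHalfPlane.ofComplex (f q)) (g q)) =ᶠ[𝓝 p] fun q ↦
      (2 * a : ℂ)⁻¹ * ∑ j ∈ Finset.range (2 * a), e (-((j : ℂ) * s / (2 * a))) *
        jacobiTheta₂ (g q + j / (2 * a)) (f q / (2 * a)) := by
    filter_upwards [h1] with q hq
    rw [th_eq_sum ha, UpperHalfPlane.ofComplex_apply_of_im_pos hq]
  refine h2.differentiableAt_iff.2 (DifferentiableAt.const_mul
    (DifferentiableAt.fun_sum fun j _ ↦ DifferentiableAt.const_mul ?_ _) _)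
  have h3 : 0 < (f p / (2 * a)).im := im_div_pos ha ⟨f p, hp⟩
  exact (hasFDerivAt_jacobiTheta₂ (g p + j / (2 * a)) h3).differentiableAt.comp
    (f := fun q ↦ (g q + j / (2 * a), f q / (2 * a))) p
    ((hg.add_const _).prodMk (by simpa only [div_eq_mul_inv] using hf.mul_const _))

theorem isHolomorphic_basicTheta (F : OrthFrame β) (hsymm : β.IsSymm) {lam : shadow β → ℂ}
    (hlam : lam ∈ W β) : IsHolomorphic (basicTheta β lam) := by
  have h := F.basicTheta_mem_thProdSpace hsymm hlam
  intro b p hp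
  refine DifferentiableAt.differentiableWithinAt ?_
  generalize basicTheta β lam = φ at h
  induction h using Submodule.span_induction with
  | mem φ h =>
    obtain ⟨t, rfl⟩ := h
    unfold thProd
    have h : ∀ i, DifferentiableAt ℂ (fun q : ℂ × (Fin (Module.finrank ℤ L) → ℂ) ↦
        th (F.a i) (t i) (UpperHalfPlane.ofComplex q.1) (F.coord (∑ j, q.2 j ⊗ₜ[ℤ] b j) i)) p := by
      intro i
      have : ∀ q : ℂ × (Fin (Module.finrank ℤ L) → ℂ), F.coord (∑ j, q.2 j ⊗ₜ[ℤ] b j) i =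
          ∑ j, q.2 j * (β (b j) (F.v i) / (2 * F.a i)) := fun q ↦ by
        simp only [← F.coord_tmul, coord, map_sum, LinearMap.sum_apply, Finset.sum_div]
      simp only [this]
      exact differentiableAt_th (F.a_pos i) (t i) (by fun_prop) (by fun_prop) hp
    exact (HasFDerivAt.finsetProd fun i _ ↦ (h i).hasFDerivAt).differentiableAt
  | zero => simp
  | add φ ψ _ _ hφ hψ => exact hφ.add hψ
  | smul c φ _ hφ => exact hφ.const_smul c

end OrthFrame

end Lattice

/-! ### Modular forms are stable under the slash action -/

theorem mdifferentiable_slash {m : ℤ} (α : Mp2Z) {f : ℍ → ℂ} (hf : MDifferentiable 𝓘(ℂ) 𝓘(ℂ) f) :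
    MDifferentiable 𝓘(ℂ) 𝓘(ℂ) (slash m α f) := by
  have h1 := hf.comp (Mp2Z.mdifferentiable_smul_SL α.mat)
  have h2 := α.holo
  rw [UpperHalfPlane.mdifferentiable_iff] at h1 h2 ⊢
  exact h1.mul (h2.zpow (Or.inl fun z _ ↦ α.root_ne_zero _))

/-- `Γ(N)` is normal and the multiplier is invariant under conjugation; for odd `m` the latter is
`exists_kappa_eq`, which uses `4 ∣ N`. -/
theorem slash_mem_modularFormsLevel {m : ℤ} {N : ℕ} (hN : Even m ∨ 4 ∣ N) (α : Mp2Z) {f : ℍ → ℂ}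
    (hf : f ∈ modularFormsLevel m N) : slash m α f ∈ modularFormsLevel m N := by
  obtain ⟨h1, h2, h3⟩ := hf
  refine ⟨mdifferentiable_slash α h1, fun γ hγ τ ↦ ?_, fun γ ↦ ?_⟩
  · have h4 : slash m γ (slash m α f) = slash m α (slash m (α * γ * α⁻¹) f) := by
      rw [← slash_mul, ← slash_mul]
      simp
    have h5 : multiplier m (α * γ * α⁻¹) (α.mat • τ) = multiplier m γ τ := by
      rw [multiplier, multiplier]
      split_ifs with hm
      · rfl
      · obtain ⟨c, -, hc⟩ := exists_kappa_eq (hN.resolve_left hm) hγ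
        rw [hc α, ← hc 1 τ]
        simp
    rw [h4, slash, h2 _ (Gamma_conj_mem hγ α), h5, slash]
    ring
  · rw [← slash_mul]
    exact h3 _

theorem slash_mem_modularForms {m : ℤ} (α : Mp2Z) {f : ℍ → ℂ} (hf : f ∈ modularForms m) :
    slash m α f ∈ modularForms m := by
  obtain ⟨N, hN, h4, hf⟩ := hf
  exact ⟨N, hN, h4, slash_mem_modularFormsLevel h4 α hf⟩

/-- `M_{m/2}(Γ(N))` as a module over the metaplectic group. -/
def levelSubrep (m : ℤ) {N : ℕ} (hN : Even m ∨ 4 ∣ N) : Subrepresentation (slashRep m) where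
  toSubmodule := modularFormsLevel m N
  apply_mem_toSubmodule α _ hf := slash_mem_modularFormsLevel hN α⁻¹ hf

/-- `M_{m/2}` as a module over the metaplectic group. -/
def modularSubrep (m : ℤ) : Subrepresentation (slashRep m) where
  toSubmodule := modularForms m
  apply_mem_toSubmodule α _ hf := slash_mem_modularForms α⁻¹ hf

/-! ### Series in non-negative powers of `q` -/

theorem norm_mul_e_le {c : ℂ} {x : ℚ} (hx : x < 0 → c = 0) {w w' : ℂ} (h : w'.im ≤ w.im) :
    ‖c * e (x * w)‖ ≤ ‖c * e (x * w')‖ := by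
  rcases lt_or_ge x 0 with h0 | h0
  · simp [hx h0]
  · rw [norm_mul, norm_mul, norm_e, norm_e]
    have him : ∀ u : ℂ, ((x : ℂ) * u).im = x * u.im := fun u ↦ by
      simp [Complex.mul_im]
    rw [him, him]
    have : (0 : ℝ) ≤ x := by exact_mod_cast h0
    have := Real.pi_pos
    gcongr

theorem mdifferentiable_of_hasSum {J : Type*} {c : J → ℂ} {x : J → ℚ} {f : ℍ → ℂ}
    (hx : ∀ j, x j < 0 → c j = 0) (hf : ∀ τ : ℍ, HasSum (fun j ↦ c j * e (x j * τ)) (f τ)) :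
    MDifferentiable 𝓘(ℂ) 𝓘(ℂ) f := by
  rw [UpperHalfPlane.mdifferentiable_iff]
  intro w hw
  have hw' : 0 < w.im := hw
  -- A point at half the height of `w`: exponents being non-negative, its series dominates the terms
  -- on the half plane above it, a neighbourhood of `w`.
  let σ : ℍ := ⟨Complex.I * (w.im / 2 : ℝ), by simpa using hw'⟩
  have hσ : (σ : ℂ).im = w.im / 2 := by
    change (Complex.I * (w.im / 2 : ℝ)).im = _
    simp
  have hU : IsOpen {u : ℂ | w.im / 2 < u.im} := isOpen_lt continuous_const Complex.continuous_im
  have h1 : DifferentiableOn ℂ (fun u : ℂ ↦ ∑' j, c j * e (x j * u)) {u : ℂ | w.im / 2 < u.im} := by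
    refine Complex.differentiableOn_tsum_of_summable_norm (hf σ).summable.norm (fun j ↦ ?_) hU
      fun j u hu ↦ norm_mul_e_le (hx j) ?_
    · exact ((differentiable_e.comp (differentiable_id.const_mul _)).const_mul _).differentiableOn
    · rw [hσ]
      exact (show w.im / 2 < u.im from hu).le
  have hmem : {u : ℂ | w.im / 2 < u.im} ∈ 𝓝 w := hU.mem_nhds (by simpa using hw')
  refine DifferentiableAt.differentiableWithinAt ((h1.differentiableAt hmem).congr_of_eventuallyEq ?_)
  filter_upwards [hmem] with u hu
  have hu' : 0 < u.im := lt_trans (by linarith) (show w.im / 2 < u.im from hu)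
  rw [Function.comp_apply, ← (hf _).tsum_eq, UpperHalfPlane.ofComplex_apply_of_im_pos hu']

theorem isBoundedAtImInfty_of_hasSum {J : Type*} {c : J → ℂ} {x : J → ℚ} {f : ℍ → ℂ}
    (hx : ∀ j, x j < 0 → c j = 0) (hf : ∀ τ : ℍ, HasSum (fun j ↦ c j * e (x j * τ)) (f τ)) :
    UpperHalfPlane.IsBoundedAtImInfty f := by
  rw [UpperHalfPlane.isBoundedAtImInfty_iff]
  refine ⟨∑' j, ‖c j * e (x j * UpperHalfPlane.I)‖, 1, fun τ hτ ↦ ?_⟩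
  rw [← (hf τ).tsum_eq]
  refine tsum_of_norm_bounded (hf UpperHalfPlane.I).summable.norm.hasSum fun j ↦
    norm_mul_e_le (hx j) ?_
  simpa using hτ

/-- Summing the double series first over `j` isolates the coefficient of each `v r`; the inner
series converge since `v r` can be divided out. -/
theorem hasSum_of_hasSum_prod {X J : Type*} {u : X → J → ℂ} {v : X → ℂ} {s : ℂ}
    (hv : ∀ r, v r ≠ 0) (h : HasSum (fun p : J × X ↦ u p.2 p.1 * v p.2) s) :
    (∀ r, Summable (u r)) ∧ HasSum (fun r ↦ (∑' j, u r j) * v r) s := by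
  have hswap : HasSum (fun p : X × J ↦ u p.1 p.2 * v p.1) s := by
    rw [← (Equiv.prodComm J X).hasSum_iff]
    exact h
  have hr : ∀ r, Summable (u r) := fun r ↦ by
    have := hswap.summable.comp_injective (i := fun j : J ↦ (r, j))
      fun j j' h ↦ (Prod.ext_iff.1 h).2
    exact (summable_mul_right_iff (hv r)).1 this
  exact ⟨hr, hswap.prod_fiberwise fun r ↦ (hr r).hasSum.mul_right _⟩

/-! ### Theta expansions of Jacobi forms -/

section Lattice

variable {L : Type*} [AddCommGroup L] {β : LinearMap.BilinForm ℤ L}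

theorem jacobiSlash_mul_fun (k n : ℤ) (α : Mp2Z) (f : ℍ → ℂ) (φ : ℍ → (ℂ ⊗[ℤ] L) → ℂ) :
    jacobiSlash β k α (fun τ z ↦ f τ * φ τ z) =
      fun τ z ↦ slash (k - n) α f τ * jacobiSlash β n α φ τ z := by
  funext τ z
  have h : α.root τ ^ (-k) = α.root τ ^ (-(k - n)) * α.root τ ^ (-n) := by
    rw [← zpow_add₀ (α.root_ne_zero τ)]
    congr 1
    ring
  simp only [jacobiSlash, slash, h]
  ring

theorem jacobiSlash_sum {ι : Type*} (s : Finset ι) (k : ℤ) (α : Mp2Z)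
    (φ : ι → ℍ → (ℂ ⊗[ℤ] L) → ℂ) :
    jacobiSlash β k α (fun τ z ↦ ∑ i ∈ s, φ i τ z) =
      fun τ z ↦ ∑ i ∈ s, jacobiSlash β k α (φ i) τ z := by
  funext τ z
  simp only [jacobiSlash, Finset.sum_mul]

variable [Module.Free ℤ L] [Module.Finite ℤ L]

namespace OrthFrame

theorem basicTheta_sum (F : OrthFrame β) (hsymm : β.IsSymm) {ι : Type*} [Fintype ι]
    (lam : ι → W β) (c : ι → ℂ) (τ : ℍ) (z : ℂ ⊗[ℤ] L) :
    basicTheta β (∑ i, c i • lam i : W β) τ z = ∑ i, c i * basicTheta β (lam i) τ z := by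
  rw [← F.thetaLin_apply hsymm, map_sum]
  simp only [map_smul, Finset.sum_apply, Pi.smul_apply, smul_eq_mul]
  rfl

/-- The basic theta functions of a basis are linearly independent as functions of `z` for each
single `τ`. -/
theorem coeff_unique (F : OrthFrame β) (hsymm : β.IsSymm) {ι : Type*} [Fintype ι]
    (lam : Module.Basis ι ℂ (W β)) (τ : ℍ) {a b : ι → ℂ}
    (h : ∀ z, ∑ i, a i * basicTheta β (lam i) τ z = ∑ i, b i * basicTheta β (lam i) τ z) :
    a = b := by
  have h1 : (∑ i, a i • lam i : W β) = ∑ i, b i • lam i :=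
    Subtype.ext (F.eq_of_basicTheta_eq hsymm (Subtype.property _) (Subtype.property _) τ
      fun z ↦ by rw [F.basicTheta_sum hsymm, F.basicTheta_sum hsymm, h])
  have h2 := congrArg (fun w ↦ (lam.repr w : ι → ℂ)) h1
  simpa only [lam.repr_sum_self] using h2

/-- The coefficients of the theta expansion as series in `q`. -/
theorem exists_theta_coeff (F : OrthFrame β) (hsymm : β.IsSymm) {h : ℤ}
    {φ : ℍ → (ℂ ⊗[ℤ] L) → ℂ} (hexp : HasJacobiExpansion β h φ) (hqp : IsQuasiPeriodic β φ) :
    ∃ G : ℍ → W β, (∀ τ z, φ τ z = basicTheta β (G τ) τ z) ∧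
      ∀ r, MDifferentiable 𝓘(ℂ) 𝓘(ℂ) (fun τ ↦ (G τ : shadow β → ℂ) r) ∧
        UpperHalfPlane.IsBoundedAtImInfty fun τ ↦ (G τ : shadow β → ℂ) r := by
  obtain ⟨c, hc, hsum⟩ := hexp
  -- The exponent `m - β(r)` left after splitting off the theta term; it is non-negative wherever
  -- the coefficient is nonzero.
  obtain ⟨x, hx⟩ : ∃ x : shadow β → ℤ → ℚ, ∀ r j,
      x r j = (h : ℚ) / 24 + j - β.baseChange ℚ (r : ℚ ⊗[ℤ] L) r / 2 := ⟨_, fun _ _ ↦ rfl⟩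
  have hterm : ∀ (τ : ℍ) z (r : shadow β) j, (c j r * e (x r j * τ)) *
      e (((β.baseChange ℚ (r : ℚ ⊗[ℤ] L) r / 2 : ℚ) : ℂ) * τ +
        β.baseChange ℂ (ratToComplex (r : ℚ ⊗[ℤ] L)) z) =
      c j r * e (((h : ℂ) / 24 + j) * τ +
        β.baseChange ℂ (ratToComplex (r : ℚ ⊗[ℤ] L)) z) := fun τ z r j ↦ by
    rw [mul_assoc, ← e_add, hx]
    congr 2
    push_cast
    ring
  have key : ∀ (τ : ℍ) (z : ℂ ⊗[ℤ] L), (∀ r, Summable fun j ↦ c j r * e (x r j * τ)) ∧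
      HasSum (fun r : shadow β ↦ (∑' j, c j r * e (x r j * τ)) *
        e (((β.baseChange ℚ (r : ℚ ⊗[ℤ] L) r / 2 : ℚ) : ℂ) * τ +
          β.baseChange ℂ (ratToComplex (r : ℚ ⊗[ℤ] L)) z)) (φ τ z) := fun τ z ↦ by
    refine hasSum_of_hasSum_prod (u := fun r j ↦ c j r * e (x r j * τ))
      (v := fun r : shadow β ↦ e (((β.baseChange ℚ (r : ℚ ⊗[ℤ] L) r / 2 : ℚ) : ℂ) * τ +
          β.baseChange ℂ (ratToComplex (r : ℚ ⊗[ℤ] L)) z)) (fun _ ↦ e_ne_zero _) ?_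
    simp only [hterm]
    exact hsum τ z
  -- For fixed `τ` the collected coefficients are those of a quasi-periodic theta series, hence lie
  -- in `W(L)`.
  have hW : ∀ τ : ℍ, (fun r ↦ ∑' j, c j r * e (x r j * τ)) ∈ W β := fun τ ↦ by
    obtain ⟨lam, hlam, h1⟩ := F.exists_mem_W hsymm
      (fun z ↦ (F.hasSum_shadow_iff hsymm _ τ z _).1 (key τ z).2) fun x y z ↦ hqp x y τ z
    rwa [F.extend_injective h1]
  have hneg : ∀ r j, x r j < 0 → c j r = 0 := fun r j hj ↦ hc j r (by rw [hx] at hj; linarith)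
  refine ⟨fun τ ↦ ⟨_, hW τ⟩, fun τ z ↦ ?_, fun r ↦ ⟨?_, ?_⟩⟩
  · exact (key τ z).2.tsum_eq.symm
  · exact mdifferentiable_of_hasSum (hneg r) fun τ ↦ ((key τ 0).1 r).hasSum
  · exact isBoundedAtImInfty_of_hasSum (hneg r) fun τ ↦ ((key τ 0).1 r).hasSum

end OrthFrame

end Lattice

/-! ### Existence of theta expansions with modular coefficients. -/

theorem eps_Z : (eps Mp2Z.Z : ℂ) = -1 := by
  change etaQuotient Mp2Z.Z UpperHalfPlane.I = -1
  have := eta_ne_zero UpperHalfPlane.I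
  simp only [etaQuotient, Mp2Z.Z_mat, one_smul, Mp2Z.Z_root]
  field_simp

theorem eps_pow_24 (α : Mp2Z) : eps α ^ 24 = 1 := by
  ext
  rw [Units.val_pow_eq_pow_val]
  exact etaQuotient_pow α UpperHalfPlane.I

/-- `ε^h(T^N) = ε(T)^{hN}` is `1` because `ε²⁴ = 1`, and kernels are normal. This is where the
condition on `24/gcd(h, 24)` enters. -/
theorem eps_zpow_normalClosure {h : ℤ} {N : ℕ} (hN : (24 : ℤ) ∣ h * N) {δ : Mp2Z}
    (hδ : δ ∈ Subgroup.normalClosure {Mp2Z.T ^ N}) : (eps ^ h) δ = 1 := by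
  refine Subgroup.normalClosure_le_normal (N := (eps ^ h).ker) (Set.singleton_subset_iff.2 ?_) hδ
  obtain ⟨t, ht⟩ := hN
  change (eps (Mp2Z.T ^ N)) ^ h = 1
  rw [map_pow, ← zpow_natCast, ← zpow_mul, mul_comm, ht, zpow_mul]
  have := eps_pow_24 Mp2Z.T
  rw [show (24 : ℤ) = ((24 : ℕ) : ℤ) by norm_num, zpow_natCast, this, one_zpow]

theorem zpow_eq_of_sq_eq_one {u : ℂ} (hu : u ^ 2 = 1) {a b : ℤ} (hab : Even (a - b)) :
    u ^ a = u ^ b := by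
  have hu0 : u ≠ 0 := fun h ↦ by simp [h] at hu
  obtain ⟨t, ht⟩ := hab
  rw [show a = 2 * t + b by omega, zpow_add₀ hu0, zpow_mul]
  norm_cast
  rw [hu]
  simp

section Lattice

variable {L : Type*} [AddCommGroup L] {β : LinearMap.BilinForm ℤ L}

/-- `Z` acts by `(-1)^k`, while `ε^h(Z) = (-1)^h`. -/
theorem eq_zero_of_mem_jacobiForms {k h : ℤ} (hkh : ¬Even (k - h)) {φ : ℍ → (ℂ ⊗[ℤ] L) → ℂ}
    (hφ : φ ∈ jacobiForms β k h) : φ = 0 := by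
  funext τ z
  have h1 := hφ.2.1 Mp2Z.Z τ z
  have h2 : ((eps ^ h) Mp2Z.Z : ℂ) = (-1) ^ h := by
    rw [← eps_Z]
    simp
  have h3 : jacobiSlash β k Mp2Z.Z φ τ z = (-1) ^ k * φ τ z := by
    simp only [jacobiSlash, Mp2Z.Z_mat, Mp2Z.Z_root, one_smul, aut_one, inv_one]
    simp [e_zero, mul_comm, ← inv_zpow]
  rw [h2, h3] at h1
  have h4 : ((-1 : ℂ)) ^ k = - (-1) ^ h := by
    rcases Int.even_or_odd k with hk | hk <;> rcases Int.even_or_odd h with hh | hh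
    · exact absurd (hk.sub hh) hkh
    · rw [hk.neg_one_zpow, hh.neg_one_zpow, neg_neg]
    · rw [hk.neg_one_zpow, hh.neg_one_zpow]
    · exact absurd (hk.sub_odd hh) hkh
  have h5 : ((-1 : ℂ)) ^ h ≠ 0 := zpow_ne_zero _ (by norm_num)
  rw [h4] at h1
  have h6 : (-1 : ℂ) ^ h * φ τ z = 0 := by linear_combination (-1 / 2 : ℂ) * h1
  simpa [h5] using h6

variable [Module.Free ℤ L] [Module.Finite ℤ L]

namespace OrthFrame

/-- Replacing `z` by `(cτ+d)z` and cancelling the automorphy factors reduces this to independence at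
the point `Aτ`. -/
theorem coeff_unique_jacobiSlash (F : OrthFrame β) (hsymm : β.IsSymm) {ι : Type*} [Fintype ι]
    (lam : Module.Basis ι ℂ (W β)) (n : ℤ) (α : Mp2Z) (τ : ℍ) {a b : ι → ℂ}
    (h : ∀ z, ∑ i, a i * jacobiSlash β n α (basicTheta β (lam i)) τ z =
      ∑ i, b i * jacobiSlash β n α (basicTheta β (lam i)) τ z) : a = b := by
  refine F.coeff_unique hsymm lam (α.mat • τ) fun z ↦ ?_
  have h1 := h (aut α.mat τ • z)
  simp only [jacobiSlash, inv_smul_smul₀ (aut_ne_zero α.mat τ), ← mul_assoc,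
    ← Finset.sum_mul] at h1
  exact mul_right_cancel₀ (e_ne_zero _)
    (mul_right_cancel₀ (zpow_ne_zero _ (α.root_ne_zero τ)) h1)

theorem exists_theta_expansion (F : OrthFrame β) (hsymm : β.IsSymm) {k h : ℤ} {N : ℕ}
    (hNq : ∀ r ∈ shadow β, ∃ m : ℤ, (N : ℚ) * (β.baseChange ℚ r r / 2) = m)
    (h24 : (24 : ℤ) ∣ h * N) (h4 : Even (k - Module.finrank ℤ L) ∨ 4 ∣ N)
    {φ : ℍ → (ℂ ⊗[ℤ] L) → ℂ} (hφ : φ ∈ jacobiForms β k h) {ι : Type*} [Fintype ι]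
    (lam : Module.Basis ι ℂ (W β)) :
    ∃ f : ι → ℍ → ℂ, (∀ i, f i ∈ modularFormsLevel (k - Module.finrank ℤ L) N) ∧
      ∀ τ z, φ τ z = ∑ i, f i τ * basicTheta β (lam i) τ z := by
  obtain ⟨G, hG, hGr⟩ := F.exists_theta_coeff hsymm hφ.2.2.2 hφ.2.2.1
  obtain ⟨f, hf⟩ : ∃ f : ι → ℍ → ℂ, ∀ i τ, f i τ = lam.repr (G τ) i := ⟨_, fun _ _ ↦ rfl⟩
  have hsum : ∀ τ z, φ τ z = ∑ i, f i τ * basicTheta β (lam i) τ z := fun τ z ↦ by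
    rw [hG, ← F.basicTheta_sum hsymm]
    simp only [hf, lam.sum_repr]
  have hext : ∀ t, MDifferentiable 𝓘(ℂ) 𝓘(ℂ) (fun τ ↦ F.extend (G τ) t) ∧
      UpperHalfPlane.IsBoundedAtImInfty fun τ ↦ F.extend (G τ) t := fun t ↦ by
    by_cases ht : F.point t ∈ shadow β
    · simp only [F.extend_of_mem _ ht]
      exact hGr _
    · simp only [F.extend_of_notMem _ ht]
      exact ⟨mdifferentiable_const, Filter.const_boundedAtFilter _ (0 : ℂ)⟩
  -- Coordinates in the basis are combinations of finitely many evaluations, so they inherit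
  -- holomorphy and boundedness at infinity.
  have hbase : ∀ i, MDifferentiable 𝓘(ℂ) 𝓘(ℂ) (f i) ∧
      UpperHalfPlane.IsBoundedAtImInfty (f i) := fun i ↦ by
    obtain ⟨b, hb⟩ := F.exists_eq_sum_extend (lam.coord i)
    have hfi : f i = fun τ ↦ ∑ t : F.residues, b t * F.extend (G τ) t := by
      funext τ
      rw [hf, ← hb]
      rfl
    rw [hfi]
    constructor
    · have h1 := fun t ↦ (hext t).1
      simp only [UpperHalfPlane.mdifferentiable_iff] at h1 ⊢
      exact DifferentiableOn.fun_sum fun t _ ↦ (h1 t).const_mul (b t)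
    · have : (fun τ ↦ ∑ t : F.residues, b t * F.extend (G τ) t) =
          ∑ t : F.residues, b t • fun τ ↦ F.extend (G τ) t := by
        funext τ
        simp
      rw [this]
      exact Finset.sum_induction _ UpperHalfPlane.IsBoundedAtImInfty (fun _ _ ha hb ↦ ha.add hb)
        (Filter.const_boundedAtFilter _ (0 : ℂ)) fun t _ ↦ (hext t).2.smul (b t)
  have hslash : ∀ (α : Mp2Z) τ z, ((eps ^ h) α : ℂ) * φ τ z =
      ∑ i, slash (k - Module.finrank ℤ L) α (f i) τ *
        jacobiSlash β (Module.finrank ℤ L) α (basicTheta β (lam i)) τ z := fun α τ z ↦ by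
    have h1 : φ = fun τ z ↦ ∑ i, f i τ * basicTheta β (lam i) τ z := funext₂ hsum
    rw [← hφ.2.1 α τ z, h1, jacobiSlash_sum]
    simp only [jacobiSlash_mul_fun k (Module.finrank ℤ L)]
  refine ⟨f, fun i ↦ ⟨(hbase i).1, fun γ hγ τ ↦ ?_, fun α ↦ ?_⟩, hsum⟩
  · by_cases hkh : Even (k - h)
    · obtain ⟨δ, hδ, γ', hγ', rfl⟩ := Mp2Z.exists_normalClosure_mul_Gamma hγ F.thetaLevel_pos
      have hγ24 := Gamma_le_of_dvd (Dvd.intro _ rfl : 24 ∣ F.thetaLevel) hγ'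
      have hu := eps_sq_eq_one hγ24
      have hu0 : (eps γ' : ℂ) ≠ 0 := (eps γ').ne_zero
      have hact : ∀ i, jacobiSlash β (Module.finrank ℤ L) (δ * γ') (basicTheta β (lam i)) =
          (eps γ' : ℂ) ^ Module.finrank ℤ L • basicTheta β (lam i) := fun i ↦
        F.jacobiSlash_mul_of_mem_Gamma hsymm hNq hδ hγ'
          (Submodule.subset_span ⟨_, (lam i).2, rfl⟩)
      have heps : ((eps ^ h) (δ * γ') : ℂ) = (eps γ' : ℂ) ^ h := by
        rw [map_mul, eps_zpow_normalClosure h24 hδ, one_mul]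
        simp
      have h1 := F.coeff_unique hsymm lam τ
        (a := fun i ↦ (eps γ' : ℂ) ^ h * f i τ)
        (b := fun i ↦ slash (k - Module.finrank ℤ L) (δ * γ') (f i) τ *
          (eps γ' : ℂ) ^ Module.finrank ℤ L) fun z ↦ by
          have := hslash (δ * γ') τ z
          rw [heps, hsum, Finset.mul_sum] at this
          simp only [hact, Pi.smul_apply, smul_eq_mul] at this
          simpa only [mul_assoc] using this
      have h2 := congrFun h1 i
      -- Put `u = ε(γ')`, so `u² = 1`. Comparing coefficients gives `uⁿ (f|γ) = u^h f`, and `u^h =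
      -- u^k` since `k - h` is even. So the required multiplier is `u^{k-n}`, which is `1` or a
      -- power of the theta multiplier according to the parity of `k - n`.
      have hmult : multiplier (k - Module.finrank ℤ L) (δ * γ') τ =
          (eps γ' : ℂ) ^ (k - Module.finrank ℤ L : ℤ) := by
        rw [multiplier]
        split_ifs with hm
        · rw [zpow_eq_of_sq_eq_one hu (b := 0) (by simpa using hm), zpow_zero]
        · rw [kappa_mul_eq_eps (h4.resolve_left hm) hδ hγ24]
      rw [hmult, zpow_sub₀ hu0, zpow_natCast, zpow_eq_of_sq_eq_one hu hkh]
      field_simp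
      linear_combination -h2
    · have h0 : f i = 0 := by
        funext τ
        have h1 := F.coeff_unique hsymm lam τ (a := fun i ↦ f i τ) (b := 0) fun z ↦ by
          rw [← hsum, eq_zero_of_mem_jacobiForms hkh hφ]
          simp
        exact congrFun h1 i
      simp [h0, slash]
  -- For the other cusps: `α` permutes `Θ(L)` linearly, so each `f i | α` is a constant combination
  -- of the `f j`, all bounded at infinity.
  · have hmem : ∀ j, ∃ w : W β, jacobiSlash β (Module.finrank ℤ L) α⁻¹ (basicTheta β (lam j)) =
        basicTheta β w := fun j ↦ by
      have := F.jacobiSlash_mem_thetaSpace hsymm α⁻¹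
        (Submodule.subset_span ⟨_, (lam j).2, rfl⟩ : basicTheta β (lam j) ∈ thetaSpace β)
      rw [F.thetaSpace_eq_range hsymm] at this
      obtain ⟨w, hw⟩ := this
      exact ⟨w, hw.symm⟩
    choose w hw using hmem
    have hD : ∀ j τ z, basicTheta β (lam j) τ z = ∑ i, lam.repr (w j) i *
        jacobiSlash β (Module.finrank ℤ L) α (basicTheta β (lam i)) τ z := fun j τ z ↦ by
      have h1 : basicTheta β (lam j) = jacobiSlash β (Module.finrank ℤ L) α
          (fun τ z ↦ ∑ i, lam.repr (w j) i * basicTheta β (lam i) τ z) := by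
        have h2 : (fun τ z ↦ ∑ i, lam.repr (w j) i * basicTheta β (lam i) τ z) =
            basicTheta β (w j) := by
          funext τ z
          rw [← F.basicTheta_sum hsymm, lam.sum_repr]
        rw [h2, ← hw, ← jacobiSlash_mul, inv_mul_cancel]
        funext τ z
        simp [jacobiSlash, aut_one, e_zero]
      rw [h1, jacobiSlash_sum]
      refine Finset.sum_congr rfl fun i _ ↦ ?_
      simp only [jacobiSlash]
      ring
    have key : slash (k - Module.finrank ℤ L) α (f i) =
        ∑ j, (((eps ^ h) α : ℂ) * lam.repr (w j) i) • f j := by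
      funext τ
      refine (congrFun (F.coeff_unique_jacobiSlash hsymm lam (Module.finrank ℤ L) α τ
        (a := fun i ↦ slash (k - Module.finrank ℤ L) α (f i) τ)
        (b := fun i ↦ ∑ j, ((eps ^ h) α : ℂ) * lam.repr (w j) i * f j τ) fun z ↦ ?_) i).trans
        (by simp [Finset.sum_apply])
      rw [← hslash, hsum, Finset.mul_sum]
      simp only [Finset.sum_mul]
      rw [Finset.sum_comm]
      refine Finset.sum_congr rfl fun j _ ↦ ?_
      rw [hD j, Finset.mul_sum, Finset.mul_sum]
      exact Finset.sum_congr rfl fun i _ ↦ by ring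
    rw [key]
    exact Finset.sum_induction _ UpperHalfPlane.IsBoundedAtImInfty (fun _ _ ha hb ↦ ha.add hb)
      (Filter.const_boundedAtFilter _ (0 : ℂ)) fun j _ ↦ (hbase j).2.smul _

end OrthFrame

end Lattice

/-! ### Fourier expansions of modular forms -/

/-- On the line `τ = Nu + i` with `u` real, this is the uniqueness of Fourier series on the circle,
the coefficients being extended by zero to negative indices. -/
theorem coeff_eq_zero_of_hasSum {N : ℕ} (hN : 0 < N) {d : ℕ → ℂ}
    (h : ∀ τ : ℍ, HasSum (fun n : ℕ ↦ d n * e ((n : ℂ) / N * τ)) 0) : d = 0 := by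
  have hN' : (N : ℂ) ≠ 0 := by exact_mod_cast hN.ne'
  have hinj : Function.Injective fun (n : ℕ) (_ : Unit) ↦ (n : ℤ) := fun n n' hn ↦ by
    have := congrFun hn ()
    simpa using this
  have key := eq_zero_of_hasSum_fourier (ι := Unit) (d := fun κ ↦
    if 0 ≤ κ () then d (κ ()).toNat * e ((κ () : ℂ) / N * Complex.I) else 0) fun u ↦ by
      rw [← hinj.hasSum_iff]
      · let τ : ℍ := ⟨N * u () + Complex.I, by simp⟩
        refine (h τ).congr_fun fun n ↦ ?_
        have hτ : (τ : ℂ) = N * u () + Complex.I := rfl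
        simp only [Function.comp_apply, Nat.cast_nonneg, if_true, Int.toNat_natCast, hτ,
          Finset.univ_unique, Finset.sum_singleton, mul_assoc]
        rw [← e_add]
        congr 2
        push_cast
        field_simp
        simp only [PUnit.default_eq_unit]
        ring
      · intro κ hκ
        rw [if_neg, zero_mul]
        intro h0
        exact hκ ⟨(κ ()).toNat, funext fun _ ↦ Int.toNat_of_nonneg h0⟩
  funext n
  have := congrFun key fun _ ↦ (n : ℤ)
  simpa [e_ne_zero] using this

/-- `5² ≡ (-1)² mod 24`, so both theta functions in `η` acquire the factor `e(1/24)` under `T`. -/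
theorem eps_T : (eps Mp2Z.T : ℂ) = e (1 / 24) := by
  change etaQuotient Mp2Z.T UpperHalfPlane.I = _
  have key : ∀ s : ℤ, th 6 s (ModularGroup.T • UpperHalfPlane.I) 0 =
      e ((s : ℂ) ^ 2 / 24) * th 6 s UpperHalfPlane.I 0 := fun s ↦ by
    have h := congrFun (congrFun (halfSlash_T_th (a := 6) (by norm_num) s) UpperHalfPlane.I) 0
    simp only [halfSlash_apply, Pi.smul_apply, smul_eq_mul, mul_zero, ne_eq, OfNat.ofNat_ne_zero,
      not_false_eq_true, zero_pow, zero_div, e_zero, mul_one, Mp2Z.T_root, inv_one,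
      Mp2Z.T_mat] at h
    rw [h]
    norm_num
  have h1 : e ((5 : ℂ) ^ 2 / 24) = e (1 / 24) := e_eq_of_sub_eq_int 1 (by norm_num)
  have h2 := key 5
  have h3 := key (-1)
  push_cast at h2 h3
  rw [h1] at h2
  rw [etaQuotient, div_eq_iff (mul_ne_zero (eta_ne_zero _) (Mp2Z.root_ne_zero _ _)), eta_eq_th,
    eta_eq_th, Mp2Z.T_mat, Mp2Z.T_root, h2, h3]
  norm_num
  ring

theorem smul_T_pow_of_mem_modularFormsLevel {m : ℤ} {N : ℕ} (hN : Even m ∨ 4 ∣ N) {f : ℍ → ℂ}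
    (hf : f ∈ modularFormsLevel m N) (τ : ℍ) : f (ModularGroup.T ^ N • τ) = f τ := by
  have hmem : (Mp2Z.T ^ N).mat ∈ CongruenceSubgroup.Gamma N := by
    rw [Mp2Z.T_pow_mat]
    simpa using CongruenceSubgroup.ModularGroup_T_pow_mem_Gamma N N dvd_rfl
  have h1 := hf.2.1 _ hmem τ
  have h2 : multiplier m (Mp2Z.T ^ N) τ = 1 := by
    rw [multiplier]
    split_ifs with hm
    · rfl
    · rw [kappa_eq_scalar (c := 1), one_zpow]
      rw [halfSlash_normalClosure (hN.resolve_left hm)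
        (Subgroup.subset_normalClosure (Set.mem_singleton _)), one_smul]
  rw [h2] at h1
  simpa [slash] using h1

theorem exists_hasSum_of_mem_modularFormsLevel {m : ℤ} {N : ℕ} (hN0 : 0 < N)
    (hN : Even m ∨ 4 ∣ N) {f : ℍ → ℂ} (hf : f ∈ modularFormsLevel m N) :
    ∃ a : ℕ → ℂ, ∀ τ : ℍ, HasSum (fun n : ℕ ↦ a n * e ((n : ℂ) / N * τ)) (f τ) := by
  have hper : Function.Periodic (f ∘ UpperHalfPlane.ofComplex) ((N : ℝ) : ℂ) := fun w ↦ by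
    have him : (w + ((N : ℝ) : ℂ)).im = w.im := by simp
    rcases lt_or_ge 0 w.im with hw | hw
    · have h1 := smul_T_pow_of_mem_modularFormsLevel hN hf ⟨w, hw⟩
      rw [Function.comp_apply, Function.comp_apply,
        UpperHalfPlane.ofComplex_apply_of_im_pos (him ▸ hw : 0 < (w + ((N : ℝ) : ℂ)).im),
        UpperHalfPlane.ofComplex_apply_of_im_pos hw, ← h1]
      congr 1
      apply UpperHalfPlane.ext
      rw [coe_T_pow_smul]
      simp
    · rw [Function.comp_apply, Function.comp_apply,
        UpperHalfPlane.ofComplex_apply_eq_of_im_nonpos (him ▸ hw) hw]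
  have hbdd : UpperHalfPlane.IsBoundedAtImInfty f := by
    have := hf.2.2 1
    have h1 : slash m 1 f = f := by
      funext τ
      simp [slash]
    rwa [h1] at this
  refine ⟨fun n ↦ (UpperHalfPlane.qExpansion N f).coeff n, fun τ ↦ ?_⟩
  refine (UpperHalfPlane.hasSum_qExpansion (by exact_mod_cast hN0) hper hf.1 hbdd τ).congr_fun
    fun n ↦ ?_
  rw [smul_eq_mul]
  congr 1
  rw [Function.Periodic.qParam, ← Complex.exp_nat_mul, e]
  congr 1
  push_cast
  ring

/-- Collecting the terms of a series by the exponent of `q`. -/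
theorem exists_coeff_of_exponent {X : Type*} {b : X → ℕ → ℂ} {q : X → ℚ} {N : ℕ} (hN : 0 < N)
    {s : ℚ} (hb : ∀ r n, b r n ≠ 0 → ∃ j : ℤ, (n : ℚ) / N + q r = s + j) :
    ∃ c : ℤ → X → ℂ, (∀ (j : ℤ) r, s + j < q r → c j r = 0) ∧ ∀ (v : ℚ → X → ℂ) (S : ℂ),
      HasSum (fun p : ℕ × X ↦ b p.2 p.1 * v ((p.1 : ℚ) / N + q p.2) p.2) S →
      HasSum (fun p : ℤ × X ↦ c p.1 p.2 * v (s + p.1) p.2) S := by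
  classical
  have hN' : (0 : ℚ) < N := by exact_mod_cast hN
  have huniq : ∀ (j : ℤ) (r : X) (n n' : ℕ), (n : ℚ) / N + q r = s + j →
      (n' : ℚ) / N + q r = s + j → n = n' := fun j r n n' h h' ↦ by
    have h1 : (n : ℚ) / N = n' / N := by linarith
    rw [div_left_inj' hN'.ne'] at h1
    exact_mod_cast h1
  -- For given `r` and `j` at most one `n` satisfies `n/N + q(r) = s + j`, so re-indexing by `j`
  -- only renames the nonzero terms.
  let c : ℤ → X → ℂ := fun j r ↦
    if h : ∃ n : ℕ, (n : ℚ) / N + q r = s + j then b r h.choose else 0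
  have hc : ∀ (j : ℤ) r (n : ℕ), (n : ℚ) / N + q r = s + j → c j r = b r n := fun j r n h ↦ by
    have h1 : ∃ n : ℕ, (n : ℚ) / N + q r = s + j := ⟨n, h⟩
    simp only [c, dif_pos h1]
    rw [huniq j r _ n h1.choose_spec h]
  refine ⟨c, fun j r hj ↦ dif_neg ?_, fun v S hS ↦ ?_⟩
  · rintro ⟨n, hn⟩
    have : (0 : ℚ) ≤ (n : ℚ) / N := by positivity
    linarith
  · choose! J hJ using hb
    have hb' : ∀ p : Function.support fun p : ℕ × X ↦ b p.2 p.1 * v ((p.1 : ℚ) / N + q p.2) p.2,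
        (p.1.1 : ℚ) / N + q p.1.2 = s + J p.1.2 p.1.1 := fun p ↦
      hJ _ _ (left_ne_zero_of_mul (Function.mem_support.1 p.2))
    refine (hasSum_iff_hasSum_of_ne_zero_bij (fun p ↦ (J p.1.2 p.1.1, p.1.2)) ?_ ?_ ?_).2 hS
    · rintro p p' h
      simp only [Prod.mk.injEq] at h
      have h1 := hb' p
      have h2 := hb' p'
      rw [← h.1, ← h.2] at h2
      exact Subtype.ext (Prod.ext (huniq _ _ _ _ h1 h2) h.2)
    · rintro ⟨j, r⟩ h
      have h0 : c j r ≠ 0 := left_ne_zero_of_mul (Function.mem_support.1 h)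
      have h1 : ∃ n : ℕ, (n : ℚ) / N + q r = s + j := by
        by_contra h1
        exact h0 (dif_neg h1)
      obtain ⟨n, hn⟩ := h1
      have h2 := hc j r n hn
      have h3 : (n, r) ∈ Function.support
          fun p : ℕ × X ↦ b p.2 p.1 * v ((p.1 : ℚ) / N + q p.2) p.2 := by
        rw [Function.mem_support] at h ⊢
        simp only at h ⊢
        rwa [hn, ← h2]
      refine ⟨⟨_, h3⟩, Prod.ext ?_ rfl⟩
      have h4 := hb' ⟨_, h3⟩
      simp only at h4 ⊢
      rw [hn] at h4
      have : (j : ℚ) = J r n := by linarith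
      exact_mod_cast this.symm
    · intro p
      have h1 := hb' p
      simp only
      rw [hc _ _ _ h1, h1]

theorem exists_common_level {ι : Type*} [Fintype ι] {m : ℤ} {f : ι → ℍ → ℂ}
    (hf : ∀ i, f i ∈ modularForms m) :
    ∃ N : ℕ, 0 < N ∧ 4 ∣ N ∧ ∀ i, f i ∈ modularFormsLevel m N := by
  choose N hN0 _ hfN using hf
  exact ⟨4 * ∏ i, N i, Nat.mul_pos (by norm_num) (Finset.prod_pos fun i _ ↦ hN0 i),
    Dvd.intro _ rfl, fun i ↦ modularFormsLevel_mono m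
      ((Finset.dvd_prod_of_mem N (Finset.mem_univ i)).mul_left 4) (hfN i)⟩

/-! ### Jacobi forms from combinations of modular forms and theta functions. -/

section Lattice

variable {L : Type*} [AddCommGroup L] [Module.Free ℤ L] [Module.Finite ℤ L]
  {β : LinearMap.BilinForm ℤ L}

namespace OrthFrame

/-- Multiply the `q`-expansions of the `f i` into the theta series. Exponents of `f i` are `n/N ≥
0`, which gives `m ≥ β(r)`; the behaviour under `T` puts `m = n/N + β(r)` into `h/24 + ℤ`. -/
theorem hasJacobiExpansion (F : OrthFrame β) (hsymm : β.IsSymm) {m h : ℤ} {ι : Type*} [Fintype ι]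
    (lam : ι → W β) {f : ι → ℍ → ℂ} (hf : ∀ i, f i ∈ modularForms m)
    (hT : ∀ τ z, ∑ i, f i (ModularGroup.T • τ) * basicTheta β (lam i) (ModularGroup.T • τ) z =
      e ((h : ℂ) / 24) * ∑ i, f i τ * basicTheta β (lam i) τ z) :
    HasJacobiExpansion β h fun τ z ↦ ∑ i, f i τ * basicTheta β (lam i) τ z := by
  obtain ⟨N, hN0, hN4, hfN⟩ := exists_common_level hf
  choose a ha using fun i ↦ exists_hasSum_of_mem_modularFormsLevel hN0 (Or.inr hN4) (hfN i)
  have hN' : (N : ℂ) ≠ 0 := by exact_mod_cast hN0.ne'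
  let q : shadow β → ℚ := fun r ↦ β.baseChange ℚ (r : ℚ ⊗[ℤ] L) r / 2
  let b : shadow β → ℕ → ℂ := fun r n ↦ ∑ i, a i n * (lam i : shadow β → ℂ) r
  let G : ℍ → W β := fun τ ↦ ∑ i, f i τ • lam i
  have hGφ : ∀ τ z, basicTheta β (G τ) τ z = ∑ i, f i τ * basicTheta β (lam i) τ z := fun τ z ↦
    F.basicTheta_sum hsymm lam (fun i ↦ f i τ) τ z
  have hG : ∀ r τ, (G τ : shadow β → ℂ) r = ∑ i, f i τ * (lam i : shadow β → ℂ) r := fun r τ ↦ by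
    simp [G]
  have hGsum : ∀ r (τ : ℍ), HasSum (fun n : ℕ ↦ b r n * e ((n : ℂ) / N * τ))
      ((G τ : shadow β → ℂ) r) := fun r τ ↦ by
    rw [hG]
    refine (hasSum_sum fun i _ ↦ (ha i τ).mul_right ((lam i : shadow β → ℂ) r)).congr_fun
      fun n ↦ ?_
    simp only [b, Finset.sum_mul]
    exact Finset.sum_congr rfl fun i _ ↦ by ring
  -- Under `T` the theta term of `r` gains `e(β(r))`; uniqueness of Fourier coefficients in `z`
  -- isolates the component at `r`.
  have hGT : ∀ r τ, (G (ModularGroup.T • τ) : shadow β → ℂ) r * e (q r) =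
      e ((h : ℂ) / 24) * (G τ : shadow β → ℂ) r := fun r τ ↦ by
    have h1 : ∀ z, HasSum (fun κ ↦ (F.extend (G (ModularGroup.T • τ)) κ *
        e ((β.baseChange ℚ (F.point κ) (F.point κ) / 2 : ℚ) : ℂ)) * F.term κ τ z)
        (e ((h : ℂ) / 24) * basicTheta β (G τ) τ z) := fun z ↦ by
      rw [hGφ, ← hT, ← hGφ]
      refine (F.hasTheta_basicTheta hsymm (G _).2 (ModularGroup.T • τ) z).congr_fun fun κ ↦ ?_
      rw [mul_assoc]
      congr 1
      rw [F.term_eq hsymm, F.term_eq hsymm, coe_T_smul, ← e_add]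
      congr 1
      ring
    have h2 := F.eq_of_hasSum h1 (c' := fun κ ↦ e ((h : ℂ) / 24) * F.extend (G τ) κ) fun z ↦ by
      simpa only [mul_assoc] using
        (F.hasTheta_basicTheta hsymm (G τ).2 τ z).mul_left (e ((h : ℂ) / 24))
    have h3 := congrFun h2 (F.index (r : ℚ ⊗[ℤ] L))
    simpa only [F.extend_index, F.point_index r.2] using h3
  -- Uniqueness of the `q`-expansion turns the relation under `T` into `e(n/N + β(r)) = e(h/24)`
  -- whenever the coefficient is nonzero.
  have hb : ∀ r n, b r n ≠ 0 → ∃ j : ℤ, (n : ℚ) / N + q r = (h : ℚ) / 24 + j := fun r n hbn ↦ by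
    have h1 := coeff_eq_zero_of_hasSum hN0
      (d := fun n ↦ b r n * (e ((n : ℂ) / N) * e (q r) - e ((h : ℂ) / 24))) fun τ ↦ by
        have h2 := ((hGsum r (ModularGroup.T • τ)).mul_right (e (q r))).sub
          ((hGsum r τ).mul_left (e ((h : ℂ) / 24)))
        rw [hGT, sub_self] at h2
        refine h2.congr_fun fun n ↦ ?_
        rw [coe_T_smul, mul_add, mul_one, e_add]
        ring
    have h3 := congrFun h1 n
    simp only [Pi.zero_apply, mul_eq_zero, hbn, false_or, sub_eq_zero] at h3
    have h4 : e ((n : ℂ) / N + q r - (h : ℂ) / 24) = 1 := by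
      rw [e_sub, e_add, h3, div_self (e_ne_zero _)]
    obtain ⟨j, hj⟩ := (e_eq_one_iff _).1 h4
    refine ⟨j, ?_⟩
    have h5 : (((n : ℚ) / N + q r : ℚ) : ℂ) = (((h : ℚ) / 24 + j : ℚ) : ℂ) := by
      push_cast
      linear_combination hj
    exact_mod_cast h5
  obtain ⟨c, hc, hcs⟩ := exists_coeff_of_exponent hN0 hb
  refine ⟨c, hc, fun τ z ↦ ?_⟩
  have h1 := hcs (fun x r ↦ e (x * τ + β.baseChange ℂ (ratToComplex (r : ℚ ⊗[ℤ] L)) z))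
    (∑ i, f i τ * basicTheta β (lam i) τ z) ?_
  · refine h1.congr_fun fun p ↦ ?_
    push_cast
    rfl
  · refine (hasSum_sum fun i _ ↦ hasSum_mul_prod (ha i τ)
      ((F.hasSum_shadow_iff hsymm (lam i) τ z _).2
        (F.hasTheta_basicTheta hsymm (lam i).2 τ z))).congr_fun fun p ↦ ?_
    simp only [b, Finset.sum_mul]
    refine Finset.sum_congr rfl fun i _ ↦ ?_
    have h2 : e ((((p.1 : ℚ) / N + q p.2 : ℚ) : ℂ) * τ +
        β.baseChange ℂ (ratToComplex (p.2 : ℚ ⊗[ℤ] L)) z) = e ((p.1 : ℂ) / N * τ) *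
        e (((β.baseChange ℚ (p.2 : ℚ ⊗[ℤ] L) p.2 / 2 : ℚ) : ℂ) * τ +
          β.baseChange ℂ (ratToComplex (p.2 : ℚ ⊗[ℤ] L)) z) := by
      rw [← e_add]
      congr 1
      simp only [q]
      push_cast
      ring
    rw [h2]
    ring

theorem mem_jacobiForms (F : OrthFrame β) (hsymm : β.IsSymm) {m k h : ℤ} {ι : Type*} [Fintype ι]
    (lam : ι → W β) {f : ι → ℍ → ℂ} (hf : ∀ i, f i ∈ modularForms m) {φ : ℍ → (ℂ ⊗[ℤ] L) → ℂ}
    (hφ : ∀ τ z, φ τ z = ∑ i, f i τ * basicTheta β (lam i) τ z)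
    (hinv : ∀ (α : Mp2Z) τ z, jacobiSlash β k α φ τ z = ((eps ^ h) α : ℂ) * φ τ z) :
    φ ∈ jacobiForms β k h := by
  obtain rfl : φ = fun τ z ↦ ∑ i, f i τ * basicTheta β (lam i) τ z := funext₂ hφ
  refine ⟨fun b ↦ ?_, hinv, fun x y τ z ↦ ?_, F.hasJacobiExpansion hsymm lam hf fun τ z ↦ ?_⟩
  · refine DifferentiableOn.fun_sum fun i _ ↦ DifferentiableOn.mul ?_
      (F.isHolomorphic_basicTheta hsymm (lam i).2 b)
    obtain ⟨N, -, -, h1, -⟩ := hf i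
    rw [UpperHalfPlane.mdifferentiable_iff] at h1
    exact h1.comp differentiableOn_fst fun p hp ↦ hp
  · simp only [Finset.sum_mul, Finset.mul_sum]
    refine Finset.sum_congr rfl fun i _ ↦ ?_
    have := F.isQuasiPeriodic_basicTheta hsymm (lam i).2 x y τ z
    linear_combination (f i τ) * this
  · have h1 := hinv Mp2Z.T τ z
    have h2 := jacobiSlash_T_pow (β := β) k 1
      (fun τ z ↦ ∑ i, f i τ * basicTheta β (lam i) τ z) τ z
    rw [pow_one, pow_one] at h2
    rw [h2] at h1
    refine h1.trans ?_
    congr 1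
    have : ((eps ^ h) Mp2Z.T : ℂ) = (eps Mp2Z.T : ℂ) ^ h := by simp
    rw [this, eps_T, ← e_int_mul]
    congr 1
    ring

end OrthFrame

end Lattice

section Lattice

variable {L : Type*} [AddCommGroup L] {β : LinearMap.BilinForm ℤ L}

/-! ### The multiplication map -/

/-- The weights `(k-n)/2` and `n/2` add up to `k/2`. Hence invariance of a tensor becomes the
transformation law of Jacobi forms with character `χ`. -/
theorem thetaMap_tensorRep {k n : ℤ} (M : Subrepresentation (slashRep (k - n)))
    (T : Subrepresentation (jacobiRep β n)) (χ : Mp2Z →* ℂˣ) (α : Mp2Z)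
    (x : M.toSubmodule ⊗[ℂ] (T.toSubmodule ⊗[ℂ] ℂ)) :
    thetaMap M.toSubmodule T.toSubmodule (tensorRep β M T χ α x) =
      (χ α : ℂ) • jacobiSlash β k α⁻¹ (thetaMap M.toSubmodule T.toSubmodule x) := by
  have hlin : ∀ φ, jacobiSlash β k α⁻¹ φ = jacobiRep β k α φ := fun _ ↦ rfl
  induction x using TensorProduct.induction_on with
  | zero => rw [map_zero, map_zero, hlin, map_zero, smul_zero]
  | add x y hx hy =>
    rw [hlin] at hx hy ⊢
    rw [map_add, map_add, map_add, hx, hy, map_add, smul_add]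
  | tmul f y =>
    induction y using TensorProduct.induction_on with
    | zero => rw [TensorProduct.tmul_zero, map_zero, map_zero, hlin, map_zero, smul_zero]
    | add x y hx hy =>
      rw [hlin] at hx hy ⊢
      rw [TensorProduct.tmul_add, map_add, map_add, map_add, hx, hy, map_add, smul_add]
    | tmul t c =>
      have h1 : tensorRep β M T χ α (f ⊗ₜ (t ⊗ₜ c)) =
          (M.toRepresentation α f) ⊗ₜ ((T.toRepresentation α t) ⊗ₜ ((χ α : ℂ) * c)) := by
        simp [tensorRep, Representation.tprod_apply, charRep]
      funext τ z
      rw [h1, thetaMap_tmul]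
      have h2 : thetaMap M.toSubmodule T.toSubmodule (f ⊗ₜ (t ⊗ₜ c)) = c • fun τ z ↦
          (f : ℍ → ℂ) τ * (t : ℍ → (ℂ ⊗[ℤ] L) → ℂ) τ z := by
        funext τ z
        rw [thetaMap_tmul]
        rfl
      rw [h2, hlin, map_smul, ← hlin, jacobiSlash_mul_fun k n]
      simp only [Pi.smul_apply, smul_eq_mul]
      rw [mul_assoc]
      rfl

/-! ### The level -/

/-- For `x` in `L_ev` the number `β(x)` is an integer, so the congruence defining the shadow becomes
integrality. -/
theorem shadow_subset_dualEven : shadow β ⊆ dualEven β := fun r hr x ⟨t, ht⟩ ↦ by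
  obtain ⟨m, hm⟩ := hr x
  refine ⟨m + t, ?_⟩
  rw [ht] at hm
  push_cast at hm ⊢
  linear_combination hm

theorem mul_quad_of_level_dvd {N : ℕ} (hN : 0 < N) (h : level β ∣ N) :
    ∀ r ∈ shadow β, ∃ m : ℤ, (N : ℚ) * (β.baseChange ℚ r r / 2) = m := by
  intro r hr
  -- If no positive integer qualified, `sInf` would make the level `0`, which cannot divide the
  -- positive `N`.
  have hne : {l : ℕ | 0 < l ∧ ∀ y ∈ dualEven β,
      ∃ m : ℤ, (l : ℚ) * (β.baseChange ℚ y y / 2) = m}.Nonempty := by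
    by_contra h0
    rw [Set.not_nonempty_iff_eq_empty] at h0
    rw [level, h0, Nat.sInf_empty, zero_dvd_iff] at h
    omega
  obtain ⟨m, hm⟩ := (Nat.sInf_mem hne).2 r (shadow_subset_dualEven hr)
  obtain ⟨t, rfl⟩ := h
  refine ⟨t * m, ?_⟩
  have hm' : (level β : ℚ) * (β.baseChange ℚ r r / 2) = m := hm
  push_cast
  linear_combination (t : ℚ) * hm'

theorem dvd_mul_of_div_gcd_dvd {h : ℤ} {N : ℕ} (hN : 24 / Int.gcd h 24 ∣ N) :
    (24 : ℤ) ∣ h * N := by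
  obtain ⟨t, rfl⟩ := hN
  obtain ⟨u, hu⟩ := Int.gcd_dvd_left (a := h) (b := 24)
  have h1 : ((24 / Int.gcd h 24 : ℕ) : ℤ) * Int.gcd h 24 = 24 := by
    exact_mod_cast Nat.div_mul_cancel (by exact_mod_cast Int.gcd_dvd_right (a := h) (b := 24))
  refine ⟨u * t, ?_⟩
  push_cast at h1 ⊢
  linear_combination (((24 : ℤ) / (Int.gcd h 24 : ℤ)) * t) * hu + (u * t) * h1

/-! ### The isomorphism -/

variable [Module.Free ℤ L] [Module.Finite ℤ L]

namespace OrthFrame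

/-- The isomorphism `W(L) → Θ(L)`. -/
def thetaEquiv (F : OrthFrame β) (hsymm : β.IsSymm) :
    W β ≃ₗ[ℂ] (F.thetaSubrep hsymm).toSubmodule :=
  (LinearEquiv.ofInjective (F.thetaLin hsymm) fun lam lam' h ↦
    Subtype.ext (F.eq_of_basicTheta_eq hsymm lam.2 lam'.2 UpperHalfPlane.I fun z ↦
      congrFun (congrFun h UpperHalfPlane.I) z)).trans
    (LinearEquiv.ofEq _ _ (F.thetaSpace_eq_range hsymm).symm)

theorem coe_thetaEquiv (F : OrthFrame β) (hsymm : β.IsSymm) (lam : W β) :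
    (F.thetaEquiv hsymm lam : ℍ → (ℂ ⊗[ℤ] L) → ℂ) = basicTheta β lam := rfl

theorem exists_eq_sum_tmul (F : OrthFrame β) (hsymm : β.IsSymm) {ι : Type*} [Fintype ι]
    (lam : Module.Basis ι ℂ (W β)) (M : Submodule ℂ (ℍ → ℂ))
    (x : M ⊗[ℂ] ((F.thetaSubrep hsymm).toSubmodule ⊗[ℂ] ℂ)) :
    ∃ f : ι → M, x = ∑ i, f i ⊗ₜ (F.thetaEquiv hsymm (lam i) ⊗ₜ (1 : ℂ)) := by
  classical
  obtain ⟨g, hg⟩ := TensorProduct.eq_repr_basis_right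
    ((lam.map (F.thetaEquiv hsymm)).map (TensorProduct.rid ℂ _).symm) x
  refine ⟨g, ?_⟩
  rw [← hg, Finsupp.sum_fintype _ _ (fun i ↦ by simp)]
  simp

theorem thetaMap_sum (F : OrthFrame β) (hsymm : β.IsSymm) {ι : Type*} [Fintype ι]
    (lam : ι → W β) (M : Submodule ℂ (ℍ → ℂ)) (f : ι → M) (τ : ℍ) (z : ℂ ⊗[ℤ] L) :
    thetaMap M (F.thetaSubrep hsymm).toSubmodule
      (∑ i, f i ⊗ₜ (F.thetaEquiv hsymm (lam i) ⊗ₜ (1 : ℂ))) τ z =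
      ∑ i, (f i : ℍ → ℂ) τ * basicTheta β (lam i) τ z := by
  rw [map_sum, Finset.sum_apply, Finset.sum_apply]
  refine Finset.sum_congr rfl fun i _ ↦ ?_
  rw [thetaMap_tmul, one_mul, coe_thetaEquiv]

/-- A tensor has a normal form `∑ fᵢ ⊗ ϑᵢ ⊗ 1` along a basis of `W(L)`; linear independence of the
`ϑᵢ` at each `τ` makes every `fᵢ(τ)` vanish. -/
theorem thetaMap_injective (F : OrthFrame β) (hsymm : β.IsSymm) (M : Submodule ℂ (ℍ → ℂ)) :
    Function.Injective (thetaMap M (F.thetaSubrep hsymm).toSubmodule) := by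
  have := F.finiteDimensional_W
  rw [injective_iff_map_eq_zero]
  intro x hx
  obtain ⟨f, rfl⟩ := F.exists_eq_sum_tmul hsymm (Module.finBasis ℂ (W β)) M x
  have h1 : ∀ i, f i = 0 := fun i ↦ by
    refine Subtype.ext (funext fun τ ↦ ?_)
    have h2 := F.coeff_unique hsymm (Module.finBasis ℂ (W β)) τ
      (a := fun i ↦ (f i : ℍ → ℂ) τ) (b := 0) fun z ↦ by
        rw [← F.thetaMap_sum hsymm (Module.finBasis ℂ (W β)) M f τ z, hx]
        simp
    exact congrFun h2 i
  simp [h1]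

/-- The multiplication map is an isomorphism onto the space of Jacobi forms if all theta expansions
have coefficients in `M`. -/
theorem thetaExpansionIso (F : OrthFrame β) (hsymm : β.IsSymm) {k h : ℤ}
    (M : Subrepresentation (slashRep (k - Module.finrank ℤ L)))
    (hM : M.toSubmodule ≤ modularForms (k - Module.finrank ℤ L))
    (hexp : ∀ (ι : Type) [Fintype ι] (lam : Module.Basis ι ℂ (W β)), ∀ φ ∈ jacobiForms β k h,
      ∃ f : ι → ℍ → ℂ, (∀ i, f i ∈ M.toSubmodule) ∧
        ∀ τ z, φ τ z = ∑ i, f i τ * basicTheta β (lam i) τ z) :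
    ThetaExpansionIso β k h M (F.thetaSubrep hsymm) := by
  have := F.finiteDimensional_W
  set T := F.thetaSubrep hsymm
  have hmem : ∀ x ∈ (tensorRep β M T (eps ^ h)).invariants,
      thetaMap M.toSubmodule T.toSubmodule x ∈ jacobiForms β k h := fun x hx ↦ by
    obtain ⟨f, hf⟩ := F.exists_eq_sum_tmul hsymm (Module.finBasis ℂ (W β)) M.toSubmodule x
    refine F.mem_jacobiForms hsymm (Module.finBasis ℂ (W β)) (fun i ↦ hM (f i).2)
      (fun τ z ↦ ?_) fun α τ z ↦ ?_
    · rw [hf]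
      exact F.thetaMap_sum hsymm _ M.toSubmodule f τ z
    · have h1 := thetaMap_tensorRep M T (eps ^ h) α⁻¹ x
      rw [(Representation.mem_invariants _ _).1 hx, inv_inv] at h1
      conv_rhs => rw [h1]
      simp [mul_inv_cancel_left₀ (zpow_ne_zero h (eps α).ne_zero)]
  have hsurj : ∀ φ ∈ jacobiForms β k h, ∃ x ∈ (tensorRep β M T (eps ^ h)).invariants,
      thetaMap M.toSubmodule T.toSubmodule x = φ := fun φ hφ ↦ by
    obtain ⟨f, hf, hsum⟩ := hexp _ (Module.finBasis ℂ (W β)) φ hφ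
    refine ⟨∑ i, (⟨f i, hf i⟩ : M.toSubmodule) ⊗ₜ
      (F.thetaEquiv hsymm (Module.finBasis ℂ (W β) i) ⊗ₜ (1 : ℂ)), ?_, ?_⟩
    all_goals
      have h1 := funext₂ fun τ z ↦ (F.thetaMap_sum hsymm (Module.finBasis ℂ (W β)) M.toSubmodule
        (fun i ↦ ⟨f i, hf i⟩) τ z).trans (hsum τ z).symm
    -- By injectivity, invariance of the tensor may be checked on its image `φ`, where it is the
    -- transformation law of `φ`.
    · refine (Representation.mem_invariants _ _).2 fun α ↦ F.thetaMap_injective hsymm _ ?_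
      rw [thetaMap_tensorRep, h1]
      funext τ z
      have h2 := hφ.2.1 α⁻¹ τ z
      simp only [Pi.smul_apply, smul_eq_mul]
      rw [h2, ← mul_assoc, ← Units.val_mul, ← map_mul, mul_inv_cancel]
      simp
    · exact h1
  let Ψ : (tensorRep β M T (eps ^ h)).invariants →ₗ[ℂ] jacobiForms β k h :=
    LinearMap.codRestrict _ (thetaMap M.toSubmodule T.toSubmodule ∘ₗ Submodule.subtype _)
      fun x ↦ hmem x.1 x.2
  have hΨ : Function.Bijective Ψ := by
    refine ⟨fun x y hxy ↦ ?_, fun φ ↦ ?_⟩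
    · exact Subtype.ext (F.thetaMap_injective hsymm _ (congrArg Subtype.val hxy))
    · obtain ⟨x, hx, hxφ⟩ := hsurj φ.1 φ.2
      exact ⟨⟨x, hx⟩, Subtype.ext hxφ⟩
  refine ⟨⟨LinearEquiv.ofBijective Ψ hΨ, fun x ↦ rfl⟩, fun ι _ lam φ ↦ ?_⟩
  · obtain ⟨f, hf, hsum⟩ := hexp ι lam φ.1 φ.2
    refine ⟨fun i ↦ ⟨f i, hf i⟩, hsum, fun g hg ↦ funext fun i ↦ Subtype.ext (funext fun τ ↦ ?_)⟩
    exact congrFun (F.coeff_unique hsymm lam τ (a := fun i ↦ (g i : ℍ → ℂ) τ)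
      (b := fun i ↦ f i τ) fun z ↦ by rw [← hg τ z, hsum τ z]) i

end OrthFrame

end Lattice

end LatticeJacobi

end

open LatticeJacobi in
/-- The weight is `k / 2` with `k : ℤ`, so that it runs through `½ℤ`, and `k - n` is twice the
weight `k / 2 - n / 2`. -/
theorem theorem2p3 {L : Type*} [AddCommGroup L] [Module.Free ℤ L] [Module.Finite ℤ L]
    (β : LinearMap.BilinForm ℤ L) (hsymm : β.IsSymm) (hpos : ∀ x : L, x ≠ 0 → 0 < β x x)
    (n : ℕ) (hn : Module.finrank ℤ L = n) (k h : ℤ) :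
    ∃ T : Subrepresentation (jacobiRep β n), T.toSubmodule = thetaSpace β ∧
      (∃ M : Subrepresentation (slashRep (k - n)), M.toSubmodule = modularForms (k - n) ∧
        ThetaExpansionIso β k h M T) ∧
      ∀ N : ℕ, 0 < N → level β ∣ N → 24 / Int.gcd h 24 ∣ N → (Even (k - n) ∨ 4 ∣ N) →
        ∃ M : Subrepresentation (slashRep (k - n)),
          M.toSubmodule = modularFormsLevel (k - n) N ∧ ThetaExpansionIso β k h M T := by
  subst hn
  obtain ⟨F⟩ := nonempty_orthFrame hsymm hpos
  refine ⟨F.thetaSubrep hsymm, rfl, ⟨modularSubrep _, rfl,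
    F.thetaExpansionIso hsymm _ le_rfl fun ι _ lam φ hφ ↦ ?_⟩, fun N hN hlevel h24 h4 ↦
    ⟨levelSubrep _ h4, rfl, F.thetaExpansionIso hsymm _ (fun f hf ↦ ⟨N, hN, h4, hf⟩)
      fun ι _ lam φ hφ ↦ F.exists_theta_expansion hsymm (mul_quad_of_level_dvd hN hlevel)
        (dvd_mul_of_div_gcd_dvd h24) h4 hφ lam⟩⟩
  -- For the union over all levels a single sufficiently divisible level serves every `φ`:
  -- `thetaLevel` makes `β` integral on the shadow and is a multiple of `24`.
  have hdvd : 24 ∣ F.thetaLevel := Dvd.intro _ rfl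
  have h4 : 4 ∣ F.thetaLevel := dvd_trans (by norm_num) hdvd
  obtain ⟨f, hf, hsum⟩ := F.exists_theta_expansion hsymm (F.thetaLevel_mul_quad hsymm)
    ((Int.natCast_dvd_natCast.2 hdvd).mul_left h) (Or.inr h4) hφ lam
  exact ⟨f, fun i ↦ ⟨_, F.thetaLevel_pos, Or.inr h4, hf i⟩, hsum⟩
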